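/- Let $p$ be a prime, let $k$ be a perfect commutative ring of characteristic $p$ (for example a perfect field), let $e\geq 1$, and let $F=(F_1,\dots,F_e)$, $F_s\in k[[X_1,\dots,X_e,Y_1,\dots,Y_e]]$, be an $e$-dimensional formal group law over $k$, i.e. $F(X,0)=X$, $F(0,Y)=Y$ and $F(F(X,Y),Z)=F(X,F(Y,Z))$ (commutativity is not assumed). An $F$-field is a field $K$ which is a $k$-algebra, together with an $F$-derivation, i.e. a $k$-algebra homomorphism $\mathbb D:K\to K[[X_1,\dots,X_e]]$, $\mathbb D(r)=\sum_{\mathbf i\in\mathbb N^e}D_{\mathbf i}(r)X^{\mathbf i}$, such that $D_{\mathbf 0}=\mathrm{id}$ and $$\sum_{\mathbf i,\mathbf j}D_{\mathbf j}(D_{\mathbf i}(r))\,V^{\mathbf i}W^{\mathbf j}=\sum_{\mathbf n}D_{\mathbf n}(r)\,F(V,W)^{\mathbf n}\qquad(r\in K).$$ It is strict if $\{x\in K : D_{(1,0,\dots,0)}(x)=\dots=D_{(0,\dots,0,1)}(x)=0\}=K^p$. The degree of imperfection of $K$ is $e$ if $[K:K^p]=p^e$. Let $L_e$ be the language of rings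 expanded by constants for the elements of $k$ and by unary function symbols $D_{\mathbf i}$, $\mathbf i\in\mathbb N^e$. Let $F\text{-}\mathrm{DF}$ be the $L_e$-theory of $F$-fields, and let $F\text{-}\mathrm{DCF}$ be the $L_e$-theory of strict $F$-fields which are separably closed and of degree of imperfection $e$. Theorem. The theory $F\text{-}\mathrm{DCF}$ is a model completion of the theory $F\text{-}\mathrm{DF}$: every model of either theory embeds into a model of the other one, $F\text{-}\mathrm{DCF}$ is model complete, and for every model $\mathbf K$ of $F\text{-}\mathrm{DF}$ the theory $F\text{-}\mathrm{DCF}\cup\mathrm{Diag}(\mathbf K)$ is complete. Moreover, $F\text{-}\mathrm{DCF}$ has quantifier elimination in the language $L_e$ (in particular without adding a $p$-th root function $\lambda$). -/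

import Mathlib

universe u v w

noncomputable section

namespace FirstOrder.Language.Theory

open FirstOrder

variable {L : Language.{u, v}}

/-- A theory is model complete if every embedding between models is elementary. -/
def IsModelComplete (T : L.Theory) : Prop :=
  ∀ (M N : ModelType.{u, v, max u v w} T) (f : M ↪[L] N) (n : ℕ) (φ : L.Formula (Fin n))
    (x : Fin n → M), φ.Realize (f ∘ x) ↔ φ.Realize x

/-- `T'` is a model companion of `T`: every model of either theory embeds into a model of the
other one, and `T'` is model complete. -/
def IsModelCompanion (T T' : L.Theory) : Prop :=
  (∀ M : ModelType.{u, v, max u v w} T, ∃ N : ModelType.{u, v, max u v w} T',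
    Nonempty (M ↪[L] N)) ∧
  (∀ N : ModelType.{u, v, max u v w} T', ∃ M : ModelType.{u, v, max u v w} T,
    Nonempty (N ↪[L] M)) ∧
  IsModelComplete.{u, v, w} T'

variable (L) in
/-- The (atomic) diagram of a structure `M`: all atomic and negated atomic sentences with
parameters from `M` which are true in `M`. -/
def diagram (M : Type w) [L.Structure M] : L[[M]].Theory :=
  {φ | M ⊨ φ ∧ (BoundedFormula.IsAtomic φ ∨
    ∃ ψ : L[[M]].Sentence, BoundedFormula.IsAtomic ψ ∧ φ = Formula.not ψ)}

/-- `T'` is a model completion of `T`: it is a model companion of `T`, and for every model `M`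
of `T` the theory `T'` together with the diagram of `M` is complete. -/
def IsModelCompletion (T T' : L.Theory) : Prop :=
  IsModelCompanion.{u, v, w} T T' ∧
  ∀ M : ModelType.{u, v, max u v w} T,
    ((L.lhomWithConstants M).onTheory T' ∪ diagram L M).IsComplete

/-- A theory has quantifier elimination if modulo the theory every formula is equivalent to a
quantifier-free formula in the same free variables. -/
def HasQuantifierElimination (T : L.Theory) : Prop :=
  ∀ (n : ℕ) (φ : L.Formula (Fin n)),
    ∃ ψ : L.Formula (Fin n), BoundedFormula.IsQF ψ ∧ T ⊨ᵇ φ.iff ψ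

end FirstOrder.Language.Theory

open FirstOrder FirstOrder.Language MvPowerSeries

/-- An `e`-dimensional formal group law `F(X, Y) = (F_1(X, Y), …, F_e(X, Y))` over `k`.  The
variables `X` are indexed by `Sum.inl` and the variables `Y` by `Sum.inr`. -/
structure FormalGroupLaw (k : Type u) [CommRing k] (e : ℕ) where
  /-- The power series `F_s(X, Y)`. -/
  series : Fin e → MvPowerSeries (Fin e ⊕ Fin e) k
  /-- `F(X, 0) = X` -/
  right_unit : ∀ s, subst (Sum.elim (fun t ↦ X t) (fun _ ↦ 0) :
    Fin e ⊕ Fin e → MvPowerSeries (Fin e) k) (series s) = X s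
  /-- `F(0, Y) = Y` -/
  left_unit : ∀ s, subst (Sum.elim (fun _ ↦ 0) (fun t ↦ X t) :
    Fin e ⊕ Fin e → MvPowerSeries (Fin e) k) (series s) = X s
  /-- `F(F(X, Y), Z) = F(X, F(Y, Z))` -/
  assoc : ∀ s,
    subst (Sum.elim
      (fun t ↦ subst (Sum.elim (fun r ↦ X (Sum.inl r)) (fun r ↦ X (Sum.inr (Sum.inl r))) :
        Fin e ⊕ Fin e → MvPowerSeries (Fin e ⊕ Fin e ⊕ Fin e) k) (series t))
      (fun t ↦ X (Sum.inr (Sum.inr t))) :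
        Fin e ⊕ Fin e → MvPowerSeries (Fin e ⊕ Fin e ⊕ Fin e) k) (series s) =
    subst (Sum.elim
      (fun t ↦ X (Sum.inl t))
      (fun t ↦ subst (Sum.elim (fun r ↦ X (Sum.inr (Sum.inl r)))
        (fun r ↦ X (Sum.inr (Sum.inr r))) :
        Fin e ⊕ Fin e → MvPowerSeries (Fin e ⊕ Fin e ⊕ Fin e) k) (series t)) :
        Fin e ⊕ Fin e → MvPowerSeries (Fin e ⊕ Fin e ⊕ Fin e) k) (series s)

namespace FormalGroupLaw

variable {k : Type u} [CommRing k] {e : ℕ}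

/-- The structure constant `c_{i,j}^n`: the coefficient of `X^i Y^j` in `F(X, Y)^n`. -/
def structConst (F : FormalGroupLaw k e) (i j n : Fin e →₀ ℕ) : k :=
  MvPowerSeries.coeff (Finsupp.sumElim i j) (∏ s, F.series s ^ n s)

end FormalGroupLaw

/-- An `F`-derivation on a `k`-algebra `R`: an `e`-dimensional Hasse-Schmidt derivation
`𝔻 : R → R⟦X⟧`, `𝔻 r = ∑ D_i(r) X^i`, over `k` (a `k`-algebra homomorphism which is a section of
`H ↦ H(0)`) which is `F`-iterative, i.e.
`∑_{i,j} D_j(D_i(r)) V^i W^j = ∑_n D_n(r) F(V, W)^n` for all `r`. -/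
structure FDerivation {k : Type u} [CommRing k] {e : ℕ} (F : FormalGroupLaw k e)
    (R : Type w) [CommRing R] [Algebra k R] where
  /-- The underlying `k`-algebra homomorphism. -/
  toAlgHom : R →ₐ[k] MvPowerSeries (Fin e) R
  constantCoeff_apply : ∀ r, constantCoeff (toAlgHom r) = r
  iterative : ∀ (r : R) (i j : Fin e →₀ ℕ),
    MvPowerSeries.coeff j (toAlgHom (MvPowerSeries.coeff i (toAlgHom r))) =
      MvPowerSeries.coeff (Finsupp.sumElim i j)
        (subst (fun s ↦ (F.series s).map (algebraMap k R)) (toAlgHom r))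

namespace FDerivation

variable {k : Type u} [CommRing k] {e : ℕ} {F : FormalGroupLaw k e}
  {R : Type w} [CommRing R] [Algebra k R]

/-- The component `D_i` of an `F`-derivation. -/
def D (d : FDerivation F R) (i : Fin e →₀ ℕ) (r : R) : R := MvPowerSeries.coeff i (d.toAlgHom r)

/-- `(R, 𝔻)` is strict if its ring of constants `⋂_s ker D_{(0,…,1,…,0)}` is `R^p`. -/
def IsStrict (d : FDerivation F R) (p : ℕ) : Prop :=
  {r : R | ∀ s : Fin e, d.D (Finsupp.single s 1) r = 0} = Set.range fun r : R ↦ r ^ p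

end FDerivation

namespace HSLang

/-- The symbols added to the language of rings: constants for the elements of `k` and unary
function symbols `D_i` for multi-indices `i`. -/
inductive Func (k : Type u) (e : ℕ) : ℕ → Type u
  | const (c : k) : Func k e 0
  | deriv (i : Fin e →₀ ℕ) : Func k e 1

/-- The language consisting of the symbols added to the language of rings. -/
def extra (k : Type u) (e : ℕ) : FirstOrder.Language.{u, 0} := ⟨Func k e, fun _ ↦ Empty⟩

end HSLang

/-- The language of `k`-algebras with `e`-dimensional HS-derivations. -/
abbrev HSLang (k : Type u) (e : ℕ) : FirstOrder.Language.{u, 0} := Language.ring.sum (HSLang.extra k e)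

namespace HSLang

variable {k : Type u} {e : ℕ} {α : Type v}

/-- A symbol of the language of rings. -/
abbrev ringSym {n : ℕ} (f : Language.ring.Functions n) : (HSLang k e).Functions n := Sum.inl f

/-- The constant symbol for an element of `k`. -/
abbrev cstSym (c : k) : (HSLang k e).Functions 0 := Sum.inr (Func.const c)

/-- The unary function symbol `D_i`. -/
abbrev derivSym (i : Fin e →₀ ℕ) : (HSLang k e).Functions 1 := Sum.inr (Func.deriv i)

/-- The constant symbol for an element of `k`, as a term. -/
def cst (c : k) : (HSLang k e).Term α :=
  Constants.term (cstSym c)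

/-- The term `D_i(t)`. -/
def D (i : Fin e →₀ ℕ) (t : (HSLang k e).Term α) : (HSLang k e).Term α :=
  Functions.apply₁ (derivSym i) t

instance : Zero ((HSLang k e).Term α) :=
  ⟨Constants.term (ringSym Ring.zeroFunc)⟩

instance : One ((HSLang k e).Term α) :=
  ⟨Constants.term (ringSym Ring.oneFunc)⟩

instance : Add ((HSLang k e).Term α) :=
  ⟨Functions.apply₂ (ringSym Ring.addFunc)⟩

instance : Mul ((HSLang k e).Term α) :=
  ⟨Functions.apply₂ (ringSym Ring.mulFunc)⟩

/-- The term `t ^ n`. -/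
def pow (t : (HSLang k e).Term α) : ℕ → (HSLang k e).Term α
  | 0 => 1
  | n + 1 => pow t n * t

/-- The term `∑ a ∈ s, f a`, for some enumeration of the finite set `s`. -/
def finSum {ι : Type*} (s : Finset ι) (f : ι → (HSLang k e).Term α) : (HSLang k e).Term α :=
  (s.toList.map f).foldr (· + ·) 0

/-- The variable which will be bound by the next quantifier block. -/
abbrev x {β : Type} (b : β) : (HSLang k e).Term (α ⊕ β) := Term.var (Sum.inr b)

/-- The variable which will be bound by the second next quantifier block. -/
abbrev y {β γ : Type} (b : β) : (HSLang k e).Term ((α ⊕ β) ⊕ γ) := Term.var (Sum.inl (Sum.inr b))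

end HSLang

open HSLang

/-- The axioms for the constants of `k` and for the HS-derivation, apart from iterativity. -/
inductive HSAxiom (k : Type u) (e : ℕ) : Type u
  | cstOne
  | cstAdd (a b : k)
  | cstMul (a b : k)
  | derivZero
  | derivAdd (i : Fin e →₀ ℕ)
  | derivSMul (i : Fin e →₀ ℕ) (c : k)
  | derivMul (i : Fin e →₀ ℕ)

/-- The axioms as first-order sentences. -/
def HSAxiom.toSentence {k : Type u} [CommRing k] {e : ℕ} : HSAxiom k e → (HSLang k e).Sentence
  | cstOne => (cst 1).equal 1
  | cstAdd a b => (cst (a + b)).equal (cst a + cst b)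
  | cstMul a b => (cst (a * b)).equal (cst a * cst b)
  | derivZero => Formula.iAlls (Fin 1) ((D 0 (x 0)).equal (x 0))
  | derivAdd i => Formula.iAlls (Fin 2) ((D i (x 0 + x 1)).equal (D i (x 0) + D i (x 1)))
  | derivSMul i c => Formula.iAlls (Fin 1) ((D i (cst c * x 0)).equal (cst c * D i (x 0)))
  | derivMul i => Formula.iAlls (Fin 2) ((D i (x 0 * x 1)).equal
      (finSum (Finset.HasAntidiagonal.antidiagonal i) fun jl ↦ D jl.1 (x 0) * D jl.2 (x 1)))

/-- The axiom `D_j(D_i(x)) = ∑_n c_{i,j}^n D_n(x)`.  As the power series of a formal group law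
have no constant term, `c_{i,j}^n = 0` unless `|n| ≤ |i| + |j|`, so that it suffices to sum over
the finite box of all `n` with entries at most `|i| + |j|`. -/
def iterAxiom {k : Type u} [CommRing k] {e : ℕ} (F : FormalGroupLaw k e) (i j : Fin e →₀ ℕ) :
    (HSLang k e).Sentence :=
  Formula.iAlls (Fin 1) ((D j (D i (x 0))).equal
    (finSum (Finset.Icc 0 (Finsupp.equivFunOnFinite.symm fun _ ↦ i.degree + j.degree))
      fun n ↦ cst (F.structConst i j n) * D n (x 0)))

/-- The theory `F-DF` of `F`-fields. -/
def FDF {k : Type u} [CommRing k] {e : ℕ} (F : FormalGroupLaw k e) : (HSLang k e).Theory :=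
  (LHom.sumInl : Language.ring →ᴸ HSLang k e).onTheory Theory.field ∪
    Set.range HSAxiom.toSentence ∪ Set.range fun ij : (Fin e →₀ ℕ) × (Fin e →₀ ℕ) ↦
      iterAxiom F ij.1 ij.2

/-- Strictness: `x` is a constant if and only if it is a `p`-th power. -/
def strictAxiom (k : Type u) (e p : ℕ) : (HSLang k e).Sentence :=
  Formula.iAlls (Fin 1) (Formula.iff
    (Formula.iInf fun s : Fin e ↦ (D (Finsupp.single s 1) (x 0)).equal 0)
    (Formula.iExs (Fin 1) ((pow (x 0) p).equal (y 0))))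

/-- Separably closed (in characteristic `p`): every polynomial `f = ∑_{i ≤ n} y_i T^i` with
`f' ≠ 0`, i.e. with `y_i ≠ 0` for some `i` not divisible by `p`, has a root. -/
def sepClosedAxiom (k : Type u) (e p n : ℕ) : (HSLang k e).Sentence :=
  Formula.iAlls (Fin (n + 1)) (Formula.imp
    (Formula.iSup fun i : {i : Fin (n + 1) // ¬ p ∣ i} ↦ Formula.not ((x i.1).equal 0))
    (Formula.iExs (Fin 1) ((finSum Finset.univ fun i : Fin (n + 1) ↦ y i * pow (x 0) i).equal 0)))

/-- Degree of imperfection `e`, i.e. `[K : K^p] = p^e`: there are `p^e` elements which are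
linearly independent over `K^p` and span `K` over `K^p`. -/
def imperfectionAxiom (k : Type u) (e p : ℕ) : (HSLang k e).Sentence :=
  Formula.iExs (Fin (p ^ e)) (
    Formula.iAlls (Fin (p ^ e)) (Formula.imp
      ((finSum Finset.univ fun i ↦ pow (x i) p * y i).equal 0)
      (Formula.iInf fun i ↦ (x i).equal 0)) ⊓
    Formula.iAlls (Fin 1) (Formula.iExs (Fin (p ^ e))
      (Term.equal (y 0)
        (finSum Finset.univ fun i ↦ pow (x i) p * Term.var (Sum.inl (Sum.inl (Sum.inr i)))))))

/-- The theory `F-DCF` of strict `F`-fields which are separably closed and of degree of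
imperfection `e`, where the base ring has characteristic `p`. -/
def FDCF (p : ℕ) {k : Type u} [CommRing k] {e : ℕ} (F : FormalGroupLaw k e) :
    (HSLang k e).Theory :=
  FDF F ∪ {strictAxiom k e p} ∪ Set.range (sepClosedAxiom k e p) ∪ {imperfectionAxiom k e p}

/-! ### The models of `F-DF` are the `F`-fields, and the models of `F-DCF` are the strict, separably
closed `F`-fields of degree of imperfection `e` -/

section Characterization

set_option linter.all false

/-- The ring symbols are interpreted by the ring operations of `M`, the constants of `k` by `c`,
and the symbols `D_i` by `δ i`. -/
structure HSLang.Interp {k : Type u} {e : ℕ} (M : Type w) [CommRing M] [(HSLang k e).Structure M]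
    (c : k → M) (δ : (Fin e →₀ ℕ) → M → M) : Prop where
  add : ∀ x, Structure.funMap (L := HSLang k e) (ringSym Ring.addFunc) x = (x 0 + x 1 : M)
  mul : ∀ x, Structure.funMap (L := HSLang k e) (ringSym Ring.mulFunc) x = (x 0 * x 1 : M)
  neg : ∀ x, Structure.funMap (L := HSLang k e) (ringSym Ring.negFunc) x = (- x 0 : M)
  zero : ∀ x, Structure.funMap (L := HSLang k e) (ringSym Ring.zeroFunc) x = (0 : M)
  one : ∀ x, Structure.funMap (L := HSLang k e) (ringSym Ring.oneFunc) x = (1 : M)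
  cst : ∀ a x, Structure.funMap (L := HSLang k e) (cstSym a) x = c a
  deriv : ∀ i x, Structure.funMap (L := HSLang k e) (derivSym i) x = δ i (x 0)

namespace HSLang.Interp
variable {k : Type u} {e : ℕ} {M : Type w} [CommRing M] [S : (HSLang k e).Structure M]
    {c : k → M} {δ : (Fin e →₀ ℕ) → M → M} {α : Type v}

lemma realize_add (h : Interp M c δ) (v : α → M) (s t :
    (HSLang k e).Term α) : (s + t).realize v = s.realize v + t.realize v := by
  show Term.realize v (Functions.apply₂ (L := HSLang k e) (ringSym Ring.addFunc) s t) = _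
  rw [Term.realize_functions_apply₂]; exact h.add _
lemma realize_mul (h : Interp M c δ) (v : α → M) (s t :
    (HSLang k e).Term α) : (s * t).realize v = s.realize v * t.realize v := by
  show Term.realize v (Functions.apply₂ (L := HSLang k e) (ringSym Ring.mulFunc) s t) = _
  rw [Term.realize_functions_apply₂]; exact h.mul _
lemma realize_zero (h : Interp M c δ) (v : α → M) :
    (0 : (HSLang k e).Term α).realize v = 0 := by
  show Term.realize v (Constants.term (L := HSLang k e) (ringSym Ring.zeroFunc)) = _
  rw [Term.realize_constants]; exact h.zero _
lemma realize_one (h : Interp M c δ) (v : α → M) :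
    (1 : (HSLang k e).Term α).realize v = 1 := by
  show Term.realize v (Constants.term (L := HSLang k e) (ringSym Ring.oneFunc)) = _
  rw [Term.realize_constants]; exact h.one _
lemma realize_cst (h : Interp M c δ) (v : α → M) (a : k) :
    (HSLang.cst a : (HSLang k e).Term α).realize v = c a := by
  unfold HSLang.cst
  rw [Term.realize_constants]; exact h.cst _ _
lemma realize_D (h : Interp M c δ) (v : α → M) (i) (t :
    (HSLang k e).Term α) : (HSLang.D i t).realize v = δ i (t.realize v) := by
  unfold HSLang.D
  rw [Term.realize_functions_apply₁]; exact h.deriv i _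
lemma realize_pow (h : Interp M c δ) (v : α → M) (t :
    (HSLang k e).Term α) (n : ℕ) : (HSLang.pow t n).realize v = (t.realize v) ^ n := by
  induction n with
  | zero => simp [HSLang.pow, h.realize_one]
  | succ n ih => simp [HSLang.pow, h.realize_mul, ih, pow_succ]
lemma realize_finSum (h : Interp M c δ) (v : α → M) {ι : Type*} (s : Finset ι) (f : ι → (HSLang k e).Term α) :
    (HSLang.finSum s f).realize v = ∑ a ∈ s, (f a).realize v := by
  rw [← Finset.sum_map_toList]
  unfold HSLang.finSum
  induction s.toList with
  | nil => simp [h.realize_zero]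
  | cons a l ih => simp [h.realize_add, ih]

lemma model_hsAxiom (h : Interp M c δ) [CommRing k] (a : HSAxiom k e) : M ⊨ a.toSentence ↔ match a with
  | .cstOne => c 1 = 1
  | .cstAdd a b => c (a + b) = c a + c b
  | .cstMul a b => c (a * b) = c a * c b
  | .derivZero => ∀ x, δ 0 x = x
  | .derivAdd i => ∀ x y, δ i (x + y) = δ i x + δ i y
  | .derivSMul i a => ∀ x, δ i (c a * x) = c a * δ i x
  | .derivMul i => ∀ x y, δ i (x * y) =
      ∑ jl ∈ Finset.HasAntidiagonal.antidiagonal i, δ jl.1 x * δ jl.2 y := by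
  cases a <;> simp [HSAxiom.toSentence, Sentence.Realize, h.realize_add, h.realize_mul, h.realize_zero, h.realize_one,
    h.realize_cst, h.realize_D, h.realize_finSum, Fin.forall_fin_succ_pi, Fin.forall_fin_zero_pi]

lemma model_iterAxiom (h : Interp M c δ) [CommRing k] (F : FormalGroupLaw k e) (i j) : M ⊨ iterAxiom F i j ↔
    ∀ x, δ j (δ i x) = ∑ n ∈ Finset.Icc 0 (Finsupp.equivFunOnFinite.symm fun _ ↦ i.degree + j.degree),
      c (F.structConst i j n) * δ n x := by
  simp [iterAxiom, Sentence.Realize, h.realize_add, h.realize_mul, h.realize_zero, h.realize_one,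
    h.realize_cst, h.realize_D, h.realize_finSum, Fin.forall_fin_succ_pi, Fin.forall_fin_zero_pi]

lemma model_field (h : Interp M c δ) : M ⊨ (LHom.sumInl : Language.ring →ᴸ HSLang k e).onTheory Theory.field ↔ IsField M := by
  letI : Language.ring.Structure M := (LHom.sumInl : Language.ring →ᴸ HSLang k e).reduct M
  letI : Ring.CompatibleRing M :=
    { (inferInstance : Language.ring.Structure M) with
      funMap_add := h.add
      funMap_mul := h.mul
      funMap_neg := h.neg
      funMap_zero := h.zero
      funMap_one := h.one }
  haveI : (LHom.sumInl : Language.ring →ᴸ HSLang k e).IsExpansionOn M := ⟨fun _ _ => rfl, fun _ _ => rfl⟩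
  rw [LHom.onTheory_model]
  constructor
  · intro hm
    exact ⟨Field.FieldAxiom.existsPairNE.toProp_of_model (K := M), mul_comm,
      fun {a} ha => Field.FieldAxiom.existsInv.toProp_of_model (K := M) a ha⟩
  · intro hf
    letI := hf.toField
    infer_instance

lemma model_strictAxiom (h : Interp M c δ) (p : ℕ) : M ⊨ strictAxiom k e p ↔
    {r : M | ∀ s : Fin e, δ (Finsupp.single s 1) r = 0} = Set.range fun r : M ↦ r ^ p := by
  simp [strictAxiom, Sentence.Realize, h.realize_add, h.realize_mul, h.realize_zero, h.realize_one,
    h.realize_cst, h.realize_D, h.realize_finSum, h.realize_pow, Fin.forall_fin_succ_pi, Fin.forall_fin_zero_pi, Fin.exists_fin_succ_pi, Fin.exists_fin_zero_pi, Set.ext_iff]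

lemma model_sepClosedAxiom (h : Interp M c δ) (p n : ℕ) : M ⊨ sepClosedAxiom k e p n ↔
    ∀ a : Fin (n+1) → M, (∃ i : Fin (n+1), ¬ p ∣ i ∧ a i ≠ 0) → ∃ x, ∑ i, a i * x ^ (i : ℕ) = 0 := by
  simp [sepClosedAxiom, Sentence.Realize, h.realize_add, h.realize_mul, h.realize_zero, h.realize_one,
    h.realize_cst, h.realize_D, h.realize_finSum, h.realize_pow, Fin.exists_fin_succ_pi, Fin.exists_fin_zero_pi]

lemma model_imperfectionAxiom (h : Interp M c δ) (p : ℕ) : M ⊨ imperfectionAxiom k e p ↔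
    ∃ y : Fin (p ^ e) → M, (∀ a : Fin (p ^ e) → M, ∑ i, a i ^ p * y i = 0 → ∀ i, a i = 0) ∧
     ∀ x, ∃ a : Fin (p ^ e) → M, x = ∑ i, a i ^ p * y i := by
  simp [imperfectionAxiom, Sentence.Realize, h.realize_add, h.realize_mul, h.realize_zero, h.realize_one,
    h.realize_cst, h.realize_D, h.realize_finSum, h.realize_pow, Fin.forall_fin_succ_pi, Fin.forall_fin_zero_pi]
end HSLang.Interp

namespace FormalGroupLaw
variable {k : Type u} [CommRing k] {e : ℕ} (F : FormalGroupLaw k e)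

lemma constantCoeff_series (s) : constantCoeff (F.series s) = 0 := by
  have ha : HasSubst (Sum.elim (fun t ↦ X t) (fun _ ↦ 0) :
    Fin e ⊕ Fin e → MvPowerSeries (Fin e) k) := hasSubst_of_constantCoeff_zero (by rintro (a|a) <;> simp)
  have h1 := F.right_unit s
  have h2 := constantCoeff_subst_eq_zero ha (by rintro (a|a) <;> simp)
    (f := F.series s - C (constantCoeff (F.series s))) (by simp)
  rw [← coe_substAlgHom ha] at h1 h2
  rw [map_sub, h1, coe_substAlgHom, subst_C] at h2
  simpa using h2

lemma structConst_eq_zero (i j n : Fin e →₀ ℕ) (h : ¬ n ∈ Finset.Icc 0 (Finsupp.equivFunOnFinite.symm fun _ : Fin e ↦ i.degree + j.degree)) :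
    F.structConst i j n = 0 := by
  apply coeff_of_lt_order
  have h1 : ((n.degree : ℕ) : ℕ∞) ≤ (∏ s, F.series s ^ n s).order := by
    refine le_trans ?_ (le_order_prod _ _)
    rw [Finsupp.degree_eq_sum, Nat.cast_sum]
    refine Finset.sum_le_sum fun s _ => le_order_pow_of_constantCoeff_eq_zero _ (F.constantCoeff_series s)
  refine lt_of_lt_of_le ?_ h1
  rw [Nat.cast_lt]
  have : ∃ s, i.degree + j.degree < n s := by
    by_contra! hc
    exact h (by simp only [Finset.mem_Icc, zero_le, true_and]; intro s; simpa using hc s)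
  obtain ⟨s, hs⟩ := this
  have h3 : (Finsupp.sumElim i j).degree = i.degree + j.degree := by
    simp [Finsupp.degree_eq_sum]
  rw [h3]
  exact lt_of_lt_of_le hs (Finsupp.le_degree s n)

lemma coeff_subst_series {R : Type w} [CommRing R] [Algebra k R] (f : MvPowerSeries (Fin e) R) (i j : Fin e →₀ ℕ) :
    MvPowerSeries.coeff (Finsupp.sumElim i j)
        (subst (fun s ↦ (F.series s).map (algebraMap k R)) f) =
      ∑ n ∈ Finset.Icc 0 (Finsupp.equivFunOnFinite.symm fun _ ↦ i.degree + j.degree),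
      algebraMap k R (F.structConst i j n) * MvPowerSeries.coeff n f := by
  have key : ∀ n : Fin e →₀ ℕ, MvPowerSeries.coeff (Finsupp.sumElim i j)
      (n.prod fun s e => ((F.series s).map (algebraMap k R)) ^ e) = algebraMap k R (F.structConst i j n) := by
    intro n
    rw [structConst, ← MvPowerSeries.coeff_map, map_prod, Finsupp.prod_fintype _ _ (by simp)]
    simp
  rw [coeff_subst (hasSubst_of_constantCoeff_zero (by simp [F.constantCoeff_series]))]
  simp only [key]
  rw [finsum_eq_sum_of_support_subset]
  · exact Finset.sum_congr rfl fun n _ => by rw [smul_eq_mul, mul_comm]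
  · intro n hn
    by_contra hc
    exact hn (by simp only [F.structConst_eq_zero i j n (by simpa using hc), map_zero, smul_zero])
end FormalGroupLaw

variable {k : Type u} [CommRing k] {e : ℕ} {F : FormalGroupLaw k e}

/-- The structure on `K` given by an `F`-derivation. -/
@[reducible] def FDerivation.toStructure {K : Type w} [CommRing K] [Algebra k K] (d : FDerivation F K) :
    (HSLang k e).Structure K where
  funMap := fun {n} f => match n, f with
    | _, Sum.inl .add => fun x => x 0 + x 1
    | _, Sum.inl .mul => fun x => x 0 * x 1
    | _, Sum.inl .neg => fun x => - x 0
    | _, Sum.inl .zero => fun _ => 0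
    | _, Sum.inl .one => fun _ => 1
    | _, Sum.inr (.const a) => fun _ => algebraMap k K a
    | _, Sum.inr (.deriv i) => fun x => d.D i (x 0)
  RelMap := fun {n} r => match r with
    | Sum.inl r => r.elim
    | Sum.inr r => r.elim

lemma FDerivation.interp {K : Type w} [CommRing K] [Algebra k K] (d : FDerivation F K) :
    letI := d.toStructure
    Interp K (algebraMap k K) d.D :=
  letI := d.toStructure
  ⟨fun _ => rfl, fun _ => rfl, fun _ => rfl, fun _ => rfl, fun _ => rfl, fun _ _ => rfl, fun _ _ => rfl⟩

/-- Every `F`-field is a model of `F-DF`. -/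
theorem FDerivation.model_FDF {K : Type w} [Field K] [Algebra k K] (d : FDerivation F K) :
    letI := d.toStructure
    K ⊨ FDF F := by
  letI := d.toStructure
  have h := d.interp
  simp only [FDF, Theory.model_union_iff]
  refine ⟨⟨h.model_field.2 (Field.toIsField K), ?_⟩, ?_⟩
  · rw [Theory.model_iff]
    rintro _ ⟨a, rfl⟩
    rw [h.model_hsAxiom]
    cases a with
    | derivZero => exact d.constantCoeff_apply
    | derivSMul i a => intro x; simp [FDerivation.D, ← Algebra.smul_def]
    | derivMul i => intro x y; simp [FDerivation.D, MvPowerSeries.coeff_mul]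
    | _ => simp [FDerivation.D]
  · rw [Theory.model_iff]
    rintro _ ⟨⟨i, j⟩, rfl⟩
    rw [h.model_iterAxiom]
    intro x
    exact (d.iterative x i j).trans (F.coeff_subst_series _ _ _)

/-- Every model of `F-DF` is an `F`-field. -/
theorem exists_FDerivation_of_model_FDF {K : Type w} [S : (HSLang k e).Structure K] (hK : K ⊨ FDF F) :
    ∃ (_ : Field K) (_ : Algebra k K) (d : FDerivation F K), S = d.toStructure := by
  simp only [FDF, Theory.model_union_iff] at hK
  obtain ⟨⟨h1, h2⟩, h3⟩ := hK
  letI R : Language.ring.Structure K := (LHom.sumInl : Language.ring →ᴸ HSLang k e).reduct K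
  haveI : (LHom.sumInl : Language.ring →ᴸ HSLang k e).IsExpansionOn K := ⟨fun _ _ => rfl, fun _ _ => rfl⟩
  rw [LHom.onTheory_model] at h1
  letI I := Field.fieldOfModelField K
  letI cr := Field.compatibleRingOfModelField K
  let c : k → K := fun a => Structure.funMap (L := HSLang k e) (cstSym a) ![]
  let δ : (Fin e →₀ ℕ) → K → K := fun i x =>
    Structure.funMap (L := HSLang k e) (derivSym i) ![x]
  have h : Interp K c δ := 
   { add := cr.funMap_add
     mul := cr.funMap_mul
     neg := cr.funMap_neg
     zero := cr.funMap_zero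
     one := cr.funMap_one
     cst := fun a x => congrArg _ (Subsingleton.elim _ _)
     deriv := fun i x => congrArg _ (funext fun a => by rw [Subsingleton.elim a 0]; rfl) }
  rw [Theory.model_iff] at h2 h3
  have h2' := fun a => (h.model_hsAxiom a).1 (h2 _ ⟨a, rfl⟩)
  have h3' := fun i j => (h.model_iterAxiom F i j).1 (h3 _ ⟨(i, j), rfl⟩)
  have c0 : c 0 = 0 := by simpa using h2' (.cstAdd 0 0)
  letI alg : Algebra k K := RingHom.toAlgebra
    { toFun := c, map_one' := h2' .cstOne, map_zero' := c0
      map_add' := fun a b => h2' (.cstAdd a b), map_mul' := fun a b => h2' (.cstMul a b) }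
  have hc : ∀ a, algebraMap k K a = c a := fun _ => rfl
  let f : K → MvPowerSeries (Fin e) K := fun x i => δ i x
  have hf : ∀ i x, MvPowerSeries.coeff i (f x) = δ i x := fun _ _ => rfl
  have d0 : ∀ i, δ i 0 = 0 := fun i => by simpa using h2' (.derivAdd i) 0 0
  have f0 : f 0 = 0 := by ext i; simp [hf, d0]
  have fadd : ∀ x y, f (x + y) = f x + f y := fun x y => by
    ext i; simpa [hf] using h2' (.derivAdd i) x y
  have fmul : ∀ x y, f (x * y) = f x * f y := fun x y => by
    ext i; simpa [hf, MvPowerSeries.coeff_mul] using h2' (.derivMul i) x y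
  have hcc : ∀ x, constantCoeff (f x) = x := fun x => by
    rw [← coeff_zero_eq_constantCoeff_apply, hf]; exact h2' .derivZero x
  have f1 : f 1 = 1 := by
    have : f 1 * f 1 = f 1 := by rw [← fmul, mul_one]
    have hne : f 1 ≠ 0 := fun h0 => by have := hcc 1; simp [h0] at this
    exact mul_left_cancel₀ hne (by rw [this, mul_one])
  have fc : ∀ a, f (c a) = algebraMap k _ a := fun a => by
    have : f (c a) = C (c a) * f 1 := by
      ext i; rw [coeff_C_mul, hf, hf, ← h2' (.derivSMul i a), mul_one]
    rw [this, f1, mul_one, MvPowerSeries.algebraMap_apply]; rfl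
  refine ⟨I, alg, ⟨{ toFun := f, map_one' := f1, map_zero' := f0, map_add' := fadd, map_mul' := fmul, commutes' := fc }, hcc, ?_⟩, ?_⟩
  · intro r i j
    rw [F.coeff_subst_series]
    exact h3' i j r
  · refine Language.Structure.ext ?_ ?_
    · funext n g x
      match n, g with
      | _, Sum.inl .add => exact h.add x
      | _, Sum.inl .mul => exact h.mul x
      | _, Sum.inl .neg => exact h.neg x
      | _, Sum.inl .zero => exact h.zero x
      | _, Sum.inl .one => exact h.one x
      | _, Sum.inr (.const a) => exact h.cst a x
      | _, Sum.inr (.deriv i) => exact h.deriv i x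
    · funext n g x
      match g with
      | Sum.inl r => exact r.elim
      | Sum.inr r => exact r.elim

open Polynomial in
lemma isSepClosed_iff_exists_root (p : ℕ) [Fact p.Prime] (K : Type w) [Field K] [CharP K p] :
    (∀ n, ∀ a : Fin (n+1) → K, (∃ i : Fin (n+1), ¬ p ∣ i ∧ a i ≠ 0) → ∃ x, ∑ i, a i * x ^ (i : ℕ) = 0)
    ↔ IsSepClosed K := by
  constructor
  · intro H
    refine IsSepClosed.of_exists_root _ fun f _ hirr hsep => ?_
    obtain ⟨x, hx⟩ := H f.natDegree (fun i => f.coeff i) (by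
      have hd : derivative f ≠ 0 := (separable_iff_derivative_ne_zero hirr).1 hsep
      by_contra! hc
      apply hd
      ext n
      rw [Polynomial.coeff_derivative, Polynomial.coeff_zero]
      by_cases hn : p ∣ n + 1
      · have : ((n : K) + 1) = 0 := by exact_mod_cast (CharP.cast_eq_zero_iff K p (n+1)).2 hn
        simp [this]
      · by_cases hl : n + 1 ≤ f.natDegree
        · rw [hc ⟨n+1, by omega⟩ hn, zero_mul]
        · rw [coeff_eq_zero_of_natDegree_lt (by omega), zero_mul])
    refine ⟨x, ?_⟩
    rw [eval_eq_sum_range, ← hx, Finset.sum_range]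
  · rintro H n a ⟨i, hi, hai⟩
    let f : K[X] := ∑ j : Fin (n+1), Polynomial.C (a j) * Polynomial.X ^ (j : ℕ)
    have hco : ∀ j : Fin (n+1), f.coeff j = a j := fun j => by
      simp [f, Polynomial.coeff_X_pow, Fin.val_inj]
    have hd : derivative f ≠ 0 := fun h0 => by
      have h1 := congrArg (fun g : K[X] => Polynomial.coeff g ((i:ℕ) - 1)) h0
      have hi0 : (i : ℕ) - 1 + 1 = i := by
        have : (i : ℕ) ≠ 0 := fun h => hi (h ▸ dvd_zero p)
        omega
      simp only [Polynomial.coeff_derivative, Polynomial.coeff_zero, hi0, hco] at h1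
      have : (((i : ℕ) - 1 : ℕ) : K) + 1 = ((i : ℕ) : K) := by exact_mod_cast congrArg (Nat.cast : ℕ → K) hi0
      rw [this] at h1
      rcases mul_eq_zero.1 h1 with h | h
      · exact hai h
      · exact hi ((CharP.cast_eq_zero_iff K p i).1 h)
    have : ∀ g : K[X], derivative g ≠ 0 → ∃ q, q ∣ g ∧ Irreducible q ∧ derivative q ≠ 0 := by
      intro g
      induction g using UniqueFactorizationMonoid.induction_on_prime with
      | h₁ => simp
      | h₂ u hu => intro h; obtain ⟨r, _, rfl⟩ := Polynomial.isUnit_iff.1 hu; simp at h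
      | h₃ g q hg hq ih =>
        intro h
        by_cases h1 : derivative q = 0
        · rw [derivative_mul, h1, zero_mul, zero_add] at h
          obtain ⟨r, hr, h2⟩ := ih (fun h3 => h (by rw [h3, mul_zero]))
          exact ⟨r, hr.mul_left _, h2⟩
        · exact ⟨q, dvd_mul_right _ _, hq.irreducible, h1⟩
    obtain ⟨q, hq, hirr, hq'⟩ := this f hd
    obtain ⟨x, hx⟩ := IsSepClosed.exists_root q (degree_pos_of_irreducible hirr).ne' ((separable_iff_derivative_ne_zero hirr).2 hq')
    refine ⟨x, ?_⟩
    have := hx.dvd hq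
    simpa [f, IsRoot, eval_finset_sum] using this

lemma finrank_fieldRange_frobenius_iff (p e : ℕ) [hp : Fact p.Prime] (K : Type w) [Field K] [CharP K p] :
    (∃ y : Fin (p ^ e) → K, (∀ a : Fin (p ^ e) → K, ∑ i, a i ^ p * y i = 0 → ∀ i, a i = 0) ∧
     ∀ x, ∃ a : Fin (p ^ e) → K, x = ∑ i, a i ^ p * y i) ↔
    Module.finrank (frobenius K p).fieldRange K = p ^ e := by
  have hfr : ∀ c : (frobenius K p).fieldRange, ∃ b : K, b ^ p = c := fun ⟨c, b, hb⟩ => ⟨b, hb⟩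
  constructor
  · rintro ⟨y, h1, h2⟩
    have li : LinearIndependent (frobenius K p).fieldRange y := by
      rw [Fintype.linearIndependent_iff]
      intro g hg i
      choose b hb using fun i => hfr (g i)
      have := h1 b (by simpa [Subfield.smul_def, hb] using hg) i
      ext; rw [← hb, this]; simp [hp.out.ne_zero]
    have sp : ⊤ ≤ Submodule.span (frobenius K p).fieldRange (Set.range y) := by
      rintro x -
      obtain ⟨a, rfl⟩ := h2 x
      refine Submodule.sum_mem _ fun i _ => ?_
      exact Submodule.smul_mem _ (⟨a i ^ p, a i, rfl⟩ : (frobenius K p).fieldRange) (Submodule.subset_span ⟨i, rfl⟩)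
    simpa using Module.finrank_eq_card_basis (Module.Basis.mk li sp)
  · intro h
    have : 0 < p ^ e := pow_pos hp.out.pos e
    have : Module.Finite (frobenius K p).fieldRange K := Module.finite_of_finrank_pos (by omega)
    let b := Module.finBasisOfFinrankEq _ _ h
    refine ⟨b, fun a ha i => ?_, fun x => ?_⟩
    · have := Fintype.linearIndependent_iff.1 b.linearIndependent
        (fun i => (⟨a i ^ p, a i, rfl⟩ : (frobenius K p).fieldRange)) (by simpa [Subfield.smul_def] using ha) i
      exact pow_eq_zero_iff hp.out.ne_zero |>.1 (congrArg Subtype.val this)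
    · choose a ha using fun i => hfr (b.repr x i)
      refine ⟨a, ?_⟩
      conv_lhs => rw [← b.sum_repr x]
      simp [Subfield.smul_def, ha]

/-- An `F`-field is a model of `F-DCF` if and only if it is strict, separably closed and of degree of
imperfection `e`, i.e. `[K : K^p] = p^e`. -/
theorem FDerivation.model_FDCF_iff (p : ℕ) [Fact p.Prime] {K : Type w} [Field K] [Algebra k K] [CharP K p] (d : FDerivation F K) :
    letI := d.toStructure
    K ⊨ FDCF p F ↔ d.IsStrict p ∧ IsSepClosed K ∧ Module.finrank (frobenius K p).fieldRange K = p ^ e := by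
  letI := d.toStructure
  have h := d.interp
  rw [← isSepClosed_iff_exists_root p, ← finrank_fieldRange_frobenius_iff p]
  have := FDerivation.model_FDF d
  simp only [FDCF, Theory.model_union_iff, Theory.model_singleton_iff, this, true_and, h.model_strictAxiom, h.model_imperfectionAxiom, and_assoc]
  rw [Theory.model_iff, Set.forall_mem_range]
  simp only [h.model_sepClosedAxiom]
  rfl

end Characterization

end

/-!
# Quantifier elimination for existentially closed fields with an action of a formal group

A model of `F-DF` is a field `K` with operators `D_i` which satisfy the composition rules given by
the structure constants of `F`. The proof rests on three facts about such fields; the model theory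
is then a compactness argument.

*Wronskians.* The elements killed by all `D_i` such that `i ≠ 0` has entries smaller than `p ^ m`
form a subfield, the constants of level `p ^ m` (`FDerivation.constants`), over which these
operators are linear. In characteristic `p` they span an algebra, since `F(X, Y) ^ p ^ m` is a
power series in the `p ^ m`-th powers of the variables
(`FormalGroupLaw.structConst_eq_zero_of_lt`). Hence linear independence over the constants is
equivalent to linear independence of Wronskian vectors (`FDerivation.linearIndependent_wronskian`,
`FDerivation.linearIndependent_of_wronskian`). It follows that `K` has degree at most `p ^ (m e)`
over its constants of level `p ^ m`, and that linear independence over the constants is preserved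
in extensions (`FDerivation.linearIndependent_constants_comp`).

*Cofree `F`-rings.* For a `k`-algebra `S`, the map `f ↦ f(F(Y, X))` makes `S[[X]]` an `F`-ring
(`FormalGroupLaw.cofree`), and a homomorphism from an `F`-ring to `S` as a `k`-algebra lifts to a
homomorphism of `F`-rings to `S[[X]]` (`FDerivation.toCofree`). So any field amalgam of two
`F`-fields over a common `F`-subring yields an amalgam of `F`-fields
(`FDerivation.exists_amalgam`). Moreover every `F`-field extends to a model of `F-DCF`
(`FDerivation.exists_extension`). First it is embedded into the fraction field `Q` of a cofree
`F`-ring, where the monomials with exponents smaller than `p` are linearly independent over the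
constants. Then `Q` is embedded into the cofree `F`-ring over its algebraic closure, and the
extension consists of the elements of that ring all of whose derivatives are algebraic over `Q`. It
is separably closed by Hensel's lemma, and it is strict because in this cofree `F`-ring constants
are `p`-th powers.

*Specializations.* Let `K` be an extension of a model `N` of `F-DCF`. By strictness, the constants
of `N` of level `p ^ m` are the `p ^ m`-th powers, over which `N` has degree `p ^ (m e)`. By the
bound on the degree, `K` is therefore generated as a vector space over its field `C` of constants
of level `p ^ m` by a basis of `N`, i.e. `K = C ⊗ N` over `N ^ p ^ m`. Linear disjointness at level
`p ^ (m + 1)` shows that `C` is a separable extension of `N`, the latter embedded by the `p ^ m`-th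
power map. As `N` is separably closed, every finitely generated subalgebra of `C` has a point in
`N` (`FDerivation.hasRationalPoints_constants`). Base change yields homomorphisms to `N` from
arbitrarily large finitely generated subrings of `K` which fix `N` and commute with all `D_i` such
that `i` has entries smaller than `p ^ m` (`FDerivation.exists_specialization`). A quantifier-free
formula involves only finitely many operators and finitely many inequalities, so its solutions in
`K` specialize to solutions in `N`.

Amalgamation and specialization together show that an existential formula holds at a tuple of an
`F`-field only if it holds at each tuple of a model of `F-DCF` with the same quantifier-free type
(`FDCF.exists_realize`). Quantifier elimination follows by compactness
(`Theory.exists_isQF_iff_of_exists_realize`), and with the embedding of `F`-fields into models of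
`F-DCF` it gives the model completion (`FDCF.isModelCompletion`).
-/

noncomputable section

open FirstOrder FirstOrder.Language MvPowerSeries HSLang

/-! ### Structure constants of a formal group law -/

namespace MvPowerSeries

/-- The coefficients of a product of two power series in disjoint sets of variables. -/
theorem coeff_rename_inl_mul_rename_inr {σ τ R : Type*} [Finite σ] [Finite τ] [CommRing R]
    (G : MvPowerSeries σ R) (H : MvPowerSeries τ R) (x : σ →₀ ℕ) (y : τ →₀ ℕ) :
    coeff (x.sumElim y) (rename Sum.inl G * rename Sum.inr H) = coeff x G * coeff y H := by
  classical
  have hx : ∀ x : σ →₀ ℕ, coeff (x.sumElim (0 : τ →₀ ℕ)) (rename Sum.inl G) = coeff x G :=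
    fun x ↦ by
    have := coeff_embDomain_rename (R := R) (Function.Embedding.inl : σ ↪ σ ⊕ τ) G x
    rwa [Finsupp.embDomain_inl] at this
  have hy : ∀ y : τ →₀ ℕ, coeff ((0 : σ →₀ ℕ).sumElim y) (rename Sum.inr H) = coeff y H :=
    fun y ↦ by
    have := coeff_embDomain_rename (R := R) (Function.Embedding.inr : τ ↪ σ ⊕ τ) H y
    rwa [Finsupp.embDomain_inr] at this
  rw [coeff_mul, Finset.sum_eq_single (x.sumElim 0, Finsupp.sumElim 0 y), hx, hy]
  · rintro ⟨a, b⟩ hab hne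
    rw [Finset.HasAntidiagonal.mem_antidiagonal] at hab
    by_contra hc
    have ha : a ∈ Set.range (Finsupp.mapDomain Sum.inl) := by
      by_contra h
      exact hc (by rw [coeff_rename_eq_zero _ _ h, zero_mul])
    have hb : b ∈ Set.range (Finsupp.mapDomain Sum.inr) := by
      by_contra h
      exact hc (by rw [coeff_rename_eq_zero _ _ h, mul_zero])
    obtain ⟨a, rfl⟩ := ha
    obtain ⟨b, rfl⟩ := hb
    have : Finsupp.sumElim a b = Finsupp.sumElim x y := by
      rw [Finsupp.sumElim_eq_add]; exact hab
    have h1 : a = x := by ext s; simpa using DFunLike.congr_fun this (Sum.inl s)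
    have h2 : b = y := by ext s; simpa using DFunLike.congr_fun this (Sum.inr s)
    subst h1 h2
    apply hne
    simp [Finsupp.sumElim_eq_add]
  · intro h
    exact absurd (by rw [Finset.HasAntidiagonal.mem_antidiagonal, ← Finsupp.sumElim_add]; simp) h

/-- Together with `coeff_pow_expChar_pow_of_not_dvd`: in characteristic `p`, the `p ^ m`-th power of
a power series is a power series in the `p ^ m`-th powers of the variables. -/
theorem coeff_pow_expChar_pow {σ R : Type*} [Finite σ] [CommRing R] (p : ℕ) [ExpChar R p] (m : ℕ)
    (f : MvPowerSeries σ R) (i : σ →₀ ℕ) :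
    coeff (p ^ m • i) (f ^ p ^ m) = coeff i f ^ p ^ m := by
  rw [← map_iterateFrobenius_expand p (expChar_ne_zero R p), coeff_map, coeff_expand_smul,
    iterateFrobenius_def]

theorem coeff_pow_expChar_pow_of_not_dvd {σ R : Type*} [Finite σ] [CommRing R] (p : ℕ)
    [ExpChar R p] (m : ℕ) (f : MvPowerSeries σ R) (i : σ →₀ ℕ) {s : σ} (h : ¬ p ^ m ∣ i s) :
    coeff i (f ^ p ^ m) = 0 := by
  rw [← map_iterateFrobenius_expand p (expChar_ne_zero R p), coeff_map,
    coeff_expand_of_not_dvd _ _ _ h, map_zero]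

end MvPowerSeries

theorem Finsupp.exists_eq_sumElim {α β : Type*} (d : α ⊕ β →₀ ℕ) :
    ∃ a b, d = Finsupp.sumElim a b :=
  ⟨_, _, (Finsupp.comapDomain_sumElim_comapDomain d).symm⟩

/-- The finite set of multi-indices with entries at most `N`. -/
def multiBox (e N : ℕ) : Finset (Fin e →₀ ℕ) :=
  Finset.Icc 0 (Finsupp.equivFunOnFinite.symm fun _ ↦ N)

theorem mem_multiBox {e N : ℕ} {n : Fin e →₀ ℕ} : n ∈ multiBox e N ↔ ∀ s, n s ≤ N := by
  simp [multiBox, Finsupp.le_def]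

theorem multiBox_mono {e N N' : ℕ} (h : N ≤ N') : multiBox e N ⊆ multiBox e N' := fun n hn ↦ by
  rw [mem_multiBox] at hn ⊢
  exact fun s ↦ (hn s).trans h

theorem degree_le_of_mem_multiBox {e N : ℕ} {n : Fin e →₀ ℕ} (hn : n ∈ multiBox e N) :
    n.degree ≤ e * N := by
  rw [Finsupp.degree_eq_sum]
  refine (Finset.sum_le_card_nsmul _ _ N fun s _ ↦ mem_multiBox.1 hn s).trans ?_
  simp

namespace FormalGroupLaw

variable {k : Type u} [CommRing k] {e : ℕ} (F : FormalGroupLaw k e)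

theorem structConst_eq_zero_of_notMem {i j n : Fin e →₀ ℕ} {N : ℕ} (hN : i.degree + j.degree ≤ N)
    (h : n ∉ multiBox e N) : F.structConst i j n = 0 :=
  F.structConst_eq_zero i j n fun h' ↦ h (multiBox_mono hN h')

theorem coeff_subst_series_multiBox {R : Type w} [CommRing R] [Algebra k R]
    (f : MvPowerSeries (Fin e) R) (i j : Fin e →₀ ℕ) {N : ℕ} (hN : i.degree + j.degree ≤ N) :
    coeff (i.sumElim j) (subst (fun s ↦ (F.series s).map (algebraMap k R)) f) =
      ∑ n ∈ multiBox e N, algebraMap k R (F.structConst i j n) * coeff n f := by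
  rw [F.coeff_subst_series]
  exact Finset.sum_subset (multiBox_mono hN) fun n _ hn ↦ by
    rw [F.structConst_eq_zero i j n hn, map_zero, zero_mul]

/-- The power series `F(X, Y)^n`. -/
def powSeries (n : Fin e →₀ ℕ) : MvPowerSeries (Fin e ⊕ Fin e) k := ∏ s, F.series s ^ n s

theorem coeff_powSeries (i j n : Fin e →₀ ℕ) :
    coeff (i.sumElim j) (F.powSeries n) = F.structConst i j n := rfl

theorem map_powSeries_of_ringHom {A : Type*} [CommRing A]
    (φ : MvPowerSeries (Fin e ⊕ Fin e) k →+* A)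
    (n : Fin e →₀ ℕ) : φ (F.powSeries n) = n.prod fun s r ↦ φ (F.series s) ^ r := by
  rw [powSeries, map_prod, Finsupp.prod_fintype _ _ (by simp)]
  simp

/-- `F(X, 0) = X` in terms of the structure constants. -/
theorem structConst_zero_right (i n : Fin e →₀ ℕ) :
    F.structConst i 0 n = if i = n then 1 else 0 := by
  classical
  have ha : HasSubst (Sum.elim (fun t ↦ X t) (fun _ ↦ 0) :
    Fin e ⊕ Fin e → MvPowerSeries (Fin e) k) :=
    hasSubst_of_constantCoeff_zero (by rintro (a|a) <;> simp)
  have h1 := F.map_powSeries_of_ringHom (substAlgHom ha : _ →ₐ[k] _).toRingHom n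
  simp only [AlgHom.toRingHom_eq_coe, RingHom.coe_coe, coe_substAlgHom, F.right_unit] at h1
  rw [← monomial_one_eq] at h1
  have h2 := congrArg (coeff i) h1
  rw [coeff_monomial, coeff_subst ha, finsum_eq_single _ (Finsupp.sumElim i 0)] at h2
  · rw [← h2, Finsupp.prod_sumElim]
    simp only [Function.comp_def, Sum.elim_inl, Finsupp.prod_zero_index, mul_one,
      ← monomial_one_eq, coeff_monomial_same, coeff_powSeries, smul_eq_mul]
  · intro d hd
    obtain ⟨a, b, rfl⟩ := Finsupp.exists_eq_sumElim d
    rw [Finsupp.prod_sumElim]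
    by_cases hb : b = 0
    · subst hb
      have : i ≠ a := fun h ↦ hd (by rw [h])
      simp only [Function.comp_def, Sum.elim_inl, Finsupp.prod_zero_index, mul_one,
        ← monomial_one_eq, coeff_monomial_ne this, smul_zero]
    · obtain ⟨s, hs⟩ := Finsupp.ne_iff.1 hb
      rw [Finsupp.prod_fintype b _ (by simp), Finset.prod_eq_zero (Finset.mem_univ s), mul_zero,
        map_zero, smul_zero]
      exact zero_pow hs

/-- `F(0, Y) = Y` in terms of the structure constants. -/
theorem structConst_zero_left (i n : Fin e →₀ ℕ) :
    F.structConst 0 i n = if i = n then 1 else 0 := by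
  classical
  have ha : HasSubst (Sum.elim (fun _ ↦ 0) (fun t ↦ X t) :
    Fin e ⊕ Fin e → MvPowerSeries (Fin e) k) :=
    hasSubst_of_constantCoeff_zero (by rintro (a|a) <;> simp)
  have h1 := F.map_powSeries_of_ringHom (substAlgHom ha : _ →ₐ[k] _).toRingHom n
  simp only [AlgHom.toRingHom_eq_coe, RingHom.coe_coe, coe_substAlgHom, F.left_unit] at h1
  rw [← monomial_one_eq] at h1
  have h2 := congrArg (coeff i) h1
  rw [coeff_monomial, coeff_subst ha, finsum_eq_single _ (Finsupp.sumElim 0 i)] at h2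
  · rw [← h2, Finsupp.prod_sumElim]
    simp only [Function.comp_def, Sum.elim_inr, Finsupp.prod_zero_index, one_mul,
      ← monomial_one_eq, coeff_monomial_same, coeff_powSeries, smul_eq_mul, mul_one]
  · intro d hd
    obtain ⟨a, b, rfl⟩ := Finsupp.exists_eq_sumElim d
    rw [Finsupp.prod_sumElim]
    by_cases hb : a = 0
    · subst hb
      have : i ≠ b := fun h ↦ hd (by rw [h])
      simp only [Function.comp_def, Sum.elim_inr, Finsupp.prod_zero_index, one_mul,
        ← monomial_one_eq, coeff_monomial_ne this, smul_zero]
    · obtain ⟨s, hs⟩ := Finsupp.ne_iff.1 hb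
      rw [Finsupp.prod_fintype a _ (by simp), Finset.prod_eq_zero (Finset.mem_univ s), zero_mul,
        map_zero, smul_zero]
      exact zero_pow hs

/-- The coefficient of `V^i W^j X^l` in `F(V, F(W, X))^m`. -/
theorem coeff_subst_powSeries_right {N : ℕ} (i j l m : Fin e →₀ ℕ) (hN : j.degree + l.degree ≤ N) :
    coeff (i.sumElim (j.sumElim l)) (subst (Sum.elim (fun t ↦ X (Sum.inl t))
      (fun t ↦ rename Sum.inr (F.series t)) :
        Fin e ⊕ Fin e → MvPowerSeries (Fin e ⊕ Fin e ⊕ Fin e) k) (F.powSeries m)) =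
      ∑ n ∈ multiBox e N, F.structConst j l n * F.structConst i n m := by
  classical
  have ha : HasSubst (Sum.elim (fun t ↦ X (Sum.inl t)) (fun t ↦ rename Sum.inr (F.series t)) :
      Fin e ⊕ Fin e → MvPowerSeries (Fin e ⊕ Fin e ⊕ Fin e) k) :=
    hasSubst_of_constantCoeff_zero (by rintro (a|a) <;> simp [F.constantCoeff_series])
  have key : ∀ a n : Fin e →₀ ℕ, coeff (i.sumElim (j.sumElim l)) ((a.sumElim n).prod fun s r ↦
      (Sum.elim (fun t ↦ X (Sum.inl t)) (fun t ↦ rename Sum.inr (F.series t)) :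
        Fin e ⊕ Fin e → MvPowerSeries (Fin e ⊕ Fin e ⊕ Fin e) k) s ^ r) =
      if i = a then F.structConst j l n else 0 := fun a n ↦ by
    rw [Finsupp.prod_sumElim]
    simp only [Function.comp_def, Sum.elim_inl, Sum.elim_inr]
    have h1 : (a.prod fun x y ↦ (X (Sum.inl x) : MvPowerSeries (Fin e ⊕ Fin e ⊕ Fin e) k) ^ y) =
        rename Sum.inl (monomial a 1) := by
      rw [monomial_one_eq, map_finsuppProd]
      simp [rename_X]
    have h2 : (n.prod fun x y ↦ (rename Sum.inr (F.series x) :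
        MvPowerSeries (Fin e ⊕ Fin e ⊕ Fin e) k) ^ y) = rename Sum.inr (F.powSeries n) :=
      (F.map_powSeries_of_ringHom (rename (R := k) Sum.inr).toRingHom n).symm
    rw [h1, h2, coeff_rename_inl_mul_rename_inr, coeff_monomial, coeff_powSeries, ite_mul, one_mul,
      zero_mul]
  have inj : Function.Injective fun n : Fin e →₀ ℕ ↦ i.sumElim n := fun a b h ↦ by
    ext s; simpa using DFunLike.congr_fun h (Sum.inr s)
  rw [coeff_subst ha,
    finsum_eq_sum_of_support_subset (s := (multiBox e N).image fun n ↦ i.sumElim n),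
    Finset.sum_image fun a _ b _ h ↦ inj h]
  · refine Finset.sum_congr rfl fun n _ ↦ ?_
    rw [key, if_pos rfl, coeff_powSeries, smul_eq_mul, mul_comm]
  · intro d hd
    obtain ⟨a, n, rfl⟩ := Finsupp.exists_eq_sumElim d
    rw [Function.mem_support, key] at hd
    by_cases h : i = a
    · subst h
      rw [if_pos rfl] at hd
      rw [Finset.coe_image]
      refine ⟨n, ?_, rfl⟩
      by_contra hn
      exact hd (by rw [F.structConst_eq_zero_of_notMem hN hn, smul_zero])
    · exact absurd (by rw [if_neg h, smul_zero]) hd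

/-- The coefficient of `V^i W^j X^l` in `F(F(V, W), X)^m`. -/
theorem coeff_subst_powSeries_left {N : ℕ} (i j l m : Fin e →₀ ℕ) (hN : i.degree + j.degree ≤ N) :
    coeff ((i.sumElim j).sumElim l) (subst (Sum.elim (fun t ↦ rename Sum.inl (F.series t))
      (fun t ↦ X (Sum.inr t)) :
        Fin e ⊕ Fin e → MvPowerSeries ((Fin e ⊕ Fin e) ⊕ Fin e) k) (F.powSeries m)) =
      ∑ n ∈ multiBox e N, F.structConst i j n * F.structConst n l m := by
  classical
  have ha : HasSubst (Sum.elim (fun t ↦ rename Sum.inl (F.series t)) (fun t ↦ X (Sum.inr t)) :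
      Fin e ⊕ Fin e → MvPowerSeries ((Fin e ⊕ Fin e) ⊕ Fin e) k) :=
    hasSubst_of_constantCoeff_zero (by rintro (a|a) <;> simp [F.constantCoeff_series])
  have key : ∀ n a : Fin e →₀ ℕ, coeff ((i.sumElim j).sumElim l) ((n.sumElim a).prod fun s r ↦
      (Sum.elim (fun t ↦ rename Sum.inl (F.series t)) (fun t ↦ X (Sum.inr t)) :
        Fin e ⊕ Fin e → MvPowerSeries ((Fin e ⊕ Fin e) ⊕ Fin e) k) s ^ r) =
      if l = a then F.structConst i j n else 0 := fun n a ↦ by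
    rw [Finsupp.prod_sumElim]
    simp only [Function.comp_def, Sum.elim_inl, Sum.elim_inr]
    have h1 : (a.prod fun x y ↦ (X (Sum.inr x) : MvPowerSeries ((Fin e ⊕ Fin e) ⊕ Fin e) k) ^ y) =
        rename Sum.inr (monomial a 1) := by
      rw [monomial_one_eq, map_finsuppProd]
      simp [rename_X]
    have h2 : (n.prod fun x y ↦ (rename Sum.inl (F.series x) :
        MvPowerSeries ((Fin e ⊕ Fin e) ⊕ Fin e) k) ^ y) = rename Sum.inl (F.powSeries n) :=
      (F.map_powSeries_of_ringHom (rename (R := k) Sum.inl).toRingHom n).symm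
    rw [h1, h2, coeff_rename_inl_mul_rename_inr, coeff_monomial, coeff_powSeries, mul_ite, mul_one,
      mul_zero]
  have inj : Function.Injective fun n : Fin e →₀ ℕ ↦ n.sumElim l := fun a b h ↦ by
    ext s; simpa using DFunLike.congr_fun h (Sum.inl s)
  rw [coeff_subst ha,
    finsum_eq_sum_of_support_subset (s := (multiBox e N).image fun n ↦ n.sumElim l),
    Finset.sum_image fun a _ b _ h ↦ inj h]
  · refine Finset.sum_congr rfl fun n _ ↦ ?_
    rw [key, if_pos rfl, coeff_powSeries, smul_eq_mul, mul_comm]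
  · intro d hd
    obtain ⟨n, a, rfl⟩ := Finsupp.exists_eq_sumElim d
    rw [Function.mem_support, key] at hd
    by_cases h : l = a
    · subst h
      rw [if_pos rfl] at hd
      rw [Finset.coe_image]
      refine ⟨n, ?_, rfl⟩
      by_contra hn
      exact hd (by rw [F.structConst_eq_zero_of_notMem hN hn, smul_zero])
    · exact absurd (by rw [if_neg h, smul_zero]) hd

/-- Associativity of the formal group law in terms of its structure constants. -/
theorem sum_structConst_mul_structConst {N : ℕ} (i j l m : Fin e →₀ ℕ)
    (hN : i.degree + j.degree + l.degree ≤ N) :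
    ∑ n ∈ multiBox e N, F.structConst j l n * F.structConst i n m =
      ∑ n ∈ multiBox e N, F.structConst i j n * F.structConst n l m := by
  have haR : HasSubst (Sum.elim (fun t ↦ X (Sum.inl t)) (fun t ↦ rename Sum.inr (F.series t)) :
      Fin e ⊕ Fin e → MvPowerSeries (Fin e ⊕ Fin e ⊕ Fin e) k) :=
    hasSubst_of_constantCoeff_zero (by rintro (a|a) <;> simp [F.constantCoeff_series])
  have haL : HasSubst (Sum.elim (fun t ↦ rename Sum.inl (F.series t)) (fun t ↦ X (Sum.inr t)) :
      Fin e ⊕ Fin e → MvPowerSeries ((Fin e ⊕ Fin e) ⊕ Fin e) k) :=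
    hasSubst_of_constantCoeff_zero (by rintro (a|a) <;> simp [F.constantCoeff_series])
  have hR : ∀ t, subst (Sum.elim (fun r ↦ X (Sum.inr (Sum.inl r)))
      (fun r ↦ X (Sum.inr (Sum.inr r))) :
      Fin e ⊕ Fin e → MvPowerSeries (Fin e ⊕ Fin e ⊕ Fin e) k) (F.series t) =
      rename Sum.inr (F.series t) := fun t ↦ by
    rw [rename_eq_subst]; congr 1; ext1 (r | r) <;> rfl
  have hL : ∀ t, subst (Sum.elim (fun r ↦ X (Sum.inl r)) (fun r ↦ X (Sum.inr (Sum.inl r))) :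
      Fin e ⊕ Fin e → MvPowerSeries (Fin e ⊕ Fin e ⊕ Fin e) k) (F.series t) =
      rename (Equiv.sumAssoc _ _ _) (rename Sum.inl (F.series t)) := fun t ↦ by
    rw [rename_rename, rename_eq_subst]; congr 1; ext1 (r | r) <;> rfl
  have key : ∀ s, rename (Equiv.sumAssoc _ _ _) (subst (Sum.elim
      (fun t ↦ rename Sum.inl (F.series t))
      (fun t ↦ X (Sum.inr t)) : Fin e ⊕ Fin e → MvPowerSeries ((Fin e ⊕ Fin e) ⊕ Fin e) k)
        (F.series s)) =
      subst (Sum.elim (fun t ↦ X (Sum.inl t)) (fun t ↦ rename Sum.inr (F.series t)) :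
        Fin e ⊕ Fin e → MvPowerSeries (Fin e ⊕ Fin e ⊕ Fin e) k) (F.series s) := fun s ↦ by
    have := F.assoc s
    simp only [hR, hL] at this
    rw [← this, rename_eq_subst, subst_comp_subst_apply haL (HasSubst.X_comp _)]
    congr 1
    ext1 (r | r)
    · simp only [Sum.elim_inl, rename_eq_subst]
    · simp only [Sum.elim_inr, ← rename_eq_subst, rename_X]; rfl
  rw [← F.coeff_subst_powSeries_right i j l m (N := N) (by omega),
    ← F.coeff_subst_powSeries_left i j l m (N := N) (by omega)]
  have h1 := F.map_powSeries_of_ringHom (substAlgHom haR : _ →ₐ[k] _).toRingHom m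
  have h2 := F.map_powSeries_of_ringHom
    ((rename (Equiv.sumAssoc (Fin e) (Fin e) (Fin e))).comp
      (substAlgHom haL : _ →ₐ[k] _)).toRingHom m
  simp only [AlgHom.toRingHom_eq_coe, RingHom.coe_coe, coe_substAlgHom, AlgHom.comp_apply,
    key] at h1 h2
  rw [h1, ← h2]
  have h3 := coeff_embDomain_rename (R := k) (Equiv.sumAssoc (Fin e) (Fin e) (Fin e)).toEmbedding
    (subst (Sum.elim (fun t ↦ rename Sum.inl (F.series t)) (fun t ↦ X (Sum.inr t)) :
      Fin e ⊕ Fin e → MvPowerSeries ((Fin e ⊕ Fin e) ⊕ Fin e) k) (F.powSeries m))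
    ((i.sumElim j).sumElim l)
  rw [← h3]
  congr 1
  congr 1
  ext t
  obtain ⟨t, rfl⟩ := (Equiv.sumAssoc (Fin e) (Fin e) (Fin e)).surjective t
  rw [← Equiv.coe_toEmbedding, Finsupp.embDomain_apply_self]
  rcases t with (t | t) | t <;> rfl

section CharP

variable (p : ℕ) [ExpChar k p]

/-- In characteristic `p` the multi-indices with entries smaller than `p ^ m` are closed under
composition: `F(X, Y)^n` has a factor `F_s(X ^ p ^ m, Y ^ p ^ m)`, up to a Frobenius twist of the
coefficients, as soon as an entry of `n` is at least `p ^ m`. -/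
theorem structConst_eq_zero_of_lt (m : ℕ) {i j n : Fin e →₀ ℕ} (hi : ∀ s, i s < p ^ m)
    (hj : ∀ s, j s < p ^ m) {s : Fin e} (hn : p ^ m ≤ n s) : F.structConst i j n = 0 := by
  classical
  have h : F.powSeries n = F.series s ^ p ^ m * (F.series s ^ (n s - p ^ m) *
      ∏ t ∈ Finset.univ.erase s, F.series t ^ n t) := by
    rw [← mul_assoc, ← pow_add, Nat.add_sub_cancel' hn, powSeries,
      ← Finset.mul_prod_erase _ _ (Finset.mem_univ s)]
  rw [← coeff_powSeries, h, coeff_mul]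
  refine Finset.sum_eq_zero fun ab hab ↦ ?_
  rw [Finset.HasAntidiagonal.mem_antidiagonal] at hab
  have hlt : ∀ t, ab.1 t < p ^ m := fun t ↦ by
    have h1 : ab.1 t ≤ (i.sumElim j) t := by rw [← hab]; simp
    rcases t with t | t
    · exact h1.trans_lt (hi t)
    · exact h1.trans_lt (hj t)
  rw [show coeff ab.1 (F.series s ^ p ^ m) = 0 from ?_, zero_mul]
  by_cases h0 : ab.1 = 0
  · have := F.constantCoeff_series s
    rw [h0, coeff_zero_eq_constantCoeff_apply, map_pow, this, zero_pow]
    exact pow_ne_zero _ (expChar_ne_zero k p)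
  · obtain ⟨t, ht⟩ := Finsupp.ne_iff.1 h0
    exact coeff_pow_expChar_pow_of_not_dvd p m _ _ (s := t) fun h ↦
      absurd (Nat.le_of_dvd (Nat.pos_of_ne_zero ht) h) (not_le.2 (hlt t))

end CharP

end FormalGroupLaw

/-! ### Fields of constants and Wronskians -/

/-- The multi-index with entries `a s < q`. -/
def boundedIndex {e q : ℕ} (a : Fin e → Fin q) : Fin e →₀ ℕ :=
  Finsupp.equivFunOnFinite.symm fun s ↦ (a s : ℕ)

theorem boundedIndex_lt {e q : ℕ} (a : Fin e → Fin q) (s : Fin e) : boundedIndex a s < q := (a s).2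

theorem exists_boundedIndex {e q : ℕ} {i : Fin e →₀ ℕ} (hi : ∀ s, i s < q) :
    ∃ a : Fin e → Fin q, boundedIndex a = i := ⟨fun s ↦ ⟨i s, hi s⟩, by ext s; rfl⟩

theorem boundedIndex_injective {e q : ℕ} :
    Function.Injective (boundedIndex : (Fin e → Fin q) → Fin e →₀ ℕ) := fun a b h ↦ by
  ext s
  exact DFunLike.congr_fun h s

namespace FDerivation

section Ring

variable {k : Type u} [CommRing k] {e : ℕ} {F : FormalGroupLaw k e}
  {R : Type w} [CommRing R] [Algebra k R] (d : FDerivation F R)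

theorem D_add (i : Fin e →₀ ℕ) (x y : R) : d.D i (x + y) = d.D i x + d.D i y := by simp [D]

theorem D_apply_zero (i : Fin e →₀ ℕ) : d.D i 0 = 0 := by simp [D]

theorem D_neg (i : Fin e →₀ ℕ) (x : R) : d.D i (-x) = -d.D i x := by simp [D]

theorem D_sum {ι : Type*} (i : Fin e →₀ ℕ) (s : Finset ι) (f : ι → R) :
    d.D i (∑ l ∈ s, f l) = ∑ l ∈ s, d.D i (f l) := by simp [D]

theorem D_mul (i : Fin e →₀ ℕ) (x y : R) :
    d.D i (x * y) = ∑ ab ∈ Finset.HasAntidiagonal.antidiagonal i, d.D ab.1 x * d.D ab.2 y := by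
  simp [D, coeff_mul]

theorem D_zero_index (x : R) : d.D 0 x = x := d.constantCoeff_apply x

theorem D_algebraMap (i : Fin e →₀ ℕ) (hi : i ≠ 0) (c : k) : d.D i (algebraMap k R c) = 0 := by
  classical
  rw [D, AlgHom.commutes, MvPowerSeries.algebraMap_apply, coeff_C, if_neg hi]

/-- Iterativity with the sum extended to any sufficiently large box of multi-indices. -/
theorem D_D {i j : Fin e →₀ ℕ} {N : ℕ} (hN : i.degree + j.degree ≤ N) (x : R) :
    d.D j (d.D i x) = ∑ n ∈ multiBox e N, algebraMap k R (F.structConst i j n) * d.D n x :=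
  (d.iterative x i j).trans (F.coeff_subst_series_multiBox _ _ _ hN)

/-- A Hasse-Schmidt derivation which satisfies the iterativity rule expressed by the structure
constants is an `F`-derivation. -/
def ofStructConst (f : R →ₐ[k] MvPowerSeries (Fin e) R) (hf : ∀ r, constantCoeff (f r) = r)
    (h : ∀ r i j, coeff j (f (coeff i (f r))) = ∑ n ∈ multiBox e (i.degree + j.degree),
      algebraMap k R (F.structConst i j n) * coeff n (f r)) : FDerivation F R where
  toAlgHom := f
  constantCoeff_apply := hf
  iterative r i j := (h r i j).trans (F.coeff_subst_series_multiBox _ _ _ le_rfl).symm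

theorem D_pow_expChar_pow (p : ℕ) [ExpChar R p] (m : ℕ) (i : Fin e →₀ ℕ) (x : R) :
    d.D (p ^ m • i) (x ^ p ^ m) = d.D i x ^ p ^ m := by
  rw [D, map_pow, coeff_pow_expChar_pow]; rfl

theorem D_pow_expChar_pow_of_not_dvd (p : ℕ) [ExpChar R p] (m : ℕ) {i : Fin e →₀ ℕ} {s : Fin e}
    (h : ¬ p ^ m ∣ i s) (x : R) : d.D i (x ^ p ^ m) = 0 := by
  rw [D, map_pow, coeff_pow_expChar_pow_of_not_dvd p m _ _ h]

/-- `x` is a constant of level `q`, where the level is a bound on the order of the operators: it is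
killed by all `D_i` such that `i ≠ 0` has entries smaller than `q`. -/
def IsConstant (q : ℕ) (x : R) : Prop := ∀ i : Fin e →₀ ℕ, i ≠ 0 → (∀ s, i s < q) → d.D i x = 0

variable {d}

/-- `D_i` is linear over the constants of level `q` if the entries of `i` are smaller than `q`. -/
theorem IsConstant.D_mul {q : ℕ} {x : R} (hx : d.IsConstant q x) {i : Fin e →₀ ℕ}
    (hi : ∀ s, i s < q) (y : R) : d.D i (x * y) = x * d.D i y := by
  rw [d.D_mul, Finset.sum_eq_single (0, i)]
  · rw [d.D_zero_index]
  · rintro ⟨a, b⟩ hab hne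
    rw [Finset.HasAntidiagonal.mem_antidiagonal] at hab
    by_cases h0 : a = 0
    · subst h0; exact absurd (by simpa using hab) hne
    · have : ∀ s, a s < q := fun s ↦ lt_of_le_of_lt (by rw [← hab]; simp) (hi s)
      simp only [hx a h0 this, zero_mul]
  · intro h; exact absurd (by simp [Finset.HasAntidiagonal.mem_antidiagonal]) h

theorem IsConstant.mono {q q' : ℕ} (h : q ≤ q') {x : R} (hx : d.IsConstant q' x) :
    d.IsConstant q x := fun i h0 hi ↦ hx i h0 fun s ↦ (hi s).trans_le h

theorem isConstant_pow (p : ℕ) [ExpChar R p] (m : ℕ) (x : R) :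
    d.IsConstant (p ^ m) (x ^ p ^ m) := by
  intro i h0 hi
  obtain ⟨s, hs⟩ := Finsupp.ne_iff.1 h0
  exact d.D_pow_expChar_pow_of_not_dvd p m (s := s) (fun h ↦
    absurd (Nat.le_of_dvd (Nat.pos_of_ne_zero hs) h) (not_le.2 (hi s))) x

/-- The `p`-th power of a constant of level `p ^ m` is a constant of level `p ^ (m + 1)`. -/
theorem IsConstant.pow (p : ℕ) [ExpChar R p] {m : ℕ} {x : R} (hx : d.IsConstant (p ^ m) x) :
    d.IsConstant (p ^ (m + 1)) (x ^ p) := by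
  intro i h0 hi
  have hp := expChar_ne_zero R p
  by_cases h : ∀ s, p ∣ i s
  · choose a ha using h
    obtain rfl : i = p ^ 1 • Finsupp.equivFunOnFinite.symm a := by ext s; simp [ha]
    have := d.D_pow_expChar_pow p 1 (Finsupp.equivFunOnFinite.symm a) x
    rw [pow_one] at this ⊢
    rw [this, hx, zero_pow hp]
    · rintro h; exact h0 (by rw [h, smul_zero])
    · intro s
      have h1 := hi s
      rw [show (p ^ 1 • Finsupp.equivFunOnFinite.symm a) s = p * a s by simp, pow_succ'] at h1
      exact lt_of_mul_lt_mul_left h1 (Nat.zero_le p)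
  · push Not at h
    obtain ⟨s, hs⟩ := h
    simpa using d.D_pow_expChar_pow_of_not_dvd p 1 (by simpa using hs) x

variable (d)

/-- The operators `D_i` such that `i` has entries smaller than `p ^ m` span an algebra over `k`. -/
theorem D_D_eq_sum_boundedIndex (p : ℕ) [ExpChar k p] (m : ℕ) (a b : Fin e → Fin (p ^ m)) (x : R) :
    d.D (boundedIndex b) (d.D (boundedIndex a) x) =
      ∑ c : Fin e → Fin (p ^ m),
        algebraMap k R (F.structConst (boundedIndex a) (boundedIndex b) (boundedIndex c)) *
          d.D (boundedIndex c) x := by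
  classical
  set N := (boundedIndex a).degree + (boundedIndex b).degree + p ^ m
  rw [d.D_D (N := N) (by omega), ← Finset.sum_image (f := fun n ↦
    algebraMap k R (F.structConst (boundedIndex a) (boundedIndex b) n) * d.D n x)
    fun a _ b _ h ↦ boundedIndex_injective h]
  symm
  refine Finset.sum_subset ?_ ?_
  · intro n hn
    obtain ⟨c, -, rfl⟩ := Finset.mem_image.1 hn
    exact mem_multiBox.2 fun s ↦ (boundedIndex_lt c s).le.trans (by omega)
  · intro n _ hn
    have : ∃ s, p ^ m ≤ n s := by
      by_contra! hc
      obtain ⟨c, rfl⟩ := exists_boundedIndex hc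
      exact hn (Finset.mem_image_of_mem _ (Finset.mem_univ _))
    obtain ⟨s, hs⟩ := this
    rw [F.structConst_eq_zero_of_lt p m (boundedIndex_lt a) (boundedIndex_lt b) hs, map_zero,
      zero_mul]

end Ring

section Field

variable {k : Type u} [CommRing k] {e : ℕ} {F : FormalGroupLaw k e}
  {K : Type w} [Field K] [Algebra k K] (d : FDerivation F K)

/-- The subfield of constants of level `q`. -/
def constants (q : ℕ) : Subfield K where
  carrier := {x | d.IsConstant q x}
  mul_mem' {x y} hx hy i h0 hi := by rw [hx.D_mul hi, hy i h0 hi, mul_zero]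
  one_mem' i h0 hi := by simpa using d.D_algebraMap i h0 1
  add_mem' {x y} hx hy i h0 hi := by rw [d.D_add, hx i h0 hi, hy i h0 hi, add_zero]
  zero_mem' i _ _ := d.D_apply_zero i
  neg_mem' {x} hx i h0 hi := by rw [d.D_neg, hx i h0 hi, neg_zero]
  inv_mem' x hx i h0 hi := by
    by_cases hx0 : x = 0
    · rw [hx0, inv_zero, d.D_apply_zero]
    · have h := hx.D_mul hi x⁻¹
      have h1 : d.D i (1 : K) = 0 := by simpa using d.D_algebraMap i h0 1
      rw [mul_inv_cancel₀ hx0, h1, eq_comm] at h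
      exact (mul_eq_zero.1 h).resolve_left hx0

theorem mem_constants {q : ℕ} {x : K} : x ∈ d.constants q ↔ d.IsConstant q x := Iff.rfl

/-- Elements which are linearly independent over the constants of level `p ^ m` have linearly
independent Wronskian vectors. -/
theorem linearIndependent_wronskian (p : ℕ) [ExpChar k p] (m : ℕ) {ι : Type*} [Fintype ι]
    {x : ι → K} (hx : LinearIndependent (d.constants (p ^ m)) x) :
    LinearIndependent K fun l ↦ fun a : Fin e → Fin (p ^ m) ↦ d.D (boundedIndex a) (x l) := by
  classical
  have hq : 0 < p ^ m := pow_pos (expChar_pos k p) m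
  rw [Fintype.linearIndependent_iff] at hx ⊢
  -- Induction on the number of nonzero coefficients of a linear relation.
  suffices H : ∀ (N : ℕ) (g : ι → K), (Finset.univ.filter fun l ↦ g l ≠ 0).card ≤ N →
      (∀ a : Fin e → Fin (p ^ m), ∑ l, g l * d.D (boundedIndex a) (x l) = 0) → ∀ l, g l = 0 by
    intro g hg
    refine H _ g le_rfl fun a ↦ ?_
    have := congrFun hg a
    simpa using this
  intro N
  induction N with
  | zero =>
    intro g hg _ l
    rw [Nat.le_zero, Finset.card_eq_zero, Finset.filter_eq_empty_iff] at hg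
    simpa using hg (Finset.mem_univ l)
  | succ N ih =>
    intro g hg hrel
    by_contra! hne
    obtain ⟨l₀, hl₀⟩ := hne
    let g' : ι → K := fun l ↦ (g l₀)⁻¹ * g l
    have hg'₀ : g' l₀ = 1 := inv_mul_cancel₀ hl₀
    have hrel' : ∀ a : Fin e → Fin (p ^ m), ∑ l, g' l * d.D (boundedIndex a) (x l) = 0 := fun a ↦ by
      simp only [g', mul_assoc, ← Finset.mul_sum, hrel a, mul_zero]
    -- Applying `D_j` to the relation yields a shorter one, so that the coefficients are constants.
    have hconst : ∀ (M : ℕ) (j : Fin e →₀ ℕ), j.degree ≤ M → j ≠ 0 → (∀ s, j s < p ^ m) →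
        ∀ l, d.D j (g' l) = 0 := by
      intro M
      induction M with
      | zero =>
        intro j hj h0
        exact absurd ((Finsupp.degree_eq_zero_iff j).1 (Nat.le_zero.1 hj)) h0
      | succ M ihM =>
        intro j hjM h0 hj
        refine ih (fun l ↦ d.D j (g' l)) ?_ fun a ↦ ?_
        · have hsub : (Finset.univ.filter fun l ↦ d.D j (g' l) ≠ 0) ⊆
              (Finset.univ.filter fun l ↦ g l ≠ 0).erase l₀ := by
            intro l hl
            rw [Finset.mem_filter] at hl
            rw [Finset.mem_erase, Finset.mem_filter]
            refine ⟨?_, Finset.mem_univ _, ?_⟩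
            · rintro rfl
              apply hl.2
              rw [hg'₀]
              simpa using d.D_algebraMap j h0 1
            · intro h
              apply hl.2
              simp only [g', h, mul_zero, d.D_apply_zero]
          have h1 := Finset.card_le_card hsub
          rw [Finset.card_erase_of_mem (by simpa using hl₀)] at h1
          omega
        · have h1 := congrArg (d.D j) (hrel' a)
          rw [d.D_sum, d.D_apply_zero] at h1
          have h2 : ∀ l, d.D j (g' l * d.D (boundedIndex a) (x l)) =
              g' l * d.D j (d.D (boundedIndex a) (x l)) +
                d.D j (g' l) * d.D (boundedIndex a) (x l) := fun l ↦ by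
            rw [d.D_mul]
            have hne : ((0, j) : (Fin e →₀ ℕ) × (Fin e →₀ ℕ)) ≠ (j, 0) := fun h ↦
              h0 (Prod.ext_iff.1 h).2
            rw [← Finset.sum_subset (s₁ := {(0, j), (j, 0)}), Finset.sum_pair hne]
            · simp only [d.D_zero_index]
            · intro ab hab
              rw [Finset.mem_insert, Finset.mem_singleton] at hab
              rw [Finset.HasAntidiagonal.mem_antidiagonal]
              rcases hab with rfl | rfl <;> simp
            · rintro ⟨b, c⟩ hbc hn
              rw [Finset.HasAntidiagonal.mem_antidiagonal] at hbc
              simp only [Finset.mem_insert, Finset.mem_singleton, Prod.mk.injEq, not_or] at hn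
              have hb0 : b ≠ 0 := fun h ↦ hn.1 ⟨h, by simpa [h] using hbc⟩
              have hc0 : c ≠ 0 := fun h ↦ hn.2 ⟨by simpa [h] using hbc, h⟩
              have hdeg : b.degree + c.degree = j.degree := by
                rw [← hbc]; exact (map_add Finsupp.degree b c).symm
              have hc1 : c.degree ≠ 0 := fun h ↦ hc0 ((Finsupp.degree_eq_zero_iff c).1 h)
              simp only [ihM b (by omega) hb0
                (fun s ↦ lt_of_le_of_lt (by rw [← hbc]; simp) (hj s)) l, zero_mul]
          simp only [h2, Finset.sum_add_distrib] at h1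
          obtain ⟨b, rfl⟩ := exists_boundedIndex hj
          have h3 : ∑ l, g' l * d.D (boundedIndex b) (d.D (boundedIndex a) (x l)) = 0 := by
            simp only [d.D_D_eq_sum_boundedIndex p m, Finset.mul_sum]
            rw [Finset.sum_comm]
            refine Finset.sum_eq_zero fun c _ ↦ ?_
            simp only [mul_left_comm (g' _), ← Finset.mul_sum, hrel' c, mul_zero]
          rwa [h3, zero_add] at h1
    -- The relation for `D_0 = id` is now a linear relation over the constants.
    have h0 := hrel' fun _ ↦ ⟨0, hq⟩
    have hz : boundedIndex (fun _ : Fin e ↦ (⟨0, hq⟩ : Fin (p ^ m))) = 0 := by ext s; rfl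
    simp only [hz, d.D_zero_index] at h0
    have := hx (fun l ↦ ⟨g' l, fun i hi0 hi ↦ hconst _ i le_rfl hi0 hi l⟩)
      (by simpa [Subfield.smul_def] using h0) l₀
    have h1 := congrArg Subtype.val this
    simp only [hg'₀] at h1
    exact one_ne_zero h1

/-- An `F`-field has degree at most `p ^ (m e)` over its constants of level `p ^ m`: there are only
that many entries in a Wronskian vector. -/
theorem card_le_of_linearIndependent (p : ℕ) [ExpChar k p] (m : ℕ) {ι : Type*} [Fintype ι]
    {x : ι → K} (hx : LinearIndependent (d.constants (p ^ m)) x) :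
    Fintype.card ι ≤ (p ^ m) ^ e := by
  have := (d.linearIndependent_wronskian p m hx).fintype_card_le_finrank
  simpa using this

/-- Elements with linearly independent Wronskian vectors are linearly independent over the
constants. -/
theorem linearIndependent_of_wronskian {q : ℕ} {ι : Type*} [Fintype ι] {x : ι → K}
    (hx : LinearIndependent K fun l ↦ fun a : Fin e → Fin q ↦ d.D (boundedIndex a) (x l)) :
    LinearIndependent (d.constants q) x := by
  rw [Fintype.linearIndependent_iff] at hx ⊢
  intro g hg l
  have := hx (fun l ↦ (g l : K)) (by
    ext a
    have h1 := congrArg (d.D (boundedIndex a)) hg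
    rw [d.D_sum, d.D_apply_zero] at h1
    simp only [Finset.sum_apply, Pi.smul_apply, smul_eq_mul, Pi.zero_apply]
    rw [← h1]
    refine Finset.sum_congr rfl fun l _ ↦ ?_
    rw [Subfield.smul_def, smul_eq_mul, ((g l).2 : d.IsConstant q _).D_mul (boundedIndex_lt a)]) l
  exact Subtype.ext this

/-- Vectors remain linearly independent after an extension of the base field. -/
theorem _root_.linearIndependent_comp_of_field {κ ι N K : Type*} [Fintype ι] [Fintype κ]
    [Field N] [Field K] (f : N →+* K) {v : ι → κ → N} (hv : LinearIndependent N v) :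
    LinearIndependent K fun l ↦ fun a ↦ f (v l a) := by
  classical
  obtain ⟨g, hg⟩ := (Fintype.linearCombination N v).exists_leftInverse_of_injective
    (LinearMap.ker_eq_bot.2 (linearIndependent_iff_injective_fintypeLinearCombination.1 hv))
  let G : κ → ι → N := fun a ↦ g fun j ↦ if a = j then 1 else 0
  have h1 : ∀ l l', ∑ a, v l a * G a l' = if l' = l then 1 else 0 := fun l l' ↦ by
    have h2 := congrFun (LinearMap.congr_fun hg (Pi.single l 1)) l'
    rw [LinearMap.comp_apply, Fintype.linearCombination_apply_single, one_smul,
      LinearMap.pi_apply_eq_sum_univ g (v l)] at h2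
    simpa only [Finset.sum_apply, Pi.smul_apply, smul_eq_mul, LinearMap.id_apply,
      Pi.single_apply] using h2
  rw [Fintype.linearIndependent_iff]
  intro c hc l
  have h3 : ∑ a, (∑ l', c l' • fun a ↦ f (v l' a)) a * f (G a l) = c l := by
    simp only [Finset.sum_apply, Pi.smul_apply, smul_eq_mul, Finset.sum_mul]
    rw [Finset.sum_comm]
    simp only [mul_assoc, ← Finset.mul_sum, ← map_mul, ← map_sum, h1]
    simp
  rw [← h3, hc]
  simp

variable {N : Type v} [Field N] [Algebra k N] (dN : FDerivation F N)

/-- The constants of an extension of an `F`-field are linearly disjoint from the ground field over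
the constants of the ground field, because the Wronskian vectors are preserved. -/
theorem linearIndependent_constants_comp (p : ℕ) [ExpChar k p] (m : ℕ) (f : N →+* K)
    (hf : ∀ i x, f (dN.D i x) = d.D i (f x)) {ι : Type*} [Fintype ι]
    {x : ι → N} (hx : LinearIndependent (dN.constants (p ^ m)) x) :
    LinearIndependent (d.constants (p ^ m)) fun l ↦ f (x l) := by
  apply d.linearIndependent_of_wronskian
  simpa only [hf] using linearIndependent_comp_of_field f (dN.linearIndependent_wronskian p m hx)

end Field

end FDerivation

/-! ### Cofree `F`-rings and fraction fields -/

namespace MvPowerSeries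

theorem sum_antidiagonal_sumElim {σ τ M : Type*} [AddCommMonoid M] (x : σ →₀ ℕ) (y : τ →₀ ℕ)
    (f : (σ ⊕ τ →₀ ℕ) × (σ ⊕ τ →₀ ℕ) → M) [DecidableEq σ] [DecidableEq τ] :
    ∑ ab ∈ Finset.HasAntidiagonal.antidiagonal (x.sumElim y), f ab =
      ∑ a ∈ Finset.HasAntidiagonal.antidiagonal x, ∑ b ∈ Finset.HasAntidiagonal.antidiagonal y,
        f (a.1.sumElim b.1, a.2.sumElim b.2) := by
  rw [← Finset.sum_product']
  symm
  refine Finset.sum_bij (fun c _ ↦ (c.1.1.sumElim c.2.1, c.1.2.sumElim c.2.2)) ?_ ?_ ?_ ?_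
  · rintro ⟨⟨a, b⟩, c, d⟩ h
    simp only [Finset.mem_product, Finset.HasAntidiagonal.mem_antidiagonal] at h ⊢
    rw [← Finsupp.sumElim_add, h.1, h.2]
  · rintro ⟨⟨a, b⟩, c, d⟩ - ⟨⟨a', b'⟩, c', d'⟩ - h
    simp only [Prod.mk.injEq] at h ⊢
    refine ⟨⟨?_, ?_⟩, ?_, ?_⟩ <;> ext s
    · exact DFunLike.congr_fun h.1 (Sum.inl s)
    · exact DFunLike.congr_fun h.2 (Sum.inl s)
    · exact DFunLike.congr_fun h.1 (Sum.inr s)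
    · exact DFunLike.congr_fun h.2 (Sum.inr s)
  · rintro ⟨u, v⟩ h
    obtain ⟨a, c, rfl⟩ := Finsupp.exists_eq_sumElim u
    obtain ⟨b, d, rfl⟩ := Finsupp.exists_eq_sumElim v
    rw [Finset.HasAntidiagonal.mem_antidiagonal] at h
    refine ⟨((a, b), c, d), ?_, rfl⟩
    simp only [Finset.mem_product, Finset.HasAntidiagonal.mem_antidiagonal]
    constructor <;> ext s
    · exact DFunLike.congr_fun h (Sum.inl s)
    · exact DFunLike.congr_fun h (Sum.inr s)
  · intros; rfl

/-- The map underlying `MvPowerSeries.curry`. -/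
def curryFun {σ τ S : Type*} [CommRing S] (f : MvPowerSeries (σ ⊕ τ) S) :
    MvPowerSeries σ (MvPowerSeries τ S) := fun i j ↦ coeff (Finsupp.sumElim i j) f

theorem coeff_coeff_curryFun {σ τ S : Type*} [CommRing S] (f : MvPowerSeries (σ ⊕ τ) S)
    (i : σ →₀ ℕ) (j : τ →₀ ℕ) : coeff j (coeff i (curryFun f)) = coeff (i.sumElim j) f := rfl

/-- A power series in two sets of variables, viewed as a power series in the first set of variables
whose coefficients are power series in the second one. -/
def curry {σ τ S : Type*} [CommRing S] :
    MvPowerSeries (σ ⊕ τ) S →+* MvPowerSeries σ (MvPowerSeries τ S) where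
  toFun := curryFun
  map_one' := by
    classical
    ext i j
    rw [coeff_coeff_curryFun, coeff_one, coeff_one]
    by_cases hi : i = 0
    · by_cases hj : j = 0
      · simp [hi, hj]
      · rw [if_pos hi, if_neg, coeff_one, if_neg hj]
        exact fun h ↦ hj (by ext s; exact DFunLike.congr_fun h (Sum.inr s))
    · rw [if_neg hi, if_neg, map_zero]
      exact fun h ↦ hi (by ext s; exact DFunLike.congr_fun h (Sum.inl s))
  map_zero' := by ext i j; exact (coeff (Finsupp.sumElim i j)).map_zero
  map_add' f g := by ext i j; exact (coeff (Finsupp.sumElim i j)).map_add f g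
  map_mul' f g := by
    classical
    ext i j
    rw [coeff_coeff_curryFun, coeff_mul, coeff_mul, sum_antidiagonal_sumElim, map_sum]
    refine Finset.sum_congr rfl fun a _ ↦ ?_
    rw [coeff_mul]
    rfl

theorem coeff_coeff_curry {σ τ S : Type*} [CommRing S] (f : MvPowerSeries (σ ⊕ τ) S) (i : σ →₀ ℕ)
    (j : τ →₀ ℕ) : coeff j (coeff i (curry f)) = coeff (i.sumElim j) f := rfl

end MvPowerSeries

namespace FormalGroupLaw

variable {k : Type u} [CommRing k] {e : ℕ} (F : FormalGroupLaw k e)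

theorem hasSubst_map_series (S : Type*) [CommRing S] [Algebra k S] :
    HasSubst fun s ↦ (F.series s).map (algebraMap k S) :=
  hasSubst_of_constantCoeff_zero (by simp [F.constantCoeff_series])

/-- The ring homomorphism `f ↦ f(F(Y, X))`, where `f(F(Y, X))` is viewed as a power series in `Y`
with coefficients in the power series ring in `X`. The order of the two arguments is the one for
which this is an `F`-derivation. -/
def translate (S : Type w) [CommRing S] [Algebra k S] :
    MvPowerSeries (Fin e) S →+* MvPowerSeries (Fin e) (MvPowerSeries (Fin e) S) :=
  curry.comp (substAlgHom (F.hasSubst_map_series S)).toRingHom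

theorem coeff_coeff_translate {S : Type w} [CommRing S] [Algebra k S] (f : MvPowerSeries (Fin e) S)
    (i j : Fin e →₀ ℕ) : coeff j (coeff i (F.translate S f)) =
      coeff (i.sumElim j) (subst (fun s ↦ (F.series s).map (algebraMap k S)) f) := by
  rw [translate, RingHom.comp_apply, coeff_coeff_curry]
  simp

theorem coeff_coeff_translate_eq_sum {S : Type w} [CommRing S] [Algebra k S]
    (f : MvPowerSeries (Fin e) S) {i j : Fin e →₀ ℕ} {N : ℕ} (hN : i.degree + j.degree ≤ N) :
    coeff j (coeff i (F.translate S f)) =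
      ∑ n ∈ multiBox e N, algebraMap k S (F.structConst i j n) * coeff n f := by
  rw [coeff_coeff_translate, coeff_subst_series_multiBox F f i j hN]

/-- The cofree `F`-ring over a `k`-algebra `S`: the power series ring over `S` with the
`F`-derivation `f ↦ f(F(Y, X))`. -/
def cofree (S : Type w) [CommRing S] [Algebra k S] : FDerivation F (MvPowerSeries (Fin e) S) :=
  FDerivation.ofStructConst
    { F.translate S with
      commutes' := fun c ↦ by
        classical
        ext i j
        change coeff j (coeff i (F.translate S (algebraMap k _ c))) = _
        rw [MvPowerSeries.algebraMap_apply, MvPowerSeries.algebraMap_apply, coeff_coeff_translate,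
          ← coe_substAlgHom (F.hasSubst_map_series S)]
        have : (C (algebraMap k S c) : MvPowerSeries (Fin e) S) =
          algebraMap S _ (algebraMap k S c) := rfl
        rw [this, AlgHom.commutes, MvPowerSeries.algebraMap_apply, coeff_C, coeff_C]
        by_cases hi : i = 0
        · by_cases hj : j = 0
          · subst hi hj; simp [MvPowerSeries.algebraMap_apply]
          · rw [if_pos hi, if_neg, MvPowerSeries.algebraMap_apply, coeff_C, if_neg hj]
            exact fun h ↦ hj (by ext s; exact DFunLike.congr_fun h (Sum.inr s))
        · rw [if_neg hi, if_neg, map_zero]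
          exact fun h ↦ hi (by ext s; exact DFunLike.congr_fun h (Sum.inl s)) }
    (fun f ↦ by
      ext l
      change coeff l (constantCoeff (F.translate S f)) = _
      rw [← coeff_zero_eq_constantCoeff_apply, F.coeff_coeff_translate_eq_sum f le_rfl]
      rw [Finset.sum_eq_single l]
      · simp [structConst_zero_left]
      · intro n _ hn; simp [structConst_zero_left, hn.symm]
      · intro h
        refine absurd (mem_multiBox.2 fun s ↦ ?_) h
        simpa using Finsupp.le_degree s l)
    (fun f i j ↦ by
      change coeff j (F.translate S (coeff i (F.translate S f))) =
        ∑ n ∈ _, _ * coeff n (F.translate S f)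
      ext l
      -- Both sides are sums over boxes of multi-indices; they agree by associativity of `F`.
      set N := i.degree + j.degree + l.degree
      have hsub : multiBox e (i.degree + j.degree) ⊆ multiBox e N := multiBox_mono (by omega)
      rw [Finset.sum_subset hsub fun n _ hn ↦ by
        rw [F.structConst_eq_zero_of_notMem le_rfl hn, map_zero, zero_mul] ]
      rw [F.coeff_coeff_translate_eq_sum _ (N := N) (by omega), map_sum]
      have h1 : ∀ n ∈ multiBox e N, coeff n (coeff i (F.translate S f)) =
          ∑ m ∈ multiBox e (N + e * N), algebraMap k S (F.structConst i n m) * coeff m f :=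
        fun n hn ↦ F.coeff_coeff_translate_eq_sum f
          (by have := degree_le_of_mem_multiBox hn; omega)
      have h2 : ∀ n ∈ multiBox e N, coeff l (algebraMap k _ (F.structConst i j n) *
          coeff n (F.translate S f)) = ∑ m ∈ multiBox e (N + e * N),
            algebraMap k S (F.structConst i j n * F.structConst n l m) * coeff m f := fun n hn ↦ by
        rw [MvPowerSeries.algebraMap_apply, coeff_C_mul, F.coeff_coeff_translate_eq_sum f
          (N := N + e * N) (by have := degree_le_of_mem_multiBox hn; omega), Finset.mul_sum]
        simp only [map_mul, mul_assoc]
      rw [Finset.sum_congr rfl h2, Finset.sum_congr rfl fun n hn ↦ by rw [h1 n hn, Finset.mul_sum],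
        Finset.sum_comm, Finset.sum_comm (s := multiBox e N)]
      refine Finset.sum_congr rfl fun m _ ↦ ?_
      simp only [← mul_assoc, ← map_mul]
      rw [← Finset.sum_mul, ← Finset.sum_mul, ← map_sum, ← map_sum,
        F.sum_structConst_mul_structConst i j l m le_rfl])

theorem coeff_D_cofree {S : Type w} [CommRing S] [Algebra k S] (f : MvPowerSeries (Fin e) S)
    {i j : Fin e →₀ ℕ} {N : ℕ} (hN : i.degree + j.degree ≤ N) :
    coeff j ((F.cofree S).D i f) =
      ∑ n ∈ multiBox e N, algebraMap k S (F.structConst i j n) * coeff n f :=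
  F.coeff_coeff_translate_eq_sum f hN

end FormalGroupLaw

namespace FDerivation

variable {k : Type u} [CommRing k] {e : ℕ} {F : FormalGroupLaw k e}

section Cofree

variable {R : Type w} [CommRing R] [Algebra k R] (d : FDerivation F R)

/-- The homomorphism from an `F`-ring `R` to the cofree `F`-ring over `S` which is given by a
homomorphism `φ` of `k`-algebras `R → S`, namely `x ↦ ∑ φ(D_i x) X^i`. It commutes with the
`F`-derivations by `D_toCofree`. -/
def toCofree {S : Type v} [CommRing S] [Algebra k S] (φ : R →ₐ[k] S) :
    R →+* MvPowerSeries (Fin e) S :=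
  (MvPowerSeries.map (φ : R →+* S)).comp (d.toAlgHom : R →+* MvPowerSeries (Fin e) R)

theorem coeff_toCofree {S : Type v} [CommRing S] [Algebra k S] (φ : R →ₐ[k] S) (x : R)
    (i : Fin e →₀ ℕ) : coeff i (d.toCofree φ x) = φ (d.D i x) := rfl

theorem toCofree_algebraMap {S : Type v} [CommRing S] [Algebra k S] (φ : R →ₐ[k] S) (c : k) :
    d.toCofree φ (algebraMap k R c) = algebraMap k _ c := by
  simp [toCofree, MvPowerSeries.algebraMap_apply]

theorem D_toCofree {S : Type v} [CommRing S] [Algebra k S] (φ : R →ₐ[k] S) (i : Fin e →₀ ℕ)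
    (x : R) : (F.cofree S).D i (d.toCofree φ x) = d.toCofree φ (d.D i x) := by
  ext j
  rw [F.coeff_D_cofree _ le_rfl, coeff_toCofree, d.D_D le_rfl, map_sum]
  simp [coeff_toCofree]

end Cofree

section FractionRing

variable {R : Type v} [CommRing R] [Algebra k R] (d : FDerivation F R)
  (K : Type w) [Field K] [Algebra R K] [IsFractionRing R K]

/-- The power series ring over `K` receives `R` via the `F`-derivation of `R`. -/
def toFractionSeries : R →+* MvPowerSeries (Fin e) K :=
  (MvPowerSeries.map (algebraMap R K)).comp (d.toAlgHom : R →+* MvPowerSeries (Fin e) R)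

theorem isUnit_toFractionSeries [IsDomain R] (y : nonZeroDivisors R) :
    IsUnit (d.toFractionSeries K y) := by
  rw [MvPowerSeries.isUnit_iff_constantCoeff]
  have : constantCoeff (d.toFractionSeries K y) = algebraMap R K y := by
    rw [toFractionSeries, RingHom.comp_apply, ← coeff_zero_eq_constantCoeff_apply, coeff_map]
    exact congrArg _ (d.D_zero_index _)
  rw [this, isUnit_iff_ne_zero]
  exact IsFractionRing.to_map_ne_zero_of_mem_nonZeroDivisors y.2

/-- The extension of a Hasse-Schmidt derivation to the fraction field. -/
def fractionHom [IsDomain R] : K →+* MvPowerSeries (Fin e) K :=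
  IsLocalization.lift (M := nonZeroDivisors R) (d.isUnit_toFractionSeries K)

theorem fractionHom_algebraMap [IsDomain R] (x : R) :
    d.fractionHom K (algebraMap R K x) = d.toFractionSeries K x :=
  IsLocalization.lift_eq _ x

variable [Algebra k K] [IsScalarTower k R K]

/-- The extension of an `F`-derivation to the fraction field. -/
def fraction [IsDomain R] : FDerivation F K where
  toAlgHom :=
    { d.fractionHom K with
      commutes' := fun c ↦ by
        change d.fractionHom K (algebraMap k K c) = _
        rw [IsScalarTower.algebraMap_apply k R K, fractionHom_algebraMap, toFractionSeries,
          RingHom.comp_apply, RingHom.coe_coe, AlgHom.commutes, MvPowerSeries.algebraMap_apply,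
          MvPowerSeries.algebraMap_apply, map_C, ← IsScalarTower.algebraMap_apply] }
  constantCoeff_apply r := by
    have : (constantCoeff.comp (d.fractionHom K)) = RingHom.id K := by
      refine IsLocalization.ringHom_ext (nonZeroDivisors R) ?_
      ext x
      rw [RingHom.comp_apply, RingHom.comp_apply, fractionHom_algebraMap, toFractionSeries,
        RingHom.comp_apply, ← coeff_zero_eq_constantCoeff_apply, coeff_map]
      exact congrArg _ (d.D_zero_index _)
    exact RingHom.congr_fun this r
  iterative r i j := by
    have : (MvPowerSeries.map (d.fractionHom K)).comp (d.fractionHom K) =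
        (F.translate K).comp (d.fractionHom K) := by
      refine IsLocalization.ringHom_ext (nonZeroDivisors R) ?_
      ext x i j
      simp only [RingHom.comp_apply, fractionHom_algebraMap]
      rw [F.coeff_coeff_translate_eq_sum _ le_rfl, coeff_map]
      have h2 : ∀ y n, coeff n (d.toFractionSeries K y) = algebraMap R K (d.D n y) :=
        fun _ _ ↦ rfl
      simp only [h2, fractionHom_algebraMap]
      rw [d.D_D le_rfl, map_sum]
      simp [← IsScalarTower.algebraMap_apply]
    have h := congrArg (fun f ↦ coeff j (coeff i f)) (RingHom.congr_fun this r)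
    simp only [RingHom.comp_apply, coeff_map, F.coeff_coeff_translate] at h
    exact h

theorem D_fraction_algebraMap [IsDomain R] (i : Fin e →₀ ℕ) (x : R) :
    (d.fraction K).D i (algebraMap R K x) = algebraMap R K (d.D i x) := by
  change coeff i (d.fractionHom K (algebraMap R K x)) = _
  rw [fractionHom_algebraMap]
  rfl

end FractionRing

end FDerivation

/-! ### Constants of cofree `F`-rings -/

namespace MvPowerSeries

/-- The augmentation ideal of a power series ring is generated by the variables. -/
theorem mem_span_range_X_of_constantCoeff_eq_zero {σ S : Type*} [Finite σ] [CommRing S]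
    {f : MvPowerSeries σ S} (hf : constantCoeff f = 0) :
    f ∈ Ideal.span (Set.range (X : σ → MvPowerSeries σ S)) := by
  classical
  cases nonempty_fintype σ
  have h : ∀ n : σ →₀ ℕ, ∃ s : Option σ, n ≠ 0 → ∃ t, s = some t ∧ n t ≠ 0 := fun n ↦ by
    by_cases hn : n = 0
    · exact ⟨none, fun h ↦ absurd hn h⟩
    · obtain ⟨t, ht⟩ := Finsupp.ne_iff.1 hn
      exact ⟨some t, fun _ ↦ ⟨t, rfl, ht⟩⟩
  choose s hs using h
  -- Each monomial of `f` is divided by one of its variables.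
  let g : σ → MvPowerSeries σ S := fun t m ↦
    if s (m + Finsupp.single t 1) = some t then coeff (m + Finsupp.single t 1) f else 0
  have hg : ∀ t m, coeff m (g t) =
    if s (m + Finsupp.single t 1) = some t then coeff (m + Finsupp.single t 1) f else 0 :=
    fun _ _ ↦ rfl
  have hfg : f = ∑ t, X t * g t := by
    ext n
    rw [map_sum]
    simp only [X, coeff_monomial_mul, one_mul, hg]
    by_cases hn : n = 0
    · subst hn
      rw [coeff_zero_eq_constantCoeff_apply, hf, Finset.sum_eq_zero]
      intro t _
      rw [if_neg]
      intro h
      simpa using h t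
    · obtain ⟨t, ht, hnt⟩ := hs n hn
      have hle : ∀ r, Finsupp.single r 1 ≤ n ↔ n r ≠ 0 := fun r ↦ by
        rw [Finsupp.single_le_iff, Nat.one_le_iff_ne_zero]
      rw [Finset.sum_eq_single t]
      · rw [if_pos ((hle t).2 hnt), tsub_add_cancel_of_le ((hle t).2 hnt), if_pos ht]
      · intro r _ hr
        by_cases h : Finsupp.single r 1 ≤ n
        · rw [if_pos h, tsub_add_cancel_of_le h, if_neg]
          rw [ht]
          exact fun h ↦ hr (Option.some_injective _ h).symm
        · rw [if_neg h]
      · simp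
  rw [hfg]
  exact Ideal.sum_mem _ fun t _ ↦ Ideal.mul_mem_right _ _ (Ideal.subset_span ⟨t, rfl⟩)

instance instIsDomain {σ S : Type*} [CommRing S] [IsDomain S] : IsDomain (MvPowerSeries σ S) :=
  NoZeroDivisors.to_isDomain _

/-- A power series ring over an algebraically closed field is strictly henselian: it is complete
with respect to the ideal generated by the variables, and the reduction of `f` has a simple root. -/
theorem exists_isRoot_of_map_separable {σ Ω : Type*} [Finite σ] [Field Ω] [IsAlgClosed Ω]
    (f : Polynomial (MvPowerSeries σ Ω)) (hf : f.Monic) (hdeg : f.natDegree ≠ 0)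
    (hsep : (f.map (constantCoeff (σ := σ) (R := Ω))).Separable) : ∃ α, f.IsRoot α := by
  set f₀ := f.map (constantCoeff (σ := σ) (R := Ω)) with hf₀
  have hdeg₀ : f₀.degree ≠ 0 := by
    have h1 : f₀.natDegree = f.natDegree := hf.natDegree_map _
    intro h
    exact hdeg (by rw [← h1]; exact Polynomial.natDegree_eq_of_degree_eq_some h)
  obtain ⟨a, ha⟩ := IsAlgClosed.exists_root f₀ hdeg₀
  have hev : ∀ g : Polynomial (MvPowerSeries σ Ω), constantCoeff (g.eval (C a)) =
      (g.map (constantCoeff (σ := σ) (R := Ω))).eval a := fun g ↦ by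
    rw [Polynomial.eval_map, Polynomial.eval₂_eq_eval_map, Polynomial.eval_map,
      ← Polynomial.eval₂_hom]
    simp
  obtain ⟨α, hα, -⟩ := HenselianRing.is_henselian
    (I := Ideal.span (Set.range (X : σ → MvPowerSeries σ Ω))) f hf (C a)
    (mem_span_range_X_of_constantCoeff_eq_zero (by rw [hev]; exact ha))
    (by
      refine IsUnit.map _ (MvPowerSeries.isUnit_iff_constantCoeff.2 ?_)
      rw [hev, ← Polynomial.derivative_map, isUnit_iff_ne_zero]
      exact hsep.eval₂_derivative_ne_zero (RingHom.id Ω) (x := a) ha)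
  exact ⟨α, hα⟩

end MvPowerSeries

namespace FormalGroupLaw

variable {k : Type u} [CommRing k] {e : ℕ} (F : FormalGroupLaw k e)

theorem constantCoeff_D_cofree {S : Type w} [CommRing S] [Algebra k S] (f : MvPowerSeries (Fin e) S)
    (i : Fin e →₀ ℕ) : constantCoeff ((F.cofree S).D i f) = coeff i f := by
  rw [← coeff_zero_eq_constantCoeff_apply, F.coeff_D_cofree f le_rfl, Finset.sum_eq_single i]
  · simp [structConst_zero_right]
  · intro n _ hn; simp [structConst_zero_right, hn.symm]
  · intro h
    refine absurd (mem_multiBox.2 fun s ↦ ?_) h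
    simpa using Finsupp.le_degree s i

/-- In the fraction field of a cofree `F`-ring over a field, the `q ^ e` monomials with exponents
smaller than `q` are linearly independent over the constants, because the constant term of their
Wronskian matrix is the identity matrix. -/
theorem linearIndependent_monomial (S : Type w) [Field S] [Algebra k S] (q : ℕ) :
    LinearIndependent (((F.cofree S).fraction (FractionRing (MvPowerSeries (Fin e) S))).constants q)
      fun a : Fin e → Fin q ↦ algebraMap (MvPowerSeries (Fin e) S)
        (FractionRing (MvPowerSeries (Fin e) S)) (monomial (boundedIndex a) 1) := by
  classical
  apply FDerivation.linearIndependent_of_wronskian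
  simp only [FDerivation.D_fraction_algebraMap]
  let M : Matrix (Fin e → Fin q) (Fin e → Fin q) (MvPowerSeries (Fin e) S) :=
    fun a b ↦ (F.cofree S).D (boundedIndex b) (monomial (boundedIndex a) 1)
  have h1 : M.map (constantCoeff (σ := Fin e) (R := S)) = 1 := by
    ext a b
    rw [Matrix.map_apply, constantCoeff_D_cofree, coeff_monomial, Matrix.one_apply]
    simp [boundedIndex_injective.eq_iff, eq_comm]
  have h2 : M.det ≠ 0 := fun h ↦ by
    have := (constantCoeff (σ := Fin e) (R := S)).map_det M
    rw [h, map_zero] at this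
    rw [RingHom.mapMatrix_apply, h1, Matrix.det_one] at this
    exact zero_ne_one this
  have h3 : (M.map (algebraMap _ (FractionRing (MvPowerSeries (Fin e) S)))).det ≠ 0 := by
    have := (algebraMap _ (FractionRing (MvPowerSeries (Fin e) S))).map_det M
    rw [RingHom.mapMatrix_apply] at this
    rw [← this]
    exact (map_ne_zero_iff _ (IsFractionRing.injective _ _)).2 h2
  exact Matrix.linearIndependent_rows_of_det_ne_zero h3

variable {Ω : Type w} [Field Ω] [Algebra k Ω]

/-- The first order operator `D_{(0, …, 1, …, 0)}` of a cofree `F`-ring is a derivation. -/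
def cofreeDerivation (s : Fin e) :
    Derivation Ω (MvPowerSeries (Fin e) Ω) (MvPowerSeries (Fin e) Ω) :=
  Derivation.mk'
    { toFun := (F.cofree Ω).D (Finsupp.single s 1)
      map_add' := (F.cofree Ω).D_add _
      map_smul' := fun a f ↦ by
        ext j
        simp only [RingHom.id_apply, coeff_smul, F.coeff_D_cofree _ le_rfl, Finset.mul_sum]
        simp only [mul_left_comm] }
    (fun f g ↦ by
      change (F.cofree Ω).D _ _ = f • (F.cofree Ω).D _ _ + g • (F.cofree Ω).D _ _
      rw [(F.cofree Ω).D_mul, Finsupp.antidiagonal_single]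
      simp [Finset.Nat.antidiagonal_succ, (F.cofree Ω).D_zero_index, mul_comm])

theorem cofreeDerivation_apply (s : Fin e) (f : MvPowerSeries (Fin e) Ω) :
    F.cofreeDerivation s f = (F.cofree Ω).D (Finsupp.single s 1) f := rfl

/-- The first order operators of a cofree `F`-ring are combinations of the partial derivatives. -/
theorem cofreeDerivation_eq_sum (s : Fin e) (f : MvPowerSeries (Fin e) Ω) :
    F.cofreeDerivation s f = ∑ t, F.cofreeDerivation s (X t) * pderiv Ω t f := by
  classical
  let G : Derivation Ω (MvPowerSeries (Fin e) Ω) (MvPowerSeries (Fin e) Ω) :=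
    F.cofreeDerivation s - ∑ t, (F.cofreeDerivation s (X t) : MvPowerSeries (Fin e) Ω) • pderiv Ω t
  have hG : ∀ f, G f = F.cofreeDerivation s f - ∑ t, F.cofreeDerivation s (X t) * pderiv Ω t f :=
    fun f ↦ by
      have h := congrFun (map_sum (Derivation.coeFnAddMonoidHom (R := Ω)
        (A := MvPowerSeries (Fin e) Ω) (M := MvPowerSeries (Fin e) Ω)) (fun t ↦
          (F.cofreeDerivation s (X t) : MvPowerSeries (Fin e) Ω) •
          pderiv Ω t) Finset.univ) f
      rw [Derivation.sub_apply]
      refine congrArg _ (h.trans ?_)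
      rw [Finset.sum_apply]
      rfl
  have hX : ∀ t, G (X t) = 0 := fun t ↦ by
    rw [hG, Finset.sum_eq_single t]
    · rw [pderiv_X_self, mul_one, sub_self]
    · intro r _ hr; rw [pderiv_X_of_ne hr.symm, mul_zero]
    · simp
  have hpoly : ∀ P : MvPolynomial (Fin e) Ω, G (P : MvPowerSeries (Fin e) Ω) = 0 := fun P ↦ by
    induction P using MvPolynomial.induction_on with
    | C a => rw [MvPolynomial.coe_C]; exact G.map_algebraMap a
    | add P Q hP hQ => rw [MvPolynomial.coe_add, map_add, hP, hQ, add_zero]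
    | mul_X P t hP =>
      rw [MvPolynomial.coe_mul, MvPolynomial.coe_X, Derivation.leibniz, hP, hX, smul_zero,
        smul_zero, add_zero]
  rw [← sub_eq_zero, ← hG]
  ext j
  rw [map_zero]
  -- The `j`-th coefficient of `G f` only depends on finitely many coefficients of `f`.
  set N := 1 + j.degree
  let P : MvPolynomial (Fin e) Ω := ∑ n ∈ multiBox e N, MvPolynomial.monomial n (coeff n f)
  have hP : ∀ n ∈ multiBox e N, coeff n (f - (P : MvPowerSeries (Fin e) Ω)) = 0 := fun n hn ↦ by
    rw [map_sub, MvPolynomial.coeff_coe, MvPolynomial.coeff_sum, Finset.sum_eq_single n]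
    · simp
    · intro b _ hb; simp [MvPolynomial.coeff_monomial, hb]
    · intro h; exact absurd hn h
  have h0 : G f = G (f - (P : MvPowerSeries (Fin e) Ω)) := by rw [map_sub, hpoly, sub_zero]
  rw [h0, hG, map_sub, cofreeDerivation_apply, F.coeff_D_cofree _ (N := N) (by simp [N]),
    Finset.sum_eq_zero fun n hn ↦ by rw [hP n hn, mul_zero], zero_sub, neg_eq_zero, map_sum]
  refine Finset.sum_eq_zero fun t _ ↦ ?_
  rw [coeff_mul]
  refine Finset.sum_eq_zero fun ab hab ↦ ?_
  rw [Finset.HasAntidiagonal.mem_antidiagonal] at hab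
  rw [coeff_pderiv, hP, zero_mul, mul_zero]
  refine mem_multiBox.2 fun r ↦ ?_
  have h1 : ab.2 r ≤ j r := by rw [← hab]; simp
  have h2 := Finsupp.le_degree r j
  have h3 : (Finsupp.single t 1 : Fin e →₀ ℕ) r ≤ 1 := by
    rw [Finsupp.single_apply]; split_ifs <;> simp
  rw [Finsupp.add_apply]
  omega

/-- Over a perfect field of characteristic `p`, the constants of a cofree `F`-ring are `p`-th
powers: the matrix which expresses the first order operators in terms of the partial derivatives is
congruent to the identity matrix modulo the variables, so all partial derivatives of a constant
vanish. -/
theorem exists_pow_eq_of_D_cofree_eq_zero (p : ℕ) [Fact p.Prime] [CharP Ω p] [PerfectField Ω]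
    (f : MvPowerSeries (Fin e) Ω) (hf : ∀ s, (F.cofree Ω).D (Finsupp.single s 1) f = 0) :
    ∃ g, g ^ p = f := by
  classical
  have hp : p.Prime := Fact.out
  let M : Matrix (Fin e) (Fin e) (MvPowerSeries (Fin e) Ω) := fun s t ↦ F.cofreeDerivation s (X t)
  have h1 : M.map (constantCoeff (σ := Fin e) (R := Ω)) = 1 := by
    ext a b
    rw [Matrix.map_apply, Matrix.one_apply]
    change constantCoeff ((F.cofree Ω).D _ _) = _
    rw [constantCoeff_D_cofree, coeff_X]
    simp [Finsupp.single_left_inj]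
  have h2 : M.det ≠ 0 := fun h ↦ by
    have := (constantCoeff (σ := Fin e) (R := Ω)).map_det M
    rw [h, map_zero, RingHom.mapMatrix_apply, h1, Matrix.det_one] at this
    exact zero_ne_one this
  have h3 : (fun t ↦ pderiv Ω t f) = 0 := by
    refine Matrix.eq_zero_of_mulVec_eq_zero h2 ?_
    ext1 s
    have := F.cofreeDerivation_eq_sum s f
    rw [cofreeDerivation_apply, hf] at this
    exact this.symm
  have h4 : ∀ (n : Fin e →₀ ℕ) t, ¬ p ∣ n t → coeff n f = 0 := fun n t hn ↦ by
    have h5 : n - Finsupp.single t 1 + Finsupp.single t 1 = n := by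
      refine tsub_add_cancel_of_le ?_
      rw [Finsupp.single_le_iff]
      exact Nat.one_le_iff_ne_zero.2 fun h ↦ hn (by rw [h]; exact dvd_zero p)
    have h6 := congrArg (coeff (n - Finsupp.single t 1)) (congrFun h3 t)
    rw [coeff_pderiv, h5, Pi.zero_apply, map_zero] at h6
    refine (mul_eq_zero.1 h6).resolve_right fun h ↦ hn ?_
    rw [← CharP.cast_eq_zero_iff Ω p, ← h5]
    simpa using h
  have : ∀ a : Ω, ∃ b, b ^ p = a := fun a ↦ by
    have := PerfectField.toPerfectRing (K := Ω) p
    exact (frobeniusEquiv Ω p).surjective a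
  choose r hr using this
  let g : MvPowerSeries (Fin e) Ω := fun n ↦ r (coeff (p • n) f)
  refine ⟨g, ?_⟩
  have hg : ∀ n, coeff n g = r (coeff (p • n) f) := fun n ↦ rfl
  ext n
  by_cases hn : ∀ t, p ∣ n t
  · choose a ha using hn
    obtain rfl : n = p • Finsupp.equivFunOnFinite.symm a := by ext s; simp [ha]
    have := coeff_pow_expChar_pow p 1 g (Finsupp.equivFunOnFinite.symm a)
    rw [pow_one] at this
    rw [this, hg, hr]
  · push Not at hn
    obtain ⟨t, ht⟩ := hn
    have := coeff_pow_expChar_pow_of_not_dvd p 1 g n (s := t) (by simpa using ht)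
    rw [pow_one] at this
    rw [this, h4 n t ht]

end FormalGroupLaw

/-! ### Every `F`-field extends to a model of `F-DCF` -/

namespace FDerivation

variable {k : Type u} [CommRing k] {e : ℕ} {F : FormalGroupLaw k e}

section Restrict

variable {R : Type w} [CommRing R] [Algebra k R] (d : FDerivation F R)

/-- The restriction of an `F`-derivation to a subalgebra which is closed under it. -/
def restrict (S : Subalgebra k R) (hS : ∀ i, ∀ x ∈ S, d.D i x ∈ S) : FDerivation F S :=
  let δ : S → MvPowerSeries (Fin e) S := fun x i ↦ ⟨d.D i x, hS i x x.2⟩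
  have hδ : ∀ x i, ((coeff i (δ x) : S) : R) = d.D i x := fun _ _ ↦ rfl
  ofStructConst
    { toFun := δ
      map_one' := by
        classical
        ext i
        rw [hδ, D, OneMemClass.coe_one, map_one, coeff_one, coeff_one]
        split_ifs <;> rfl
      map_mul' := fun x y ↦ by
        ext i
        rw [hδ, MulMemClass.coe_mul, D_mul, coeff_mul, AddSubmonoidClass.coe_finsetSum]
        rfl
      map_zero' := by
        ext i
        rw [hδ, ZeroMemClass.coe_zero, D_apply_zero]
        rfl
      map_add' := fun x y ↦ by
        ext i
        rw [hδ, AddMemClass.coe_add, D_add, map_add]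
        rfl
      commutes' := fun c ↦ by
        classical
        ext i
        rw [hδ]
        change coeff i (d.toAlgHom (algebraMap k R c)) = _
        rw [AlgHom.commutes, MvPowerSeries.algebraMap_apply, MvPowerSeries.algebraMap_apply,
          coeff_C, coeff_C]
        split_ifs <;> rfl }
    (fun x ↦ by
      apply Subtype.ext
      rw [← coeff_zero_eq_constantCoeff_apply]
      exact d.D_zero_index x)
    (fun x i j ↦ by
      apply Subtype.ext
      rw [AddSubmonoidClass.coe_finsetSum]
      exact d.D_D le_rfl (x : R))

end Restrict

section Closure

variable {K : Type v} [Field K] [Algebra k K] {W : Type w} [CommRing W] [Algebra k W]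
  [Algebra K W] [IsScalarTower k K W] (d : FDerivation F W)

/-- The elements of an `F`-ring all of whose derivatives are integral over a field `K`. -/
def integralSubalgebra : Subalgebra k W where
  carrier := {x | ∀ i, IsIntegral K (d.D i x)}
  mul_mem' {x y} hx hy i := by
    rw [d.D_mul]
    exact IsIntegral.sum _ fun a _ ↦ (hx _).mul (hy _)
  add_mem' {x y} hx hy i := by
    rw [d.D_add]
    exact (hx i).add (hy i)
  algebraMap_mem' c i := by
    by_cases hi : i = 0
    · rw [hi, d.D_zero_index, IsScalarTower.algebraMap_apply k K W]
      exact isIntegral_algebraMap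
    · rw [d.D_algebraMap i hi]
      exact isIntegral_zero

theorem D_mem_integralSubalgebra (i : Fin e →₀ ℕ) {x : W} (hx : x ∈ d.integralSubalgebra (K := K)) :
    d.D i x ∈ d.integralSubalgebra (K := K) := fun j ↦ by
  rw [d.D_D le_rfl]
  refine IsIntegral.sum _ fun n _ ↦ IsIntegral.mul ?_ (hx n)
  rw [IsScalarTower.algebraMap_apply k K W]
  exact isIntegral_algebraMap

/-- `D_i(x) ^ p = D_{p i}(x ^ p)`. -/
theorem mem_integralSubalgebra_of_pow (p : ℕ) [hp : Fact p.Prime] [ExpChar W p] {x : W}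
    (hx : x ^ p ∈ d.integralSubalgebra (K := K)) : x ∈ d.integralSubalgebra (K := K) := fun i ↦ by
  refine IsIntegral.of_pow hp.out.pos ?_
  have := d.D_pow_expChar_pow p 1 i x
  rw [pow_one] at this
  rw [← this]
  exact hx _

/-- A separable element `α` is a polynomial in `α ^ p ^ m`, for all `m`. -/
theorem exists_aeval_pow_eq_of_isSeparable {L : Type*} [Field L] [IsDomain W] [Algebra L W] (p : ℕ)
    [ExpChar L p] (m : ℕ) {α : W} (hα : IsSeparable L α) :
    ∃ g : Polynomial L, Polynomial.aeval (α ^ p ^ m) g = α := by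
  let Q := FractionRing W
  have hinj : Function.Injective (algebraMap W Q) := IsFractionRing.injective W Q
  have hα' : IsSeparable L (algebraMap W Q α) := by
    rw [IsSeparable, minpoly.algebraMap_eq hinj]; exact hα
  have hint : IsIntegral L (algebraMap W Q α ^ p ^ m) := hα'.isIntegral.pow _
  have h1 : algebraMap W Q α ∈ IntermediateField.adjoin L {algebraMap W Q α ^ p ^ m} := by
    rw [← IntermediateField.adjoin_simple_eq_adjoin_pow_expChar_pow_of_isSeparable L Q hα' p m]
    exact IntermediateField.mem_adjoin_simple_self L _
  rw [← IntermediateField.mem_toSubalgebra,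
    IntermediateField.adjoin_simple_toSubalgebra_of_isAlgebraic hint.isAlgebraic,
    Algebra.adjoin_singleton_eq_range_aeval] at h1
  obtain ⟨g, hg⟩ := h1
  refine ⟨g, hinj ?_⟩
  rw [← Polynomial.aeval_algebraMap_apply, map_pow]
  exact hg

/-- If `α` is separable over a subfield `L` of the ring of elements with integral derivatives, then
its derivatives are integral as well: up to any finite order, `D_i` is linear over the subring of
`p ^ m`-th powers, and `α` is a polynomial in `α ^ p ^ m` with coefficients in `L`. -/
theorem mem_integralSubalgebra_of_isSeparable {L : Type*} [Field L] [IsDomain W] [Algebra L W]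
    (hL : ∀ x : L, algebraMap L W x ∈ d.integralSubalgebra (K := K)) (p : ℕ) [hp : Fact p.Prime]
    [ExpChar L p] [ExpChar W p] {α : W} (hα : IsSeparable L α) :
    α ∈ d.integralSubalgebra (K := K) := fun i ↦ by
  have hL' : ∀ x : L, algebraMap L W x ∈ integralClosure K W := fun x ↦ by
    have := hL x 0
    rwa [d.D_zero_index] at this
  have hαK : IsIntegral K α := by
    let φ : L →+* integralClosure K W := (algebraMap L W).codRestrict (integralClosure K W) hL'
    have hα' : IsIntegral (integralClosure K W) α := by
      obtain ⟨f, hf, hf0⟩ := hα.isIntegral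
      refine ⟨f.map φ, hf.map φ, ?_⟩
      rw [Polynomial.eval₂_map]
      exact hf0
    exact isIntegral_trans α hα'
  obtain ⟨m, hm⟩ : ∃ m, ∀ s, i s < p ^ m := by
    refine ⟨i.degree, fun s ↦ ?_⟩
    exact (Finsupp.le_degree s i).trans_lt (Nat.lt_pow_self hp.out.one_lt)
  obtain ⟨g, hg⟩ := exists_aeval_pow_eq_of_isSeparable p m hα
  rw [← hg, Polynomial.aeval_eq_sum_range, d.D_sum]
  refine IsIntegral.sum _ fun j _ ↦ ?_
  rw [Algebra.smul_def, mul_comm, ← pow_mul, mul_comm (p ^ m), pow_mul,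
    (d.isConstant_pow p m (α ^ j)).D_mul hm]
  exact ((hαK.pow _).pow _).mul (hL _ i)

theorem isField_integralSubalgebra [IsDomain W]
    (hK : ∀ x i, IsIntegral K (d.D i (algebraMap K W x))) :
    IsField (d.integralSubalgebra (K := K)) := by
  let φ : K →+* d.integralSubalgebra (K := K) := (algebraMap K W).codRestrict _ hK
  let := φ.toAlgebra
  have : Algebra.IsIntegral K (d.integralSubalgebra (K := K)) := ⟨fun x ↦ by
    have h0 : IsIntegral K (x : W) := by simpa [d.D_zero_index] using x.2 0
    obtain ⟨f, hf, hf0⟩ := h0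
    refine ⟨f, hf, ?_⟩
    apply Subtype.coe_injective
    have := Polynomial.hom_eval₂ f φ (d.integralSubalgebra (K := K)).val.toRingHom x
    exact this.trans hf0⟩
  exact isField_of_isIntegral_of_isField' (R := K) (Field.toIsField K)

end Closure

theorem _root_.charP_of_algebra (k : Type*) [CommRing k] (A : Type*) [CommRing A] [Nontrivial A]
    [Algebra k A] (p : ℕ) [hp : Fact p.Prime] [CharP k p] : CharP A p := by
  refine (CharP.charP_iff_prime_eq_zero hp.out).2 ?_
  rw [← map_natCast (algebraMap k A) p, CharP.cast_eq_zero k p, map_zero]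

/-- The elements of an `F`-domain `W` all of whose derivatives are algebraic over an `F`-field `K`
form an `F`-field which is closed under `p`-th roots and under roots of separable polynomials. -/
theorem exists_integral_extension (p : ℕ) [Fact p.Prime] [CharP k p] {K : Type v} [Field K]
    [Algebra k K] {W : Type w} [CommRing W] [IsDomain W] [Algebra k W] (dK : FDerivation F K)
    (d : FDerivation F W) (φ : K →+* W) (hφ : ∀ c, φ (algebraMap k K c) = algebraMap k W c)
    (h : ∀ i x, d.D i (φ x) = φ (dK.D i x)) :
    ∃ (L : Type w) (_ : Field L) (_ : Algebra k L) (dL : FDerivation F L) (j : L →+* W)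
      (ι : K →+* L), (∀ i x, d.D i (j x) = j (dL.D i x)) ∧
      (∀ i x, ι (dK.D i x) = dL.D i (ι x)) ∧ (∀ c, ι (algebraMap k K c) = algebraMap k L c) ∧
      (∀ x, x ^ p ∈ Set.range j → x ∈ Set.range j) ∧
      ∀ f : Polynomial L, f.Separable → ∀ α, f.eval₂ j α = 0 → α ∈ Set.range j := by
  let := φ.toAlgebra
  have : IsScalarTower k K W := IsScalarTower.of_algebraMap_eq fun c ↦ (hφ c).symm
  have hK : ∀ x i, IsIntegral K (d.D i (algebraMap K W x)) := fun x i ↦ by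
    rw [RingHom.algebraMap_toAlgebra, h]; exact isIntegral_algebraMap
  let ι : K →+* d.integralSubalgebra (K := K) := (algebraMap K W).codRestrict _ hK
  let S := d.integralSubalgebra (K := K)
  let fS : Field S := (d.isField_integralSubalgebra hK).toField
  have cW : CharP W p := charP_of_algebra k W p
  have cS : CharP S p := charP_of_algebra k S p
  refine ⟨S, fS,
    Subalgebra.algebra _, d.restrict S fun i x hx ↦ d.D_mem_integralSubalgebra i hx,
    S.val.toRingHom, ι, fun i x ↦ rfl, fun i x ↦ Subtype.ext (h i x).symm,
    fun c ↦ Subtype.ext (hφ c), ?_, ?_⟩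
  · rintro x ⟨y, hy⟩
    exact ⟨⟨x, d.mem_integralSubalgebra_of_pow p (hy ▸ y.2)⟩, rfl⟩
  · intro f hf α hα
    refine ⟨⟨α, d.mem_integralSubalgebra_of_isSeparable (L := S) (fun x ↦ x.2) p ?_⟩, rfl⟩
    exact hf.of_dvd (minpoly.dvd _ _ hα)

/-- `p ^ (m e)` elements which are linearly independent over the constants of level `p ^ m` form a
basis. -/
theorem span_eq_top_of_linearIndependent {K : Type w} [Field K] [Algebra k K] (d : FDerivation F K)
    (p : ℕ) [ExpChar k p] (m : ℕ) {ι : Type*} [Fintype ι] {x : ι → K}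
    (hx : LinearIndependent (d.constants (p ^ m)) x) (hc : Fintype.card ι = (p ^ m) ^ e) :
    Submodule.span (d.constants (p ^ m)) (Set.range x) = ⊤ := by
  by_contra hne
  obtain ⟨z, -, hz⟩ := SetLike.exists_of_lt (lt_top_iff_ne_top.2 hne)
  have := d.card_le_of_linearIndependent p m (hx.option hz)
  rw [Fintype.card_option] at this
  omega

theorem finrank_constants {K : Type w} [Field K] [Algebra k K] (d : FDerivation F K)
    (p : ℕ) [ExpChar k p] (m : ℕ) {ι : Type*} [Fintype ι] {x : ι → K}
    (hx : LinearIndependent (d.constants (p ^ m)) x) (hc : Fintype.card ι = (p ^ m) ^ e) :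
    Module.finrank (d.constants (p ^ m)) K = (p ^ m) ^ e := by
  rw [← hc]
  exact Module.finrank_eq_card_basis
    (Module.Basis.mk hx (d.span_eq_top_of_linearIndependent p m hx hc).ge)

/-- The constants of level `p` of a strict `F`-field are its `p`-th powers: they are killed by the
operators `D_{(0, …, 1, …, 0)}`. -/
theorem IsStrict.constants_eq {K : Type w} [Field K] [Algebra k K] {d : FDerivation F K} {p : ℕ}
    [hp : Fact p.Prime] [CharP K p] (hd : d.IsStrict p) :
    d.constants (p ^ 1) = (frobenius K p).fieldRange := by
  ext x
  rw [mem_constants, RingHom.mem_fieldRange]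
  constructor
  · intro hx
    have : x ∈ {r : K | ∀ s : Fin e, d.D (Finsupp.single s 1) r = 0} := fun s ↦ by
      refine hx _ (by simp) fun t ↦ ?_
      rw [pow_one, Finsupp.single_apply]
      have := hp.out.one_lt
      split_ifs <;> omega
    rw [hd] at this
    exact this
  · rintro ⟨y, rfl⟩
    have := d.isConstant_pow p 1 y
    rwa [pow_one] at this ⊢

/-- Every `F`-field extends to a strict separably closed `F`-field of degree of imperfection `e`. -/
theorem exists_extension (p : ℕ) [hp : Fact p.Prime] [CharP k p] {K : Type w} [Field K]
    [Algebra k K] (d : FDerivation F K) :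
    ∃ (L : Type w) (_ : Field L) (_ : Algebra k L) (_ : CharP L p) (dL : FDerivation F L)
      (ι : K →+* L), (∀ i x, ι (d.D i x) = dL.D i (ι x)) ∧
      (∀ c, ι (algebraMap k K c) = algebraMap k L c) ∧
      dL.IsStrict p ∧ IsSepClosed L ∧ Module.finrank (frobenius L p).fieldRange L = p ^ e := by
  -- The fraction field of the cofree `F`-ring over `K` has the required number of elements which
  -- are linearly independent over the constants.
  let V := MvPowerSeries (Fin e) K
  let Q := FractionRing V
  let dQ : FDerivation F Q := (F.cofree K).fraction Q
  let ι₁ : K →+* Q := (algebraMap V Q).comp (d.toCofree (AlgHom.id k K))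
  have hι₁ : ∀ i x, ι₁ (d.D i x) = dQ.D i (ι₁ x) := fun i x ↦ by
    change algebraMap V Q (d.toCofree (AlgHom.id k K) (d.D i x)) = dQ.D i (algebraMap V Q _)
    rw [← D_toCofree]
    exact ((F.cofree K).D_fraction_algebraMap Q i _).symm
  have hι₁' : ∀ c, ι₁ (algebraMap k K c) = algebraMap k Q c := fun c ↦ by
    rw [IsScalarTower.algebraMap_apply k V Q, RingHom.comp_apply, toCofree_algebraMap]
  have hli : LinearIndependent (dQ.constants (p ^ 1)) _ := F.linearIndependent_monomial K (p ^ 1)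
  -- The extension is the field of elements with algebraic derivatives of a cofree `F`-ring.
  let Ω := AlgebraicClosure Q
  let W := MvPowerSeries (Fin e) Ω
  have : CharP Ω p := charP_of_algebra k Ω p
  let φ : Q →+* W := dQ.toCofree (IsScalarTower.toAlgHom k Q Ω)
  obtain ⟨L, fL, aL, dL, j, ι₂, hj, hι₂, hι₂', hroot, hsep⟩ := exists_integral_extension p dQ
    (F.cofree Ω) φ (dQ.toCofree_algebraMap _) (dQ.D_toCofree _)
  have hcL : CharP L p := charP_of_algebra k L p
  have hstrict : dL.IsStrict p := by
    ext x
    constructor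
    · intro hx
      obtain ⟨g, hg⟩ := F.exists_pow_eq_of_D_cofree_eq_zero p (j x) fun s ↦ by
        rw [hj, hx s, map_zero]
      obtain ⟨z, rfl⟩ := hroot g ⟨x, hg.symm⟩
      exact ⟨z, j.injective (by rw [map_pow, hg])⟩
    · rintro ⟨z, rfl⟩ s
      have := dL.D_pow_expChar_pow_of_not_dvd p 1 (i := Finsupp.single s 1) (s := s)
        (by simpa using hp.out.ne_one) z
      rwa [pow_one] at this
  refine ⟨L, fL, aL, hcL, dL, ι₂.comp ι₁, fun i x ↦ ?_, fun c ↦ ?_, hstrict, ?_, ?_⟩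
  · rw [RingHom.comp_apply, hι₁, hι₂]
    rfl
  · rw [RingHom.comp_apply, hι₁', hι₂']
  · refine IsSepClosed.of_exists_root L fun f hf hirr hs ↦ ?_
    obtain ⟨α, hα⟩ := exists_isRoot_of_map_separable (f.map j) (hf.map j)
      (by rw [hf.natDegree_map]; exact hirr.natDegree_pos.ne') (by
        rw [Polynomial.map_map]
        exact hs.map)
    rw [Polynomial.IsRoot, Polynomial.eval_map] at hα
    obtain ⟨x, rfl⟩ := hsep f hs α hα
    refine ⟨x, j.injective ?_⟩
    rw [map_zero, ← hα, Polynomial.eval₂_at_apply]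
  · have : ExpChar k p := ExpChar.prime hp.out
    rw [← hstrict.constants_eq, ← pow_one (p ^ e), ← pow_mul, mul_comm, pow_mul]
    refine dL.finrank_constants p 1 (dL.linearIndependent_constants_comp dQ p 1 ι₂ hι₂ hli) ?_
    simp

end FDerivation

/-! ### Rational points over separably closed fields -/

/-- Every finitely generated subalgebra of the `N`-algebra `E` has an `N`-rational point, stated as:
every finite subset of `E` is contained in a subalgebra with an `N`-rational point. -/
def HasRationalPoints (N : Type*) (E : Type*) [Field N] [CommRing E] [Algebra N E] : Prop :=
  ∀ C : Finset E, ∃ A : Subalgebra N E, (C : Set E) ⊆ A ∧ Nonempty (A →ₐ[N] N)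

section RationalPoints

variable {N : Type*} [Field N]

instance (priority := 400) IsSepClosed.toInfinite [IsSepClosed N] : Infinite N := by
  by_contra h
  rw [not_infinite_iff_finite] at h
  have : IsAlgClosed N := IsSepClosed.isAlgClosed_of_perfectField N
  exact Infinite.not_finite (α := N) h

/-- Finitely many fractions have a common denominator, and a rational point of `R` at which this
denominator does not vanish extends to the local ring of the point. -/
theorem HasRationalPoints.of_isFractionRing {R K : Type*} [CommRing R] [IsDomain R] [Field K]
    [Algebra N R] [Algebra N K] [Algebra R K] [IsScalarTower N R K] [IsFractionRing R K]
    (H : ∀ r : R, r ≠ 0 → ∃ φ : R →ₐ[N] N, φ r ≠ 0) : HasRationalPoints N K := by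
  intro C
  obtain ⟨b, hb⟩ := IsLocalization.exist_integer_multiples_of_finset (nonZeroDivisors R) C
  obtain ⟨φ, hφ⟩ := H b (nonZeroDivisors.ne_zero b.2)
  have : (RingHom.ker φ).IsPrime := RingHom.ker_isPrime φ
  let S := (RingHom.ker φ).primeCompl
  have hS : S ≤ nonZeroDivisors R := (RingHom.ker φ).primeCompl_le_nonZeroDivisors
  let A := Localization.subalgebra.ofField K S hS
  have hloc : IsLocalization S A := Localization.subalgebra.isLocalization_ofField K S hS
  have hu : ∀ y : S, IsUnit (φ y) := fun y ↦ IsUnit.mk0 _ y.2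
  refine ⟨A.restrictScalars N, fun c hc ↦ ?_,
    ⟨{ (IsLocalization.lift (M := S) (S := A) (g := φ.toRingHom) hu : A →+* N) with
        commutes' := fun n ↦ ?_ }⟩⟩
  swap
  · have h1 : algebraMap N (A.restrictScalars N) n = algebraMap R A (algebraMap N R n) :=
      Subtype.ext (IsScalarTower.algebraMap_apply N R K n)
    rw [h1]
    exact (IsLocalization.lift_eq hu _).trans (φ.commutes n)
  obtain ⟨a, ha⟩ := hb c hc
  refine ⟨a, b, hφ, ?_⟩
  have hb0 : algebraMap R K b ≠ 0 := (IsFractionRing.to_map_ne_zero_of_mem_nonZeroDivisors b.2)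
  rw [ha, Algebra.smul_def, mul_comm, inv_mul_cancel_left₀ hb0]

/-- Rational points are lifted along a finite separable field extension. It is generated by a root
of a monic polynomial `g` with `a g + b g' = 1`. If the coefficients of `g`, `a` and `b` belong to a
subalgebra with a rational point, then the specialization of `g` is separable and has a root. -/
theorem HasRationalPoints.of_isSeparable [IsSepClosed N] {K E : Type*} [Field K] [Field E]
    [Algebra N K] [Algebra N E] [Algebra K E] [IsScalarTower N K E] [FiniteDimensional K E]
    [Algebra.IsSeparable K E] (H : HasRationalPoints N K) : HasRationalPoints N E := by
  classical
  intro C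
  obtain ⟨β, hβ⟩ := Field.exists_primitive_element K E
  have hint : IsIntegral K β := Algebra.IsIntegral.isIntegral β
  have hpoly : ∀ x : E, ∃ f : Polynomial K, Polynomial.aeval β f = x := fun x ↦ by
    have : x ∈ (IntermediateField.adjoin K {β}).toSubalgebra := by rw [hβ]; trivial
    rwa [IntermediateField.adjoin_simple_toSubalgebra_of_isAlgebraic hint.isAlgebraic,
      Algebra.adjoin_singleton_eq_range_aeval] at this
  choose f hf using hpoly
  obtain ⟨a, b, hab⟩ := Algebra.IsSeparable.isSeparable K β
  set g := minpoly K β with hg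
  obtain ⟨A, hA, ⟨φ⟩⟩ := H (g.coeffs ∪ a.coeffs ∪ b.coeffs ∪ C.biUnion fun x ↦ (f x).coeffs)
  have hlift : ∀ h : Polynomial K, (h.coeffs : Set K) ⊆ A →
      h ∈ Polynomial.lifts A.val.toRingHom := by
    intro h hh
    rw [Polynomial.lifts_iff_coeff_lifts]
    intro n
    by_cases hn : h.coeff n = 0
    · exact ⟨0, by rw [hn, map_zero]⟩
    · exact ⟨⟨h.coeff n, hh (Polynomial.coeff_mem_coeffs hn)⟩, rfl⟩
  simp only [Finset.coe_union, Set.union_subset_iff, Finset.coe_biUnion,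
    Set.iUnion_subset_iff] at hA
  obtain ⟨g', hg', -, hg'm⟩ := Polynomial.lifts_and_degree_eq_and_monic (hlift g hA.1.1.1)
    (minpoly.monic hint)
  obtain ⟨a', ha'⟩ := hlift a hA.1.1.2
  obtain ⟨b', hb'⟩ := hlift b hA.1.2
  have hinj : Function.Injective A.val.toRingHom := Subtype.val_injective
  have hsep : g'.Separable := by
    refine ⟨a', b', Polynomial.map_injective _ hinj ?_⟩
    rw [Polynomial.map_add, Polynomial.map_mul, Polynomial.map_mul, ← Polynomial.derivative_map,
      hg', Polynomial.map_one, ← hab]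
    congr
  obtain ⟨z, hz⟩ := IsSepClosed.exists_root (g'.map φ.toRingHom) (by
    rw [hg'm.degree_map, ← hg'm.degree_map A.val.toRingHom, hg']
    exact (minpoly.degree_pos hint).ne') hsep.map
  let ψ : Polynomial A →ₐ[N] E :=
    { Polynomial.eval₂RingHom ((algebraMap K E).comp A.val.toRingHom) β with
      commutes' := fun n ↦ by
        rw [Polynomial.algebraMap_apply]
        change Polynomial.eval₂ _ _ _ = _
        rw [Polynomial.eval₂_C]
        exact (IsScalarTower.algebraMap_apply N K E n).symm }
  let ev : Polynomial A →ₐ[N] N :=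
    { Polynomial.eval₂RingHom φ.toRingHom z with
      commutes' := fun n ↦ by
        rw [Polynomial.algebraMap_apply]
        change Polynomial.eval₂ _ _ _ = _
        rw [Polynomial.eval₂_C]
        exact φ.commutes n }
  have hψ : ∀ h, ψ h = Polynomial.aeval β (h.map A.val.toRingHom) := fun h ↦ by
    rw [Polynomial.aeval_def, Polynomial.eval₂_map]; rfl
  have hker : RingHom.ker ψ.rangeRestrict ≤ RingHom.ker ev := by
    intro h hh
    have h0 : ψ h = 0 := congrArg Subtype.val hh
    rw [hψ] at h0
    have hd := minpoly.dvd K β h0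
    rw [← hg, ← hg', Polynomial.map_dvd_map _ hinj hg'm] at hd
    obtain ⟨r, rfl⟩ := hd
    have : ev g' = 0 := by
      rw [Polynomial.IsRoot, Polynomial.eval_map] at hz
      exact hz
    rw [RingHom.mem_ker, map_mul, this, zero_mul]
  refine ⟨ψ.range, fun x hx ↦ ?_,
    ⟨AlgHom.liftOfSurjective ψ.rangeRestrict ψ.rangeRestrict_surjective ev hker⟩⟩
  obtain ⟨h, hh⟩ := hlift (f x) (hA.2 x hx)
  refine ⟨h, ?_⟩
  change ψ h = x
  rw [hψ, ← hf x, ← hh]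
  rfl

open scoped IntermediateField.algebraAdjoinAdjoin in
/-- Nonzero polynomials over an infinite field do not vanish everywhere. -/
theorem hasRationalPoints_adjoin_of_algebraicIndependent [Infinite N] {E : Type*} [Field E]
    [Algebra N E] {s : Set E} (hs : AlgebraicIndependent N ((↑) : s → E)) :
    HasRationalPoints N (IntermediateField.adjoin N s) := by
  refine HasRationalPoints.of_isFractionRing (R := Algebra.adjoin N s) fun r hr ↦ ?_
  have ε : Algebra.adjoin N s ≃ₐ[N] MvPolynomial s N :=
    (Subalgebra.equivOfEq _ _ (by rw [Subtype.range_coe])).trans hs.aevalEquiv.symm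
  have h0 : ε r ≠ 0 := ε.map_ne_zero_iff.2 hr
  obtain ⟨v, hv⟩ : ∃ v, MvPolynomial.eval v (ε r) ≠ 0 := by
    by_contra! h
    exact h0 (MvPolynomial.funext fun v ↦ by rw [h, map_zero])
  refine ⟨(MvPolynomial.aeval v).comp ε.toAlgHom, ?_⟩
  simpa [MvPolynomial.aeval_eq_eval] using hv

/-- Separability of an extension, in the form that linearly independent elements have linearly
independent `p`-th powers, is inherited by intermediate fields. -/
theorem IntermediateField.linearIndepOn_pow (p : ℕ) {E : Type*} [Field E] [Algebra N E]
    (H : ∀ s : Finset E, LinearIndepOn N _root_.id (s : Set E) →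
      LinearIndepOn N (· ^ p) (s : Set E)) (E' : IntermediateField N E) (s : Finset E')
    (hs : LinearIndepOn N _root_.id (s : Set E')) : LinearIndepOn N (· ^ p) (s : Set E') := by
  classical
  have hinj : Set.InjOn E'.val (s : Set E') := Subtype.val_injective.injOn
  have h1 : LinearIndepOn N _root_.id ((s.image E'.val : Finset E) : Set E) := by
    rw [Finset.coe_image, ← linearIndepOn_iff_image hinj]
    exact hs.map_injOn E'.val.toLinearMap Subtype.val_injective.injOn
  have h2 := (linearIndepOn_finset_iff.1 (H _ h1))
  rw [linearIndepOn_finset_iff]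
  intro g hg i hi
  have h3 := h2 (fun x ↦ if hx : x ∈ E' then g ⟨x, hx⟩ else 0) ?_ i (Finset.mem_image_of_mem _ hi)
  · simpa using h3
  · rw [Finset.sum_image hinj]
    have := congrArg E'.val hg
    rw [map_zero, map_sum] at this
    rw [← this]
    refine Finset.sum_congr rfl fun x _ ↦ ?_
    rw [dif_pos (show E'.val x ∈ E' from x.2)]
    rfl

/-- A separable extension of a separably closed field has rational points. Separability is used in
the form that linearly independent elements have linearly independent `p`-th powers; a finitely
generated subextension is then finite separable over a purely transcendental one. -/
theorem hasRationalPoints_of_linearIndepOn_pow [IsSepClosed N] (p : ℕ) (hp : p.Prime) [ExpChar N p]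
    {E : Type*} [Field E] [Algebra N E]
    (H : ∀ s : Finset E, LinearIndepOn N _root_.id (s : Set E) →
      LinearIndepOn N (· ^ p) (s : Set E)) : HasRationalPoints N E := by
  classical
  intro C
  let E' := IntermediateField.adjoin N (C : Set E)
  have : Algebra.EssFiniteType N E' := IntermediateField.essFiniteType_iff.2 ⟨C, rfl⟩
  obtain ⟨s, hs, hsep⟩ :=
    exists_isTranscendenceBasis_and_isSeparable_of_linearIndepOn_pow_of_essFiniteType p hp
      (E'.linearIndepOn_pow p H)
  let K := IntermediateField.adjoin N (s : Set E')
  have hK : HasRationalPoints N K := hasRationalPoints_adjoin_of_algebraicIndependent hs.1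
  have : FiniteDimensional K E' := by
    have h1 : Algebra.EssFiniteType K E' := .of_comp N _ _
    have h2 : Algebra.IsAlgebraic K E' := hsep.isAlgebraic
    exact Algebra.finite_of_essFiniteType_of_isAlgebraic
  have hC : ∀ c ∈ C, c ∈ E' := fun c hc ↦ IntermediateField.subset_adjoin N _ hc
  have hE' : HasRationalPoints N E' := hK.of_isSeparable
  let C' : Finset E' := C.attach.image fun c ↦ ⟨c.1, hC c.1 c.2⟩
  obtain ⟨A, hA, ⟨φ⟩⟩ := hE' C'
  refine ⟨A.map E'.val, fun c hc ↦ ?_,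
    ⟨φ.comp (A.equivMapOfInjective E'.val Subtype.val_injective).symm.toAlgHom⟩⟩
  exact ⟨⟨c, hC c hc⟩, hA (Finset.mem_image_of_mem _ (Finset.mem_attach C ⟨c, hc⟩)), rfl⟩

end RationalPoints

/-! ### Specializations of extensions of strict separably closed fields -/

/-- A family `y` is a basis of the field `N` over the subfield `N ^ q` of `q`-th powers. -/
structure IsPowBasis {N ι : Type*} [Field N] [Fintype ι] (q : ℕ) (y : ι → N) : Prop where
  eq_zero : ∀ a : ι → N, ∑ l, a l ^ q * y l = 0 → ∀ l, a l = 0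
  exists_eq_sum : ∀ x, ∃ a : ι → N, x = ∑ l, a l ^ q * y l

namespace IsPowBasis

variable {N ι κ : Type*} [Field N] [Fintype ι] [Fintype κ]

/-- If `y` is a basis of `N` over `N ^ q'` and `z` is one over `N ^ q`, then the products of
elements of `y` with `q'`-th powers of elements of `z` form a basis over `N ^ (q q')`. -/
theorem mul {q q' : ℕ}
    (hadd : ∀ a : κ → N, (∑ j, a j) ^ q' = ∑ j, a j ^ q')
    {z : κ → N} (hz : IsPowBasis q z) {y : ι → N} (hy : IsPowBasis q' y) :
    IsPowBasis (q * q') fun lj : ι × κ ↦ z lj.2 ^ q' * y lj.1 := by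
  have key : ∀ a : ι × κ → N, ∑ lj, a lj ^ (q * q') * (z lj.2 ^ q' * y lj.1) =
      ∑ l, (∑ j, a (l, j) ^ q * z j) ^ q' * y l := fun a ↦ by
    rw [Fintype.sum_prod_type]
    refine Finset.sum_congr rfl fun l _ ↦ ?_
    rw [hadd, Finset.sum_mul]
    refine Finset.sum_congr rfl fun j _ ↦ ?_
    rw [mul_pow, pow_mul, mul_assoc]
  constructor
  · intro a ha lj
    rw [key] at ha
    exact hz.eq_zero _ (hy.eq_zero _ ha lj.1) lj.2
  · intro x
    obtain ⟨a, rfl⟩ := hy.exists_eq_sum x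
    choose b hb using fun l ↦ hz.exists_eq_sum (a l)
    exact ⟨fun lj ↦ b lj.1 lj.2, by simp only [key, ← hb]⟩

theorem exists_of_finrank (p e m : ℕ) [Fact p.Prime] [CharP N p]
    (h : Module.finrank (frobenius N p).fieldRange N = p ^ e) :
    ∃ (ι : Type) (_ : Fintype ι) (y : ι → N), Fintype.card ι = (p ^ m) ^ e ∧
      IsPowBasis (p ^ m) y := by
  obtain ⟨z, hz1, hz2⟩ := (finrank_fieldRange_frobenius_iff p e N).2 h
  have hz : IsPowBasis p z := ⟨hz1, hz2⟩
  induction m with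
  | zero =>
    refine ⟨Unit, inferInstance, fun _ ↦ 1, by simp, ?_, fun x ↦ ⟨fun _ ↦ x, by simp⟩⟩
    intro a ha l
    simpa using ha
  | succ m ih =>
    obtain ⟨ι, hι, y, hc, hy⟩ := ih
    refine ⟨ι × Fin (p ^ e), inferInstance, fun lj ↦ z lj.2 ^ p ^ m * y lj.1, ?_, ?_⟩
    · rw [Fintype.card_prod, hc, Fintype.card_fin, ← mul_pow, pow_succ]
    · rw [pow_succ']
      exact mul (sum_pow_char_pow p m _) hz hy

end IsPowBasis

namespace FDerivation

variable {k : Type u} [CommRing k] {e : ℕ} {F : FormalGroupLaw k e}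
  {N : Type v} [Field N] [Algebra k N] {dN : FDerivation F N}
  {K : Type w} [Field K] [Algebra k K] {dK : FDerivation F K}

/-- In a strict `F`-field the constants of level `p ^ m` are the `p ^ m`-th powers. -/
theorem IsStrict.exists_pow_eq {p : ℕ} [hp : Fact p.Prime] [CharP N p] (hd : dN.IsStrict p) (m : ℕ)
    {x : N} (hx : dN.IsConstant (p ^ m) x) : ∃ y, y ^ p ^ m = x := by
  induction m generalizing x with
  | zero => exact ⟨x, by simp⟩
  | succ m ih =>
    have h1 : x ∈ dN.constants (p ^ 1) := hx.mono (Nat.pow_le_pow_right hp.out.pos (by omega))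
    rw [hd.constants_eq] at h1
    obtain ⟨z, rfl⟩ := h1
    obtain ⟨y, rfl⟩ := ih (x := z) fun i h0 hi ↦ by
      have h2 := dN.D_pow_expChar_pow p 1 i z
      rw [pow_one, ← frobenius_def, hx] at h2
      · exact (pow_eq_zero_iff hp.out.ne_zero).1 h2.symm
      · simpa [hp.out.ne_zero] using h0
      · intro s
        rw [pow_succ']
        simpa using Nat.mul_lt_mul_of_pos_left (hi s) hp.out.pos
    exact ⟨y, by rw [frobenius_def, ← pow_mul, pow_succ]⟩

/-- A family which is linearly independent over the `p ^ m`-th powers of a strict `F`-field is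
linearly independent over the constants of level `p ^ m`. -/
theorem IsStrict.linearIndependent_constants {p : ℕ} [hp : Fact p.Prime] [CharP N p]
    (hd : dN.IsStrict p) {m : ℕ} {ι : Type*} [Fintype ι] {y : ι → N}
    (hy : ∀ a : ι → N, ∑ l, a l ^ p ^ m * y l = 0 → ∀ l, a l = 0) :
    LinearIndependent (dN.constants (p ^ m)) y := by
  rw [Fintype.linearIndependent_iff]
  intro g hg l
  choose a ha using fun l ↦ hd.exists_pow_eq m (g l).2
  have h1 := hy a (by simpa [ha, Subfield.smul_def] using hg) l
  apply Subtype.ext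
  rw [← ha, h1, ZeroMemClass.coe_zero, zero_pow (pow_ne_zero _ hp.out.ne_zero)]

section constantsHom

variable {N : Type v} [Field N] {K : Type w} [Field K] [Algebra k K] {dK : FDerivation F K}

variable (dK) in
/-- The field of constants of level `p ^ m` of an extension `K` of a field `N` of characteristic
`p`, as an extension of `N` via `n ↦ f(n) ^ p ^ m`. -/
def constantsHom (p : ℕ) [ExpChar N p] [ExpChar K p] (m : ℕ) (f : N →+* K) :
    N →+* dK.constants (p ^ m) :=
  (f.comp (iterateFrobenius N p m)).codRestrict _ fun n ↦ by
    rw [RingHom.comp_apply, iterateFrobenius_def, map_pow]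
    exact dK.isConstant_pow p m (f n)

theorem coe_constantsHom (p : ℕ) [ExpChar N p] [ExpChar K p] (m : ℕ) (f : N →+* K) (n : N) :
    (dK.constantsHom p m f n : K) = f n ^ p ^ m := by
  rw [← map_pow]; rfl

end constantsHom

/-- The constants of level `p ^ m` of an extension of a strict `F`-field `N` form a separable
extension of `N` (via `n ↦ n ^ p ^ m`). Thus they have `N`-rational points if `N` is separably
closed. -/
theorem hasRationalPoints_constants (p : ℕ) [hp : Fact p.Prime] [CharP k p] [CharP N p] [CharP K p]
    (hd : dN.IsStrict p) [IsSepClosed N]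
    (hN : Module.finrank (frobenius N p).fieldRange N = p ^ e) (f : N →+* K)
    (hf : ∀ i x, f (dN.D i x) = dK.D i (f x)) (m : ℕ) :
    letI := (dK.constantsHom p m f).toAlgebra
    HasRationalPoints N (dK.constants (p ^ m)) := by
  let := (dK.constantsHom p m f).toAlgebra
  have : ExpChar k p := ExpChar.prime hp.out
  refine hasRationalPoints_of_linearIndepOn_pow p hp.out fun s hs ↦ ?_
  obtain ⟨z, hz1, hz2⟩ := (finrank_fieldRange_frobenius_iff p e N).2 hN
  rw [linearIndepOn_finset_iff] at hs ⊢
  intro g hg x hx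
  choose a ha using hz2
  -- The `p ^ m`-th powers of the basis are linearly independent over the constants of level
  -- `p ^ (m + 1)`.
  have hli : LinearIndependent (dN.constants (p ^ (m + 1))) fun j ↦ z j ^ p ^ m := by
    refine hd.linearIndependent_constants fun b hb ↦ hz1 b ?_
    refine (pow_eq_zero_iff (pow_ne_zero m hp.out.ne_zero)).1 ?_
    rw [sum_pow_char_pow, ← hb]
    refine Finset.sum_congr rfl fun j _ ↦ ?_
    rw [mul_pow, ← pow_mul, pow_succ']
  have hliK := Fintype.linearIndependent_iff.1
    (dK.linearIndependent_constants_comp dN p (m + 1) f hf hli)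
  -- Expanding the coefficients of a relation between `p`-th powers in the basis `z` of `N` over
  -- `N ^ p` splits it into relations `t j = 0` between the elements of `s` themselves.
  let t : Fin (p ^ e) → dK.constants (p ^ m) := fun j ↦ ∑ x ∈ s, a (g x) j • x
  have ht : ∀ j, t j = 0 := fun j ↦ by
    have h1 := hliK (fun j ↦ ⟨(t j : K) ^ p, (t j).2.pow p⟩) ?_ j
    · exact Subtype.ext ((pow_eq_zero_iff hp.out.ne_zero).1 (congrArg Subtype.val h1))
    · have h2 := congrArg Subtype.val hg
      rw [AddSubmonoidClass.coe_finsetSum, ZeroMemClass.coe_zero] at h2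
      rw [← h2]
      simp only [t, Subfield.smul_def, smul_eq_mul, AddSubmonoidClass.coe_finsetSum,
        sum_pow_char, Finset.sum_mul]
      rw [Finset.sum_comm]
      refine Finset.sum_congr rfl fun x _ ↦ ?_
      rw [Algebra.smul_def, RingHom.algebraMap_toAlgebra, MulMemClass.coe_mul, coe_constantsHom]
      conv_rhs => rw [ha (g x)]
      rw [map_sum, sum_pow_char_pow, Finset.sum_mul]
      refine Finset.sum_congr rfl fun j _ ↦ ?_
      rw [Algebra.smul_def, RingHom.algebraMap_toAlgebra, MulMemClass.coe_mul, coe_constantsHom]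
      simp only [map_mul, map_pow, mul_pow, SubmonoidClass.coe_pow]
      ring
  rw [ha (g x)]
  refine Finset.sum_eq_zero fun j _ ↦ ?_
  rw [hs _ (ht j) x hx, zero_pow hp.out.ne_zero, zero_mul]

/-- Let `N` be a strict separably closed `F`-field of degree of imperfection `e`. For each finite
set `Z` of elements of an extension `K` of `N` there is a homomorphism over `N` from a subring of
`K` which contains `Z` to `N`, which commutes with all `D_i` such that `i` has entries smaller than
`p ^ m`. The homomorphism is given by its graph `G`.

With `B` a ring of constants of `K` of level `p ^ m` which has a rational point, the subring is
`B ⊗ N`, where the tensor product is taken over the `p ^ m`-th powers of `N`; the operators `D_i` in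
question are linear over `B`. -/
theorem exists_specialization (p : ℕ) [hp : Fact p.Prime] [CharP k p] [CharP N p] [CharP K p]
    (hd : dN.IsStrict p) [IsSepClosed N]
    (hN : Module.finrank (frobenius N p).fieldRange N = p ^ e) (f : N →+* K)
    (hf : ∀ i x, f (dN.D i x) = dK.D i (f x)) (m : ℕ) (Z : Finset K) :
    ∃ G : Subring (K × N), (∀ n, (0, n) ∈ G → n = 0) ∧ (∀ n, (f n, n) ∈ G) ∧
      (∀ i, (∀ s, i s < p ^ m) → ∀ x ∈ G, (dK.D i x.1, dN.D i x.2) ∈ G) ∧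
      ∀ z ∈ Z, ∃ n, (z, n) ∈ G := by
  classical
  have : ExpChar k p := ExpChar.prime hp.out
  obtain ⟨ι, _, y, hc, hy⟩ := IsPowBasis.exists_of_finrank p e m hN
  have hliN := hd.linearIndependent_constants hy.eq_zero
  have hli := dK.linearIndependent_constants_comp dN p m f hf hliN
  let b : Module.Basis ι (dK.constants (p ^ m)) K :=
    Module.Basis.mk hli (dK.span_eq_top_of_linearIndependent p m hli hc).ge
  have hb : ∀ z, z = ∑ l, (b.repr z l : K) * f (y l) := fun z ↦ by
    conv_lhs => rw [← b.sum_repr z]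
    simp [b, Subfield.smul_def]
  let := (dK.constantsHom p m f).toAlgebra
  obtain ⟨B, hB, ⟨φ⟩⟩ := hasRationalPoints_constants (dK := dK) p hd hN f hf m
    (Z.biUnion fun z ↦ Finset.univ.image (b.repr z))
  -- An element of `N` occurs in `B` as its `p ^ m`-th power, so the point `φ` is twisted by
  -- Frobenius.
  let θ : B →+* N := (iterateFrobenius N p m).comp φ.toRingHom
  have hθ : ∀ c, θ c = φ c ^ p ^ m := fun c ↦ iterateFrobenius_def ..
  let inc : B →+* K := (dK.constants (p ^ m)).subtype.comp B.val.toRingHom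
  have hinc : ∀ n : N, inc (algebraMap N B n) = f n ^ p ^ m := fun n ↦
    coe_constantsHom (dK := dK) p m f n
  have hθn : ∀ n : N, θ (algebraMap N B n) = n ^ p ^ m := fun n ↦ by rw [hθ, AlgHom.commutes]; rfl
  -- A sum `∑ c_j f(n_j)` with `c_j ∈ B` is mapped to `∑ θ(c_j) n_j`, whether the `n_j` are
  -- the elements of the basis or not.
  let G₀ : Set (K × N) :=
    {x | ∃ c : ι → B, x.1 = ∑ l, inc (c l) * f (y l) ∧ x.2 = ∑ l, θ (c l) * y l}
  have hadd : ∀ x ∈ G₀, ∀ x' ∈ G₀, x + x' ∈ G₀ := by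
    rintro ⟨_, _⟩ ⟨c, rfl, rfl⟩ ⟨_, _⟩ ⟨c', rfl, rfl⟩
    refine ⟨c + c', ?_, ?_⟩ <;>
    simp only [Prod.mk_add_mk, Pi.add_apply, map_add, add_mul, Finset.sum_add_distrib]
  have hsmul : ∀ (c : B) (n : N), (inc c * f n, θ c * n) ∈ G₀ := fun c n ↦ by
    obtain ⟨a, rfl⟩ := hy.exists_eq_sum n
    refine ⟨fun l ↦ c * algebraMap N B (a l), ?_, ?_⟩
    · simp only [map_mul, map_sum, Finset.mul_sum, hinc, map_pow, mul_assoc]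
    · simp only [map_mul, hθn, Finset.mul_sum, mul_assoc]
  have hzero : (0 : K × N) ∈ G₀ := ⟨0, by simp, by simp⟩
  have hsum : ∀ {J : Type} [Fintype J] (c : J → B) (n : J → N),
      (∑ j, inc (c j) * f (n j), ∑ j, θ (c j) * n j) ∈ G₀ := by
    intro J _ c n
    have : ∀ s : Finset J, (∑ j ∈ s, inc (c j) * f (n j), ∑ j ∈ s, θ (c j) * n j) ∈ G₀ := by
      intro s
      induction s using Finset.induction_on with
      | empty => exact hzero
      | insert j s hj ih =>
        rw [Finset.sum_insert hj, Finset.sum_insert hj]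
        exact hadd _ (hsmul _ _) _ ih
    exact this _
  have hn : ∀ n, (f n, n) ∈ G₀ := fun n ↦ by simpa using hsmul 1 n
  let G : Subring (K × N) :=
    { carrier := G₀
      zero_mem' := hzero
      one_mem' := by
        have := hn 1
        rwa [map_one] at this
      add_mem' := fun hx hx' ↦ hadd _ hx _ hx'
      neg_mem' := by
        rintro ⟨_, _⟩ ⟨c, rfl, rfl⟩
        refine ⟨-c, ?_, ?_⟩ <;> simp
      mul_mem' := by
        rintro ⟨_, _⟩ ⟨_, _⟩ ⟨c, rfl, rfl⟩ ⟨c', rfl, rfl⟩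
        rw [Prod.mk_mul_mk]
        convert hsum (fun lj : ι × ι ↦ c lj.1 * c' lj.2) (fun lj ↦ y lj.1 * y lj.2) using 2 <;>
        · rw [Finset.sum_mul_sum, Fintype.sum_prod_type]
          refine Finset.sum_congr rfl fun l _ ↦ Finset.sum_congr rfl fun j _ ↦ ?_
          simp only [map_mul]
          ring }
  refine ⟨G, ?_, hn, ?_, fun z hz ↦ ?_⟩
  · rintro n ⟨c, h0, rfl⟩
    have h1 : ∀ l, (c l : dK.constants (p ^ m)) = 0 :=
      Fintype.linearIndependent_iff.1 hli (fun l ↦ c l) h0.symm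
    refine Finset.sum_eq_zero fun l _ ↦ ?_
    rw [show c l = 0 from Subtype.ext (h1 l), map_zero, zero_mul]
  · rintro i hi ⟨_, _⟩ ⟨c, rfl, rfl⟩
    change (_, _) ∈ G₀
    convert hsum c (fun l ↦ dN.D i (y l)) using 2
    · rw [dK.D_sum]
      refine Finset.sum_congr rfl fun l _ ↦ ?_
      have hcl : dK.IsConstant (p ^ m) (inc (c l)) := (c l).1.2
      rw [hcl.D_mul hi, hf]
    · rw [dN.D_sum]
      refine Finset.sum_congr rfl fun l _ ↦ ?_
      rw [hθ, (dN.isConstant_pow p m _).D_mul hi]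
  · have hzB : ∀ l, b.repr z l ∈ B := fun l ↦ hB (Finset.mem_coe.2 (Finset.mem_biUnion.2
      ⟨z, hz, Finset.mem_image_of_mem _ (Finset.mem_univ l)⟩))
    exact ⟨_, fun l ↦ ⟨b.repr z l, hzB l⟩, hb z, rfl⟩

end FDerivation

/-! ### A criterion for quantifier elimination -/

namespace FirstOrder.Language

variable {L : Language.{u, v}}

namespace Theory

variable {T : L.Theory}

/-- Compactness: a consequence of a theory and of a set `Γ` of sentences which is closed under
conjunctions is a consequence of the theory and of one sentence of `Γ`. -/
theorem ModelsBoundedFormula.exists_mem_imp {Γ : L.Theory} (htop : ⊤ ∈ Γ)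
    (hinf : ∀ χ ∈ Γ, ∀ χ' ∈ Γ, χ ⊓ χ' ∈ Γ) {σ : L.Sentence} (h : T ∪ Γ ⊨ᵇ σ) :
    ∃ χ ∈ Γ, T ⊨ᵇ χ.imp σ := by
  classical
  obtain ⟨T₀, hT₀, hσ⟩ := models_iff_finset_models.1 h
  have key : ∀ s : Finset L.Sentence, (s : L.Theory) ⊆ T ∪ Γ →
      ∃ χ ∈ Γ, ∀ M : ModelType.{u, v, max u v} T, M ⊨ χ → ∀ τ ∈ s, M ⊨ τ := by
    intro s
    induction s using Finset.induction_on with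
    | empty => exact fun _ ↦ ⟨⊤, htop, by simp⟩
    | insert τ s _ ih =>
      intro hs
      rw [Finset.coe_insert, Set.insert_subset_iff] at hs
      obtain ⟨χ, hχ, h1⟩ := ih hs.2
      rcases hs.1 with hτ | hτ
      · refine ⟨χ, hχ, fun M hM τ' hτ' ↦ ?_⟩
        rcases Finset.mem_insert.1 hτ' with rfl | hτ'
        · exact T.realize_sentence_of_mem hτ
        · exact h1 M hM τ' hτ'
      · refine ⟨τ ⊓ χ, hinf _ hτ _ hχ, fun M hM τ' hτ' ↦ ?_⟩
        rw [Sentence.Realize, Formula.realize_inf] at hM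
        rcases Finset.mem_insert.1 hτ' with rfl | hτ'
        · exact hM.1
        · exact h1 M hM.2 τ' hτ'
  obtain ⟨χ, hχ, h1⟩ := key T₀ hT₀
  refine ⟨χ, hχ, models_sentence_iff.2 fun M ↦ ?_⟩
  rw [Sentence.Realize, Formula.realize_imp]
  intro hM
  have : M ⊨ (T₀ : L.Theory) := ⟨fun τ hτ ↦ h1 M hM τ hτ⟩
  exact hσ.realize_sentence M

/-- A sentence which is preserved between all models of `T` satisfying the same sentences of a
Boolean algebra `Q` of sentences is equivalent modulo `T` to a member of `Q`. -/
theorem exists_mem_iff_of_forall_realize {Q : L.Theory} (htop : ⊤ ∈ Q)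
    (hinf : ∀ χ ∈ Q, ∀ χ' ∈ Q, χ ⊓ χ' ∈ Q) (hnot : ∀ χ ∈ Q, Formula.not χ ∈ Q) {σ : L.Sentence}
    (h : ∀ M N : ModelType.{u, v, max u v} T, (∀ χ ∈ Q, M ⊨ χ → N ⊨ χ) → M ⊨ σ → N ⊨ σ) :
    ∃ χ ∈ Q, T ⊨ᵇ σ.iff χ := by
  -- By compactness it suffices that `σ` follows from its consequences in `Q`. In a model `N` of
  -- these consequences, the set `Δ` of members of `Q` which hold in `N` is consistent with `σ`.
  let Γ : L.Theory := {χ | χ ∈ Q ∧ T ⊨ᵇ σ.imp χ}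
  have hΓ : T ∪ Γ ⊨ᵇ σ := by
    rw [models_sentence_iff]
    intro N
    have hN := model_union_iff.1 N.is_model
    have hNT := hN.1
    by_contra hσ
    let Δ : L.Theory := {χ | χ ∈ Q ∧ N ⊨ χ}
    have hΔ : ¬ T ∪ Δ ⊨ᵇ Formula.not σ := by
      intro h1
      obtain ⟨χ, ⟨hχ, hNχ⟩, h2⟩ := ModelsBoundedFormula.exists_mem_imp (Γ := Δ)
        ⟨htop, by simp [Sentence.Realize]⟩
        (fun χ hχ χ' hχ' ↦ ⟨hinf _ hχ.1 _ hχ'.1, by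
          rw [Sentence.Realize, Formula.realize_inf]; exact ⟨hχ.2, hχ'.2⟩⟩) h1
      have h3 : Formula.not χ ∈ Γ := by
        refine ⟨hnot _ hχ, models_sentence_iff.2 fun M ↦ ?_⟩
        have := models_sentence_iff.1 h2 M
        simp only [Sentence.Realize, Formula.realize_imp, Formula.realize_not] at this ⊢
        exact fun a b ↦ this b a
      exact (Sentence.realize_not N).1 (hN.2.realize_of_mem _ h3) hNχ
    rw [models_sentence_iff] at hΔ
    push Not at hΔ
    obtain ⟨M, hM⟩ := hΔ
    rw [Sentence.realize_not, not_not] at hM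
    have hM' := model_union_iff.1 M.is_model
    have hMT := hM'.1
    refine hσ (h (ModelType.of T M) (ModelType.of T N) (fun χ hχ hMχ ↦ ?_) hM)
    by_contra hNχ
    exact (Sentence.realize_not M).1
      (hM'.2.realize_of_mem _ ⟨hnot χ hχ, (Sentence.realize_not N).2 hNχ⟩) hMχ
  obtain ⟨χ, hχ, h1⟩ := ModelsBoundedFormula.exists_mem_imp (Γ := Γ)
    ⟨htop, models_sentence_iff.2 fun M ↦ by simp [Sentence.Realize]⟩
    (fun χ hχ χ' hχ' ↦ ⟨hinf _ hχ.1 _ hχ'.1, models_sentence_iff.2 fun M ↦ by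
      have h1 := models_sentence_iff.1 hχ.2 M
      have h2 := models_sentence_iff.1 hχ'.2 M
      simp only [Sentence.Realize, Formula.realize_imp, Formula.realize_inf] at h1 h2 ⊢
      exact fun h ↦ ⟨h1 h, h2 h⟩⟩) hΓ
  refine ⟨χ, hχ.1, models_sentence_iff.2 fun M ↦ ?_⟩
  have h2 := models_sentence_iff.1 h1 M
  have h3 := models_sentence_iff.1 hχ.2 M
  simp only [Sentence.Realize, Formula.realize_imp, Formula.realize_iff] at h2 h3 ⊢
  exact ⟨h3, h2⟩

/-- A formula which is preserved between all tuples in models of `T` satisfying the same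
quantifier-free formulas is equivalent to a quantifier-free formula modulo `T`. -/
theorem exists_isQF_iff_of_forall_realize {α : Type w} {φ : L.Formula α}
    (h : ∀ (M N : ModelType.{u, v, max u v w} T) (a : α → M) (b : α → N),
      (∀ ψ : L.Formula α, ψ.IsQF → ψ.Realize a → ψ.Realize b) → φ.Realize a → φ.Realize b) :
    ∃ ψ : L.Formula α, ψ.IsQF ∧ T ⊨ᵇ φ.iff ψ := by
  obtain ⟨_, ⟨ψ, hψ, rfl⟩, h1⟩ := exists_mem_iff_of_forall_realize
    (T := (L.lhomWithConstants α).onTheory T)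
    (Q := Formula.equivSentence '' {ψ : L.Formula α | ψ.IsQF}) (σ := Formula.equivSentence φ)
    ⟨⊤, BoundedFormula.IsQF.top, rfl⟩
    (by rintro _ ⟨ψ, hψ, rfl⟩ _ ⟨ψ', hψ', rfl⟩; exact ⟨ψ ⊓ ψ', hψ.inf hψ', rfl⟩)
    (by rintro _ ⟨ψ, hψ, rfl⟩; exact ⟨ψ.not, hψ.not, rfl⟩) (by
      intro M N hMN
      let := (L.lhomWithConstants α).reduct M
      let := (L.lhomWithConstants α).reduct N
      have : M ⊨ T := (LHom.onTheory_model _ _).1 M.is_model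
      have : N ⊨ T := (LHom.onTheory_model _ _).1 N.is_model
      rw [Formula.realize_equivSentence, Formula.realize_equivSentence]
      refine h (ModelType.of T M) (ModelType.of T N) _ _ fun ψ hψ h1 ↦ ?_
      have h2 := hMN _ ⟨ψ, hψ, rfl⟩
      rw [Formula.realize_equivSentence, Formula.realize_equivSentence] at h2
      exact h2 h1)
  refine ⟨ψ, hψ, models_formula_iff_onTheory_models_equivSentence.2 h1⟩

end Theory

theorem BoundedFormula.IsQF.toFormula {α : Type w} {n : ℕ} {φ : L.BoundedFormula α n}
    (h : φ.IsQF) : φ.toFormula.IsQF := by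
  induction h with
  | falsum => exact .falsum
  | of_isAtomic h =>
    cases h with
    | equal t₁ t₂ => exact .of_isAtomic (.equal _ _)
    | rel R ts => exact .of_isAtomic (.rel _ _)
  | imp _ _ ih₁ ih₂ => exact .imp ih₁ ih₂

namespace Theory

variable {T : L.Theory}

/-- Quantifier elimination follows if for tuples `a` and `b` of models `M` and `N` of `T` which
satisfy the same quantifier-free formulas, and every quantifier-free `θ`, if `θ(a, x)` is
satisfiable in `M` then `θ(b, y)` is satisfiable in `N`. -/
theorem exists_isQF_iff_of_exists_realize {α : Type w}
    (H : ∀ (n : ℕ) (M N : ModelType.{u, v, max u v w} T) (a : α ⊕ Fin n → M) (b : α ⊕ Fin n → N),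
      (∀ ψ : L.Formula (α ⊕ Fin n), ψ.IsQF → ψ.Realize a → ψ.Realize b) →
      ∀ θ : L.Formula (Option (α ⊕ Fin n)), θ.IsQF →
        ∀ x : M, θ.Realize (fun o ↦ o.elim x a) → ∃ y : N, θ.Realize (fun o ↦ o.elim y b))
    {n : ℕ} (φ : L.BoundedFormula α n) :
    ∃ ψ : L.BoundedFormula α n, ψ.IsQF ∧ T ⊨ᵇ φ.iff ψ := by
  induction φ using BoundedFormula.induction_on_exists_not with
  | hqf h => exact ⟨_, h, fun M v xs ↦ by rw [BoundedFormula.realize_iff]⟩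
  | hnot h =>
    obtain ⟨ψ, hψ, h1⟩ := h
    refine ⟨ψ.not, hψ.not, fun M v xs ↦ ?_⟩
    have := h1 M v xs
    rw [BoundedFormula.realize_iff] at this ⊢
    rw [BoundedFormula.realize_not, BoundedFormula.realize_not, this]
  | @hse m φ₁ φ₂ h =>
    have h' : ∀ (M : ModelType.{u, v, max u v w} T) (v : α → M) (xs),
        φ₁.Realize v xs ↔ φ₂.Realize v xs :=
      fun M v xs ↦ (BoundedFormula.realize_iff).1 (ModelsBoundedFormula.realize_boundedFormula h M)
    refine exists_congr fun ψ ↦ and_congr_right fun _ ↦ forall_congr' fun M ↦ forall_congr' fun v ↦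
      forall_congr' fun xs ↦ ?_
    rw [BoundedFormula.realize_iff, BoundedFormula.realize_iff, h']
  | @hex m φ h =>
    obtain ⟨ψ, hψ, h1⟩ := h
    -- The variable which is bound by the quantifier becomes `none`.
    let g : α ⊕ Fin (m + 1) → Option (α ⊕ Fin m) :=
      Sum.elim (fun c ↦ some (Sum.inl c)) (Fin.snoc (fun i ↦ some (Sum.inr i)) none)
    have hg : ∀ {M : Type (max u v w)} (a : α ⊕ Fin m → M) (x : M),
        (fun o : Option (α ⊕ Fin m) ↦ o.elim x a) ∘ g =
          Sum.elim (a ∘ Sum.inl) (Fin.snoc (a ∘ Sum.inr) x) := by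
      intro M a x
      funext c
      rcases c with c | c
      · rfl
      · induction c using Fin.lastCases with
        | last => simp [g]
        | cast i => simp [g]
    have hθ : ∀ (M : Type (max u v w)) [L.Structure M] (a : α ⊕ Fin m → M) (x : M),
        (ψ.toFormula.relabel g).Realize (fun o ↦ o.elim x a) ↔
          ψ.Realize (a ∘ Sum.inl) (Fin.snoc (a ∘ Sum.inr) x) := by
      intro M _ a x
      rw [Formula.realize_relabel, hg, BoundedFormula.realize_toFormula]
      rfl
    obtain ⟨χ, hχ, h2⟩ := exists_isQF_iff_of_forall_realize (T := T) (φ := ψ.ex.toFormula) (by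
      intro M N a b hab
      rw [BoundedFormula.realize_toFormula, BoundedFormula.realize_toFormula,
        BoundedFormula.realize_ex, BoundedFormula.realize_ex]
      rintro ⟨x, hx⟩
      obtain ⟨y, hy⟩ := H m M N a b hab (ψ.toFormula.relabel g) (hψ.toFormula.relabel _) x
        ((hθ M a x).2 hx)
      exact ⟨y, (hθ N b y).1 hy⟩)
    refine ⟨BoundedFormula.relabel (n := m) id χ, hχ.relabel _, fun M v xs ↦ ?_⟩
    have h3 : Formula.Realize (∃' ψ).toFormula (Sum.elim v xs) ↔
        Formula.Realize χ (Sum.elim v xs) := BoundedFormula.realize_iff.1 (h2 M _ default)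
    rw [BoundedFormula.realize_iff]
    have h4 : (BoundedFormula.relabel (n := m) id χ).Realize v xs ↔
        Formula.Realize χ (Sum.elim v xs) := by
      rw [BoundedFormula.realize_relabel, Formula.Realize]
      exact iff_of_eq (congrArg₂ _ rfl (Subsingleton.elim _ _))
    rw [h4, BoundedFormula.realize_ex]
    rw [BoundedFormula.realize_toFormula, BoundedFormula.realize_ex] at h3
    refine _root_.Iff.trans (exists_congr fun x ↦ ?_) h3
    have h5 := h1 M v (Fin.snoc xs x)
    rw [BoundedFormula.realize_iff] at h5
    exact h5

end Theory

end FirstOrder.Language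

/-! ### Amalgamation of `F`-fields -/

namespace FDerivation

variable {k : Type u} [CommRing k] {e : ℕ} {F : FormalGroupLaw k e}

open scoped TensorProduct in
/-- Two fields containing an integral domain have a common extension field. -/
theorem _root_.exists_field_amalgam {A : Type*} {M : Type v} {N : Type w} [CommRing A]
    [Field M] [Field N] (f : A →+* M) (g : A →+* N) (hf : Function.Injective f)
    (hg : Function.Injective g) :
    ∃ (Ω : Type (max v w)) (_ : Field Ω) (f' : M →+* Ω) (g' : N →+* Ω), f'.comp f = g'.comp g := by
  let := f.toAlgebra
  let := g.toAlgebra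
  have : Nontrivial (M ⊗[A] N) :=
    Algebra.TensorProduct.nontrivial_of_algebraMap_injective_of_isDomain A M N hf hg
  obtain ⟨I, hI⟩ := Ideal.exists_maximal (M ⊗[A] N)
  refine ⟨(M ⊗[A] N) ⧸ I, Ideal.Quotient.field I,
    (Ideal.Quotient.mk I).comp Algebra.TensorProduct.includeLeftRingHom,
    (Ideal.Quotient.mk I).comp Algebra.TensorProduct.includeRight.toRingHom, ?_⟩
  ext a
  exact congrArg (Ideal.Quotient.mk I)
    ((Algebra.TensorProduct.includeRight : N →ₐ[A] M ⊗[A] N).commutes a).symm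

/-- Two `F`-fields have a common extension over a common `F`-subring. The subring is given by the
graph `G` of an isomorphism between `F`-subrings: a common extension `Ω` of the fields induces
homomorphisms to the cofree `F`-ring over `Ω`, whose fraction field is an `F`-field. -/
theorem exists_amalgam {M : Type v} {N : Type w} [Field M] [Field N] [Algebra k M] [Algebra k N]
    (dM : FDerivation F M) (dN : FDerivation F N) (G : Subalgebra k (M × N))
    (hM : ∀ x ∈ G, x.1 = 0 → x.2 = 0) (hN : ∀ x ∈ G, x.2 = 0 → x.1 = 0)
    (hD : ∀ i, ∀ x ∈ G, (dM.D i x.1, dN.D i x.2) ∈ G) :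
    ∃ (K : Type (max v w)) (_ : Field K) (_ : Algebra k K) (dK : FDerivation F K) (f : M →ₐ[k] K)
      (g : N →ₐ[k] K), (∀ i x, f (dM.D i x) = dK.D i (f x)) ∧
      (∀ i x, g (dN.D i x) = dK.D i (g x)) ∧ ∀ x ∈ G, f x.1 = g x.2 := by
  obtain ⟨Ω, _, f', g', h⟩ := exists_field_amalgam ((RingHom.fst M N).comp G.val.toRingHom)
    ((RingHom.snd M N).comp G.val.toRingHom)
    ((injective_iff_map_eq_zero _).2 fun x hx ↦ Subtype.ext (Prod.ext hx (hM x x.2 hx)))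
    ((injective_iff_map_eq_zero _).2 fun x hx ↦ Subtype.ext (Prod.ext (hN x x.2 hx) hx))
  have h' : ∀ x ∈ G, f' x.1 = g' x.2 := fun x hx ↦ RingHom.congr_fun h ⟨x, hx⟩
  let := (f'.comp (algebraMap k M)).toAlgebra
  let f₀ : M →ₐ[k] Ω := { f' with commutes' := fun _ ↦ rfl }
  let g₀ : N →ₐ[k] Ω := { g' with commutes' := fun c ↦ (h' _ (G.algebraMap_mem c)).symm }
  let V := MvPowerSeries (Fin e) Ω
  let Q := FractionRing V
  let dQ : FDerivation F Q := (F.cofree Ω).fraction Q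
  refine ⟨Q, inferInstance, inferInstance, dQ,
    { (algebraMap V Q).comp (dM.toCofree f₀) with commutes' := fun c ↦ ?_ },
    { (algebraMap V Q).comp (dN.toCofree g₀) with commutes' := fun c ↦ ?_ },
    fun i x ↦ ?_, fun i x ↦ ?_, fun x hx ↦ ?_⟩
  · change algebraMap V Q (dM.toCofree f₀ _) = _
    rw [toCofree_algebraMap, ← IsScalarTower.algebraMap_apply k V Q]
  · change algebraMap V Q (dN.toCofree g₀ _) = _
    rw [toCofree_algebraMap, ← IsScalarTower.algebraMap_apply k V Q]
  · change algebraMap V Q (dM.toCofree f₀ (dM.D i x)) = dQ.D i (algebraMap V Q _)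
    rw [← D_toCofree]
    exact ((F.cofree Ω).D_fraction_algebraMap Q i _).symm
  · change algebraMap V Q (dN.toCofree g₀ (dN.D i x)) = dQ.D i (algebraMap V Q _)
    rw [← D_toCofree]
    exact ((F.cofree Ω).D_fraction_algebraMap Q i _).symm
  · refine congrArg (algebraMap V Q) ?_
    ext i
    exact h' _ (hD i x hx)

end FDerivation

/-! ### Model theory of `F`-fields -/

namespace FDerivation

variable {k : Type u} [CommRing k] {e : ℕ} {F : FormalGroupLaw k e}
  {M : Type v} [Field M] [Algebra k M] (dM : FDerivation F M)
  {K : Type w} [Field K] [Algebra k K] (dK : FDerivation F K)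

/-- A homomorphism of `F`-fields, as an embedding of structures. -/
def embedding (f : M →ₐ[k] K) (hf : ∀ i x, f (dM.D i x) = dK.D i (f x)) :
    @Embedding (HSLang k e) M K dM.toStructure dK.toStructure :=
  let _ := dM.toStructure
  let _ := dK.toStructure
  { toFun := f
    inj' := f.toRingHom.injective
    map_fun' := fun {n} g x ↦ by
      match n, g with
      | _, Sum.inl .add => exact map_add f _ _
      | _, Sum.inl .mul => exact map_mul f _ _
      | _, Sum.inl .neg => exact map_neg f _
      | _, Sum.inl .zero => exact map_zero f
      | _, Sum.inl .one => exact map_one f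
      | _, Sum.inr (.const a) => exact f.commutes a
      | _, Sum.inr (.deriv i) => exact hf i _
    map_rel' := fun {n} r ↦ match r with
      | Sum.inl r => r.elim
      | Sum.inr r => r.elim }

variable {dM dK}

/-- The values of a term at related tuples are related, for any relation which is a subalgebra of
`K × M` and is closed under sufficiently many of the operators `D_i`. -/
theorem exists_forall_realize_mem {γ : Type*} (t : (HSLang k e).Term γ) :
    letI := dM.toStructure
    letI := dK.toStructure
    ∃ q : ℕ, ∀ G : Subalgebra k (K × M),
      (∀ i, (∀ s, i s < q) → ∀ x ∈ G, (dK.D i x.1, dM.D i x.2) ∈ G) →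
      ∀ (v : γ → K) (u : γ → M), (∀ c, (v c, u c) ∈ G) → (t.realize v, t.realize u) ∈ G := by
  let _ := dM.toStructure
  let _ := dK.toStructure
  induction t with
  | var c => exact ⟨0, fun G _ v u h ↦ h c⟩
  | @func n g ts ih =>
    obtain ⟨q₀, h1⟩ : ∃ q₀ : ℕ, ∀ (q' : ℕ) (G : Subalgebra k (K × M)), q₀ ≤ q' →
        (∀ i, (∀ s, i s < q') → ∀ x ∈ G, (dK.D i x.1, dM.D i x.2) ∈ G) →
        ∀ (v : γ → K) (u : γ → M), (∀ c, (v c, u c) ∈ G) →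
          ∀ j, ((ts j).realize v, (ts j).realize u) ∈ G := by
      choose q hq using ih
      exact ⟨Finset.univ.sup q, fun q' G hq' hG v u h j ↦ hq j G (fun i hi ↦ hG i fun s ↦
        (hi s).trans_le ((Finset.le_sup (Finset.mem_univ j)).trans hq')) v u h⟩
    clear ih
    match n, g, ts, h1 with
    | _, Sum.inl .add, ts, h1 =>
      exact ⟨q₀, fun G hG v u h ↦ G.add_mem (h1 _ G le_rfl hG v u h 0) (h1 _ G le_rfl hG v u h 1)⟩
    | _, Sum.inl .mul, ts, h1 =>
      exact ⟨q₀, fun G hG v u h ↦ G.mul_mem (h1 _ G le_rfl hG v u h 0) (h1 _ G le_rfl hG v u h 1)⟩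
    | _, Sum.inl .neg, ts, h1 => exact ⟨q₀, fun G hG v u h ↦ G.neg_mem (h1 _ G le_rfl hG v u h 0)⟩
    | _, Sum.inl .zero, ts, h1 => exact ⟨q₀, fun G hG v u h ↦ G.zero_mem⟩
    | _, Sum.inl .one, ts, h1 => exact ⟨q₀, fun G hG v u h ↦ G.one_mem⟩
    | _, Sum.inr (.const a), ts, h1 => exact ⟨q₀, fun G hG v u h ↦ G.algebraMap_mem a⟩
    | _, Sum.inr (.deriv i), ts, h1 =>
      refine ⟨max q₀ (i.degree + 1), fun G hG v u h ↦ ?_⟩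
      exact hG i (fun s ↦ lt_max_of_lt_right (Nat.lt_succ_of_le (Finsupp.le_degree s i))) _
        (h1 _ G (le_max_left _ _) hG v u h 0)

/-- The truth of a quantifier-free formula at a tuple is preserved by specializations which commute
with sufficiently many of the operators `D_i` and are defined at sufficiently many elements: an
inequality `s ≠ t` is preserved if the specialization is defined at the inverse of `s - t`. The
specialization is given by its graph `G`. -/
theorem exists_forall_realize_iff {γ : Type*} {n : ℕ} {θ : (HSLang k e).BoundedFormula γ n}
    (hθ : θ.IsQF) (v : γ → K) (xs : Fin n → K) :
    letI := dM.toStructure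
    letI := dK.toStructure
    ∃ (q : ℕ) (Z : Finset K), ∀ G : Subalgebra k (K × M), (∀ x, (0, x) ∈ G → x = 0) →
      (∀ i, (∀ s, i s < q) → ∀ x ∈ G, (dK.D i x.1, dM.D i x.2) ∈ G) →
      (∀ z ∈ Z, ∃ x, (z, x) ∈ G) → ∀ (u : γ → M) (ys : Fin n → M),
      (∀ c, (Sum.elim v xs c, Sum.elim u ys c) ∈ G) → (θ.Realize v xs ↔ θ.Realize u ys) := by
  classical
  let _ := dM.toStructure
  let _ := dK.toStructure
  induction hθ with
  | falsum => exact ⟨0, ∅, fun _ _ _ _ _ _ _ ↦ Iff.rfl⟩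
  | imp _ _ ih₁ ih₂ =>
    obtain ⟨q₁, Z₁, h₁⟩ := ih₁
    obtain ⟨q₂, Z₂, h₂⟩ := ih₂
    refine ⟨max q₁ q₂, Z₁ ∪ Z₂, fun G h0 hD hZ u ys hu ↦ ?_⟩
    rw [BoundedFormula.realize_imp, BoundedFormula.realize_imp,
      h₁ G h0 (fun i hi ↦ hD i fun s ↦ lt_max_of_lt_left (hi s))
        (fun z hz ↦ hZ z (Finset.mem_union_left _ hz)) u ys hu,
      h₂ G h0 (fun i hi ↦ hD i fun s ↦ lt_max_of_lt_right (hi s))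
        (fun z hz ↦ hZ z (Finset.mem_union_right _ hz)) u ys hu]
  | of_isAtomic h =>
    cases h with
    | rel R ts =>
      match R with
      | Sum.inl r => exact r.elim
      | Sum.inr r => exact r.elim
    | equal t₁ t₂ =>
      obtain ⟨q₁, h₁⟩ := exists_forall_realize_mem (dM := dM) (dK := dK) t₁
      obtain ⟨q₂, h₂⟩ := exists_forall_realize_mem (dM := dM) (dK := dK) t₂
      refine ⟨max q₁ q₂, {(t₁.realize (Sum.elim v xs) - t₂.realize (Sum.elim v xs))⁻¹},
        fun G h0 hD hZ u ys hu ↦ ?_⟩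
      have hm : (t₁.realize (Sum.elim v xs) - t₂.realize (Sum.elim v xs),
          t₁.realize (Sum.elim u ys) - t₂.realize (Sum.elim u ys)) ∈ G := G.sub_mem
        (h₁ G (fun i hi ↦ hD i fun s ↦ lt_max_of_lt_left (hi s)) _ _ hu)
        (h₂ G (fun i hi ↦ hD i fun s ↦ lt_max_of_lt_right (hi s)) _ _ hu)
      rw [BoundedFormula.realize_bdEqual, BoundedFormula.realize_bdEqual, ← sub_eq_zero,
        ← sub_eq_zero (b := t₂.realize (Sum.elim u ys))]
      constructor
      · intro h
        rw [h] at hm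
        exact h0 _ hm
      · intro h
        by_contra hne
        obtain ⟨x, hx⟩ := hZ _ (Finset.mem_singleton_self _)
        have h3 : (1 - _ * _, 1 - x * _) ∈ G := G.sub_mem G.one_mem (G.mul_mem hx hm)
        rw [inv_mul_cancel₀ hne, h, sub_self, mul_zero, sub_zero] at h3
        have h4 := h0 1 h3
        exact one_ne_zero h4

end FDerivation

theorem FirstOrder.Language.BoundedFormula.IsQF.realize_comp_embedding {L : Language.{u, v}}
    {M N α : Type*} [L.Structure M] [L.Structure N] {ψ : L.Formula α} (hψ : IsQF ψ) (f : M ↪[L] N)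
    (a : α → M) : Formula.Realize ψ (f ∘ a) ↔ Formula.Realize ψ a := by
  rw [Formula.Realize, Formula.Realize, ← hψ.realize_embedding f]
  exact iff_of_eq (congrArg _ (Subsingleton.elim _ _))

namespace FDerivation

variable {k : Type u} [CommRing k] {e : ℕ} {F : FormalGroupLaw k e}

/-- The set of pairs of values of a term at a tuple `a` of an `F`-field and at a tuple `b` of
another `F`-field. If the tuples satisfy the same quantifier-free formulas, then this is the graph
of an isomorphism between the `F`-subrings which they generate. -/
def termGraph {M : Type v} {N : Type w} [Field M] [Field N] [Algebra k M] [Algebra k N]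
    (dM : FDerivation F M) (dN : FDerivation F N) {γ : Type*} (a : γ → M) (b : γ → N) :
    Subalgebra k (M × N) :=
  letI := dM.toStructure
  letI := dN.toStructure
  { carrier := Set.range fun t : (HSLang k e).Term γ ↦ (t.realize a, t.realize b)
    add_mem' := by
      rintro _ _ ⟨s, rfl⟩ ⟨t, rfl⟩
      exact ⟨s + t, by simp only [dM.interp.realize_add, dN.interp.realize_add, Prod.mk_add_mk]⟩
    mul_mem' := by
      rintro _ _ ⟨s, rfl⟩ ⟨t, rfl⟩
      exact ⟨s * t, by simp only [dM.interp.realize_mul, dN.interp.realize_mul, Prod.mk_mul_mk]⟩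
    algebraMap_mem' := fun c ↦
      ⟨cst c, by simp only [dM.interp.realize_cst, dN.interp.realize_cst]; rfl⟩ }

/-- Tuples of `F`-fields `M` and `N` satisfying the same quantifier-free formulas have the same
image in some common extension. -/
theorem exists_amalgam_of_isQF {M : Type v} {N : Type w} [Field M] [Field N] [Algebra k M]
    [Algebra k N] (dM : FDerivation F M) (dN : FDerivation F N) {γ : Type*} (a : γ → M)
    (b : γ → N) :
    letI := dM.toStructure
    letI := dN.toStructure
    (∀ ψ : (HSLang k e).Formula γ, ψ.IsQF → ψ.Realize a → ψ.Realize b) →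
    ∃ (K : Type (max v w)) (_ : Field K) (_ : Algebra k K) (dK : FDerivation F K) (f : M →ₐ[k] K)
      (g : N →ₐ[k] K), (∀ i x, f (dM.D i x) = dK.D i (f x)) ∧
      (∀ i x, g (dN.D i x) = dK.D i (g x)) ∧ ∀ c, f (a c) = g (b c) := by
  let _ := dM.toStructure
  let _ := dN.toStructure
  intro h
  obtain ⟨K, _, _, dK, f, g, hf, hg, hfg⟩ := dM.exists_amalgam dN (dM.termGraph dN a b)
    (by
      rintro _ ⟨t, rfl⟩ h0
      have := h (t.equal 0) (BoundedFormula.IsAtomic.equal _ _).isQF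
      simp only [Formula.realize_equal, dM.interp.realize_zero, dN.interp.realize_zero] at this
      exact this h0)
    (by
      rintro _ ⟨t, rfl⟩ h0
      have := h (t.equal 0).not (BoundedFormula.IsAtomic.equal _ _).isQF.not
      simp only [Formula.realize_equal, Formula.realize_not, dM.interp.realize_zero,
        dN.interp.realize_zero] at this
      by_contra hne
      exact this hne h0)
    (by
      rintro i _ ⟨t, rfl⟩
      exact ⟨HSLang.D i t, by simp only [dM.interp.realize_D, dN.interp.realize_D]⟩)
  exact ⟨K, _, _, dK, f, g, hf, hg, fun c ↦ hfg (a c, b c) ⟨Term.var c, rfl⟩⟩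

end FDerivation

section FDCF

variable (p : ℕ) [hp : Fact p.Prime] {k : Type u} [CommRing k] [CharP k p] {e : ℕ}
  (F : FormalGroupLaw k e)

/-- An existential formula which holds at a tuple `a` of an `F`-field holds at a tuple `b` of a model
of `F-DCF` which satisfies the same quantifier-free formulas: after amalgamation, a solution in `M`
becomes a solution in an extension of `N`, which is specialized to `N`. -/
theorem FDCF.exists_realize {M N : Type w} [SM : (HSLang k e).Structure M]
    [SN : (HSLang k e).Structure N] (hM : M ⊨ FDF F) (hN : N ⊨ FDCF p F) {γ : Type v}
    (a : γ → M) (b : γ → N)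
    (hab : ∀ ψ : (HSLang k e).Formula γ, ψ.IsQF → ψ.Realize a → ψ.Realize b)
    (θ : (HSLang k e).Formula (Option γ)) (hθ : θ.IsQF) (x : M)
    (hx : θ.Realize fun o ↦ o.elim x a) : ∃ y : N, θ.Realize fun o ↦ o.elim y b := by
  have hN' : N ⊨ FDF F := by
    simp only [FDCF, Theory.model_union_iff] at hN
    exact hN.1.1.1
  obtain ⟨_, _, dM, rfl⟩ := exists_FDerivation_of_model_FDF hM
  obtain ⟨_, _, dN, rfl⟩ := exists_FDerivation_of_model_FDF hN'
  have : CharP N p := charP_of_algebra k N p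
  obtain ⟨hstrict, hsep, hfin⟩ := (dN.model_FDCF_iff p).1 hN
  obtain ⟨K, _, _, dK, f, g, hf, hg, hfg⟩ := dM.exists_amalgam_of_isQF dN a b hab
  have : CharP K p := charP_of_algebra k K p
  let _ := dK.toStructure
  let _ := dM.toStructure
  obtain ⟨q, Z, H⟩ := FDerivation.exists_forall_realize_iff (dM := dN) (dK := dK) hθ
    (fun o ↦ o.elim (f x) (f ∘ a)) default
  classical
  obtain ⟨G, hG0, hGg, hGD, hGZ⟩ := FDerivation.exists_specialization (dK := dK) p hstrict hfin
    (g : N →+* K) hg q (insert (f x) Z)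
  let G' : Subalgebra k (K × N) :=
    { G with
      algebraMap_mem' := fun c ↦ by
        have := hGg (algebraMap k N c)
        rwa [RingHom.coe_coe, g.commutes] at this }
  obtain ⟨y, hy⟩ := hGZ (f x) (Finset.mem_insert_self _ _)
  refine ⟨y, (H G' hG0 (fun i hi ↦ hGD i fun s ↦ (hi s).trans (Nat.lt_pow_self hp.out.one_lt))
    (fun z hz ↦ hGZ z (Finset.mem_insert_of_mem hz)) _ _ ?_).1 ?_⟩
  -- The tuple `(f x, f a)` is specialized to `(y, b)`.
  · rintro ((_ | c) | c)
    · exact hy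
    · have := hGg (b c)
      change (f (a c), b c) ∈ G
      rw [hfg]
      exact this
    · exact c.elim0
  · have h1 := (hθ.realize_comp_embedding (dM.embedding dK f hf) fun o ↦ o.elim x a).2 hx
    have h2 : (dM.embedding dK f hf) ∘ (fun o : Option γ ↦ o.elim x a) =
        fun o ↦ o.elim (f x) (f ∘ a) := by
      funext o
      cases o <;> rfl
    rw [h2] at h1
    exact h1

/-- `F-DCF` has quantifier elimination, for formulas with free variables from any type. -/
theorem FDCF.exists_isQF_iff {γ : Type v} {n : ℕ} (φ : (HSLang k e).BoundedFormula γ n) :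
    ∃ ψ : (HSLang k e).BoundedFormula γ n, ψ.IsQF ∧ FDCF p F ⊨ᵇ φ.iff ψ :=
  Theory.exists_isQF_iff_of_exists_realize (fun n M N a b hab θ hθ x hx ↦
    FDCF.exists_realize p F (by
      have := M.is_model
      simp only [FDCF, Theory.model_union_iff] at this
      exact this.1.1.1) N.is_model a b hab θ hθ x hx) φ

theorem exists_embedding_model_FDCF {M : Type w} [SM : (HSLang k e).Structure M] (hM : M ⊨ FDF F) :
    ∃ (N : Type w) (_ : Nonempty N) (_ : (HSLang k e).Structure N), N ⊨ FDCF p F ∧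
      Nonempty (M ↪[HSLang k e] N) := by
  obtain ⟨_, _, dM, rfl⟩ := exists_FDerivation_of_model_FDF hM
  obtain ⟨N, _, _, _, dN, ι, hι, hιk, hN⟩ := dM.exists_extension p
  exact ⟨N, inferInstance, dN.toStructure, (dN.model_FDCF_iff p).2 hN,
    ⟨dM.embedding dN { ι with commutes' := hιk } hι⟩⟩

end FDCF

namespace FirstOrder.Language

variable {L : Language.{u, v}} {M : Type w}

theorem isAtomic_equivSentence {ψ : L.Formula M} (h : BoundedFormula.IsAtomic ψ) :
    BoundedFormula.IsAtomic (Formula.equivSentence ψ) := by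
  cases h with
  | equal t₁ t₂ => exact .equal _ _
  | rel R ts => exact .rel _ _

theorem isAtomic_equivSentence_symm {χ : L[[M]].Sentence} (h : BoundedFormula.IsAtomic χ) :
    BoundedFormula.IsAtomic (Formula.equivSentence.symm χ : L.Formula M) := by
  cases h with
  | equal t₁ t₂ => exact .equal _ _
  | rel R ts => exact .rel _ _

variable [L.Structure M]

/-- A structure with an embedding of `M` is a model of the diagram of `M`. -/
theorem model_diagram_of_embedding {N : Type*} [L.Structure N] (f : M ↪[L] N) :
    letI := constantsOn.structure f
    N ⊨ Theory.diagram L M := by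
  let := constantsOn.structure (M := N) f
  have key : ∀ χ : L[[M]].Sentence, BoundedFormula.IsAtomic χ → (N ⊨ χ ↔ M ⊨ χ) := fun χ hχ ↦ by
    rw [← Formula.realize_equivSentence_symm_con, ← Formula.realize_equivSentence_symm_con]
    exact (isAtomic_equivSentence_symm hχ).isQF.realize_comp_embedding f fun a ↦ (L.con a : M)
  refine ⟨fun χ hχ ↦ ?_⟩
  obtain ⟨h1, h2 | ⟨ψ, hψ, rfl⟩⟩ := hχ
  · exact (key χ h2).2 h1
  · rw [Sentence.realize_not] at h1 ⊢
    rwa [key ψ hψ]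

/-- In a model of the diagram of `M`, the same quantifier-free formulas hold at `M` as in `M`. -/
theorem realize_equivSentence_iff_of_model_diagram {N : Type*} [L[[M]].Structure N]
    (hN : N ⊨ Theory.diagram L M) {ψ : L.Formula M} (hψ : BoundedFormula.IsQF ψ) :
    N ⊨ Formula.equivSentence ψ ↔ M ⊨ Formula.equivSentence ψ := by
  induction hψ with
  | falsum => exact Iff.rfl
  | @of_isAtomic χ h =>
    by_cases hM : M ⊨ Formula.equivSentence χ
    · exact iff_of_true (hN.realize_of_mem _ ⟨hM, .inl (isAtomic_equivSentence h)⟩) hM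
    · refine iff_of_false ?_ hM
      rw [← Sentence.realize_not] at hM ⊢
      exact hN.realize_of_mem _ ⟨hM, .inr ⟨_, isAtomic_equivSentence h, rfl⟩⟩
  | @imp φ₁ φ₂ _ _ ih₁ ih₂ =>
    exact imp_congr ih₁ ih₂

end FirstOrder.Language

/-- Both the model completeness of `F-DCF` and the completeness of its union with a diagram follow
from quantifier elimination. -/
theorem FDCF.isModelCompletion (p : ℕ) [Fact p.Prime] {k : Type u} [CommRing k] [CharP k p]
    {e : ℕ} (F : FormalGroupLaw k e) :
    Theory.IsModelCompletion.{u, 0, w} (FDF F) (FDCF p F) := by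
  refine ⟨⟨fun M ↦ ?_, fun N ↦ ?_, fun M N f n φ x ↦ ?_⟩, fun M ↦ ⟨?_, fun σ ↦ ?_⟩⟩
  · obtain ⟨N, _, _, hN, hMN⟩ := exists_embedding_model_FDCF p F M.is_model
    exact ⟨Theory.ModelType.of _ N, hMN⟩
  · have hN := N.is_model
    simp only [FDCF, Theory.model_union_iff] at hN
    have := hN.1.1.1
    exact ⟨Theory.ModelType.of _ N, ⟨Embedding.refl _ _⟩⟩
  · obtain ⟨ψ, hψ, h⟩ := FDCF.exists_isQF_iff p F φ
    have h1 : ∀ (K : Theory.ModelType.{u, 0, max u w} (FDCF p F)) (y : Fin n → K),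
        φ.Realize y ↔ Formula.Realize ψ y := fun K y ↦
      BoundedFormula.realize_iff.1 (h.realize_boundedFormula K)
    rw [h1, h1]
    exact hψ.realize_comp_embedding f x
  · obtain ⟨N, _, _, hN, ⟨f⟩⟩ := exists_embedding_model_FDCF p F M.is_model
    let := constantsOn.structure (M := N) f
    have : N ⊨ ((HSLang k e).lhomWithConstants M).onTheory (FDCF p F) ∪ Theory.diagram _ M :=
      Theory.model_union_iff.2 ⟨(LHom.onTheory_model _ _).2 hN, model_diagram_of_embedding f⟩
    exact Theory.Model.isSatisfiable N
  · obtain ⟨φ, rfl⟩ := Formula.equivSentence.surjective σ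
    obtain ⟨ψ, hψ, h⟩ := FDCF.exists_isQF_iff p F φ
    rw [Theory.models_formula_iff_onTheory_models_equivSentence] at h
    have key : ∀ N : Theory.ModelType.{max u w, 0, max u w}
        (((HSLang k e).lhomWithConstants M).onTheory (FDCF p F) ∪ Theory.diagram _ M),
        N ⊨ Formula.equivSentence φ ↔ M ⊨ Formula.equivSentence ψ := fun N ↦ by
      have hN := Theory.model_union_iff.1 N.is_model
      rw [← realize_equivSentence_iff_of_model_diagram hN.2 hψ]
      have := hN.1
      exact Formula.realize_iff.1 (h.realize_sentence N)
    by_cases hM : M ⊨ Formula.equivSentence ψ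
    · exact .inl (Theory.models_sentence_iff.2 fun N ↦ (key N).2 hM)
    · refine .inr (Theory.models_sentence_iff.2 fun N ↦ ?_)
      rw [Sentence.realize_not, key]
      exact hM

end

theorem mainTheorem2 (p : ℕ) [Fact p.Prime] {k : Type u} [CommRing k] [CharP k p]
    [PerfectRing k p] (e : ℕ) (he : 0 < e) (F : FormalGroupLaw k e) :
    FirstOrder.Language.Theory.IsModelCompletion.{u, 0, w} (FDF F) (FDCF p F) ∧
      (FDCF p F).HasQuantifierElimination :=
  ⟨FDCF.isModelCompletion p F, fun _ φ ↦ FDCF.exists_isQF_iff p F φ⟩
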